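/- **Setup.** Let $\Gamma$ be a countable discrete group acting measurably and measure-preservingly on a standard probability space $(X,\mu)$, and let $A=L^\infty(X)$ with the action $(g\cdot a)(x)=a(g^{-1}x)$. Let $\pi\colon\Gamma\to O(H)$ be a mixing orthogonal representation on a real Hilbert space $H$ (i.e. $\langle\pi(g)\xi,\eta\rangle\to 0$ as $g\to\infty$ for all $\xi,\eta\in H$), and let $b\colon\Gamma\to H$ be a $1$-cocycle, i.e. $b(gh)=\pi(g)b(h)+b(g)$ for all $g,h\in\Gamma$. Fix an orthonormal basis $(e_i)_{i\in I}$ of $H$, let $(Z,\nu)=\prod_{i\in I}\bigl(\mathbb R,\tfrac1{\sqrt{2\pi}}e^{-x^2/2}dx\bigr)$, and for $\xi=\sum_i c_ie_i\in H$ let $\omega(\xi)\in\mathcal U(L^\infty(Z))$ be the function $(z_i)_i\mapsto\exp\bigl(\sqrt2\,i\sum_i c_iz_i\bigr)$, where the series converges in $L^2(Z)$. Let $D\subset L^\infty(Z)$ be the von Neumann algebra generated by $\{\omega(\xi):\xi\in H\}$, with the trace-preserving $\Gamma$-action determined by $g\cdot\omega(\xi)=\omega(\pi(g)\xi)$. Put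 $$M=A\rtimes\Gamma=(1\otimes A)\rtimes\Gamma\ \subset\ \tilde M=(D\,\bar\otimes\,A)\rtimes\Gamma ,$$ where $\Gamma$ acts diagonally on $D\,\bar\otimes\,A$. Let $(u_g)_{g\in\Gamma}$ be the canonical unitaries, $\tau$ the canonical trace on $\tilde M$, and $\|x\|_2=\tau(x^*x)^{1/2}$. For $t\in\mathbb R$ let $\alpha_t$ be the $*$-automorphism of $\tilde M$ that is conjugation, in the regular representation of $\tilde M$ on $\ell^2(\Gamma,L^2(Z\times X))$, by the unitary which multiplies in the fibre over $g$ by $\omega(t\,\pi(g)^{-1}b(g))\otimes1$; it satisfies $$\alpha_t|_{D\bar\otimes A}=\mathrm{id},\qquad \alpha_t(u_g)=(\omega(t\,b(g))\otimes 1)\,u_g\quad(g\in\Gamma).$$ For $x\in M$ and $g\in\Gamma$ let $(x)_g=E_A(xu_g^*)$ be the Fourier coefficient of $x$ at $g$, where $E_A\colon M\to A$ is the trace-preserving conditional expectation. **Theorem.** Let $B\subset M$ be an abelian von Neumann subalgebra (with the same unit), let $t>0$, and let $(v_n)_{n\in\mathbb N}$ be a sequence in the normalizer $\mathcal N_M(B)=\{u\in\mathcal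 U(M): u^*Bu=B\}$ such that (a) $\|\alpha_t(v_n)-v_n\|_2<\tfrac1{200}$ for all $n\in\mathbb N$; (b) for every $g\in\Gamma$, $\|(v_n)_g\|_2\to0$ as $n\to\infty$. Then there is a non-zero partial isometry $v\in\tilde M$ such that $\alpha_t(x)v=vx$ for all $x\in B$. -/

import Mathlib

open MeasureTheory ProbabilityTheory Filter Topology
open scoped ENNReal

set_option linter.unusedSectionVars false

noncomputable section

namespace GaussianDeformation

/-! ### Von Neumann algebras of operators -/

section VonNeumann

variable {𝓚 : Type*} [NormedAddCommGroup 𝓚] [InnerProductSpace ℂ 𝓚] [CompleteSpace 𝓚]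

instance : SMulMemClass (VonNeumannAlgebra 𝓚) ℂ (𝓚 →L[ℂ] 𝓚) where
  smul_mem {s} c x hx :=
    show c • x ∈ s.toStarSubalgebra from
      SMulMemClass.smul_mem c (show x ∈ s.toStarSubalgebra from hx)

/-- The von Neumann algebra generated by a set `S` of bounded operators: the double commutant of
`S ∪ S*`. -/
def vnGen (S : Set (𝓚 →L[ℂ] 𝓚)) : VonNeumannAlgebra 𝓚 where
  toStarSubalgebra := StarSubalgebra.centralizer ℂ
    (StarSubalgebra.centralizer ℂ S : Set (𝓚 →L[ℂ] 𝓚))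
  centralizer_centralizer' := by simp

theorem coe_vnGen (S : Set (𝓚 →L[ℂ] 𝓚)) :
    (vnGen S : Set (𝓚 →L[ℂ] 𝓚)) = Set.centralizer (Set.centralizer (S ∪ star S)) :=
  StarSubalgebra.coe_centralizer_centralizer ℂ S

theorem subset_vnGen (S : Set (𝓚 →L[ℂ] 𝓚)) : S ⊆ vnGen S := by
  rw [coe_vnGen]
  exact Set.subset_union_left.trans Set.subset_centralizer_centralizer

/-- The von Neumann algebra generated by `S` is the smallest one that contains `S`. -/
theorem vnGen_le {S : Set (𝓚 →L[ℂ] 𝓚)} {N : VonNeumannAlgebra 𝓚} (h : S ⊆ N) :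
    vnGen S ≤ N := by
  have h2 : S ∪ star S ⊆ N := by
    refine Set.union_subset h fun x hx => ?_
    have := h hx
    simpa using star_mem (this : star x ∈ N)
  rw [← SetLike.coe_subset_coe, coe_vnGen, ← N.centralizer_centralizer]
  exact Set.centralizer_subset (Set.centralizer_subset h2)

/-- Conjugation by a unitary `w` maps `vnGen S` into `N` as soon as it maps `S` into `N`. -/
theorem conj_mem_of_mem_vnGen {S : Set (𝓚 →L[ℂ] 𝓚)} {N : VonNeumannAlgebra 𝓚}
    {w : 𝓚 →L[ℂ] 𝓚} (h1 : star w * w = 1) (h2 : w * star w = 1)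
    (h : ∀ s ∈ S, w * s * star w ∈ N) {x : 𝓚 →L[ℂ] 𝓚} (hx : x ∈ vnGen S) :
    w * x * star w ∈ N := by
  have h' : ∀ s ∈ S ∪ star S, w * s * star w ∈ N := by
    rintro s (hs | hs)
    · exact h s hs
    · have := star_mem (h _ hs)
      simpa [mul_assoc] using this
  rw [← SetLike.mem_coe, coe_vnGen] at hx
  rw [← SetLike.mem_coe, ← N.centralizer_centralizer]
  intro y hy
  have key : star w * y * w ∈ Set.centralizer (S ∪ star S) := by
    intro s hs
    have h3 : w * s * star w * y = y * (w * s * star w) := hy _ (h' s hs)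
    calc s * (star w * y * w) = star w * (w * s * star w * y) * w := by
          simp only [← mul_assoc]; rw [h1, one_mul]
      _ = star w * y * w * s * (star w * w) := by rw [h3]; simp only [mul_assoc]
      _ = star w * y * w * s := by rw [h1, mul_one]
  have h4 : star w * y * w * x = x * (star w * y * w) := hx _ key
  calc y * (w * x * star w) = (w * star w) * y * w * x * star w := by
        rw [h2, one_mul]; simp only [mul_assoc]
    _ = w * (star w * y * w * x) * star w := by simp only [mul_assoc]
    _ = w * x * star w * y * (w * star w) := by rw [h4]; simp only [mul_assoc]
    _ = w * x * star w * y := by rw [h2, mul_one]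

/-- The normalizer `{u ∈ 𝒰(N) | u* B u = B}` of `B` in `N`. -/
def normalizer (N B : VonNeumannAlgebra 𝓚) : Set (𝓚 →L[ℂ] 𝓚) :=
  {u | u ∈ N ∧ u ∈ unitary (𝓚 →L[ℂ] 𝓚) ∧
    (fun x => star u * x * u) '' (B : Set (𝓚 →L[ℂ] 𝓚)) = B}

end VonNeumann

/-! ### The Gaussian functor -/

section Gaussian

/-- The Gaussian space `Z = ℝ^ι` with the product of standard Gaussian measures. -/
def gaussianMeasure (ι : Type*) : Measure (ι → ℝ) :=
  Measure.infinitePi fun _ : ι => gaussianReal 0 1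

instance (ι : Type*) : IsProbabilityMeasure (gaussianMeasure ι) := by
  unfold gaussianMeasure; infer_instance

variable {ι : Type*}

theorem memLp_coord (i : ι) : MemLp (fun z : ι → ℝ => z i) 2 (gaussianMeasure ι) :=
  (memLp_id_gaussianReal' (μ := 0) (v := 1) 2 (by simp)).comp_measurePreserving
    (measurePreserving_eval_infinitePi (fun _ : ι => gaussianReal 0 1) i)

/-- The coordinate function `z ↦ z i` in `L²(Z)`. -/
def coord (i : ι) : Lp ℝ 2 (gaussianMeasure ι) := (memLp_coord i).toLp _

theorem orthonormal_coord : Orthonormal ℝ (coord (ι := ι)) := by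
  classical
  rw [orthonormal_iff_ite]
  intro i j
  have hint : inner ℝ (coord i) (coord j) = ∫ z : ι → ℝ, z i * z j ∂(gaussianMeasure ι) := by
    rw [L2.inner_def]
    refine integral_congr_ae ?_
    filter_upwards [(memLp_coord (ι := ι) i).coeFn_toLp, (memLp_coord (ι := ι) j).coeFn_toLp]
      with z h1 h2
    simp only [coord]
    rw [h1, h2]
    simp [mul_comm]
  have hmp : ∀ k : ι, MeasurePreserving (fun z : ι → ℝ => z k) (gaussianMeasure ι)
      (gaussianReal 0 1) := fun k =>
    measurePreserving_eval_infinitePi (fun _ : ι => gaussianReal 0 1) k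
  rw [hint]
  split_ifs with hij
  · subst hij
    have hsq : ∫ z : ι → ℝ, z i * z i ∂(gaussianMeasure ι) =
        ∫ x : ℝ, x * x ∂(gaussianReal 0 1) := by
      rw [← (hmp i).map_eq, integral_map (measurable_pi_apply i).aemeasurable (by fun_prop)]
    have hv := variance_fun_id_gaussianReal (μ := 0) (v := 1)
    rw [variance_eq_integral (by fun_prop)] at hv
    simp only [integral_id_gaussianReal, sub_zero] at hv
    rw [hsq]
    simpa [pow_two] using hv
  · have hind : IndepFun (fun z : ι → ℝ => z i) (fun z : ι → ℝ => z j) (gaussianMeasure ι) :=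
      (iIndepFun_infinitePi (P := fun _ : ι => gaussianReal 0 1) (X := fun _ (x : ℝ) => x)
        (fun _ => measurable_id)).indepFun hij
    have h0 : ∫ z : ι → ℝ, z i ∂(gaussianMeasure ι) = 0 := by
      have := integral_id_gaussianReal (μ := 0) (v := 1)
      rw [← (hmp i).map_eq, integral_map (measurable_pi_apply i).aemeasurable (by fun_prop)] at this
      exact this
    have := hind.integral_mul_eq_mul_integral
      (measurable_pi_apply i).aestronglyMeasurable (measurable_pi_apply j).aestronglyMeasurable
    simp only [Pi.mul_apply] at this
    rw [h0, zero_mul] at this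
    exact this

variable {H : Type*} [NormedAddCommGroup H] [InnerProductSpace ℝ H]

/-- The isometry `H → L²(Z)`, `∑ cₙ eₙ ↦ ∑ cₙ zₙ` (the series converges in `L²`). -/
def field (e : HilbertBasis ι ℝ H) : H →ₗᵢ[ℝ] Lp ℝ 2 (gaussianMeasure ι) :=
  (orthonormal_coord (ι := ι)).orthogonalFamily.linearIsometry.comp e.repr.toLinearIsometry

theorem field_basis (e : HilbertBasis ι ℝ H) (i : ι) : field e (e i) = coord i := by
  classical
  change (orthonormal_coord (ι := ι)).orthogonalFamily.linearIsometry (e.repr (e i)) = _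
  rw [e.repr_self, OrthogonalFamily.linearIsometry_apply_single]
  simp

/-- The function `exp(√2 i ∑ cₙ zₙ)` on `Z`, where `ξ = ∑ cₙ eₙ`. -/
def omegaFun (e : HilbertBasis ι ℝ H) (ξ : H) (z : ι → ℝ) : ℂ :=
  Complex.exp (((Real.sqrt 2 * field e ξ z : ℝ) : ℂ) * Complex.I)

theorem norm_omegaFun (e : HilbertBasis ι ℝ H) (ξ : H) (z : ι → ℝ) : ‖omegaFun e ξ z‖ = 1 :=
  Complex.norm_exp_ofReal_mul_I _

theorem memLp_omegaFun (e : HilbertBasis ι ℝ H) (ξ : H) :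
    MemLp (omegaFun e ξ) ∞ (gaussianMeasure ι) := by
  refine memLp_top_of_bound ?_ 1 (.of_forall fun z => (norm_omegaFun e ξ z).le)
  have := (Lp.aestronglyMeasurable (field e ξ)).aemeasurable
  unfold omegaFun
  exact AEMeasurable.aestronglyMeasurable (by fun_prop)

/-- The unitary `ω(ξ) ∈ L^∞(Z)`. -/
def omega (e : HilbertBasis ι ℝ H) (ξ : H) : Lp ℂ ∞ (gaussianMeasure ι) :=
  (memLp_omegaFun e ξ).toLp _

theorem coeFn_omega (e : HilbertBasis ι ℝ H) (ξ : H) :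
    omega e ξ =ᵐ[gaussianMeasure ι] omegaFun e ξ :=
  (memLp_omegaFun e ξ).coeFn_toLp

theorem omegaFun_add (e : HilbertBasis ι ℝ H) (ξ η : H) :
    omegaFun e (ξ + η) =ᵐ[gaussianMeasure ι] fun z => omegaFun e ξ z * omegaFun e η z := by
  have h : field e (ξ + η) =ᵐ[gaussianMeasure ι] field e ξ + field e η := by
    rw [map_add]; exact Lp.coeFn_add _ _
  filter_upwards [h] with z hz
  rw [omegaFun, hz, omegaFun, omegaFun, ← Complex.exp_add]
  simp only [Pi.add_apply]
  push_cast
  ring_nf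

theorem omegaFun_zero (e : HilbertBasis ι ℝ H) :
    omegaFun e (0 : H) =ᵐ[gaussianMeasure ι] fun _ => 1 := by
  have h : field e (0 : H) =ᵐ[gaussianMeasure ι] 0 := by
    rw [map_zero]; exact Lp.coeFn_zero _ _ _
  filter_upwards [h] with z hz
  rw [omegaFun, hz]
  simp

theorem omegaFun_neg (e : HilbertBasis ι ℝ H) (ξ : H) :
    omegaFun e (-ξ) =ᵐ[gaussianMeasure ι] fun z => star (omegaFun e ξ z) := by
  have h : field e (-ξ) =ᵐ[gaussianMeasure ι] -field e ξ := by
    rw [map_neg]; exact Lp.coeFn_neg _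
  filter_upwards [h] with z hz
  rw [omegaFun, hz, omegaFun, Complex.star_def, ← Complex.exp_conj]
  simp

theorem norm_omega_le (e : HilbertBasis ι ℝ H) (ξ : H) : ‖omega e ξ‖ ≤ 1 := by
  refine Lp.norm_le_of_ae_bound zero_le_one ?_ |>.trans (by simp)
  filter_upwards [(memLp_omegaFun e ξ).coeFn_toLp] with z hz
  rw [omega, hz, norm_omegaFun]

end Gaussian

/-! ### Multiplication operators -/

/-- The operator on `L²` of multiplication by an element of `L^∞`. -/
def mulOp {S : Type*} [MeasurableSpace S] {m : Measure S} (a : Lp ℂ ∞ m) :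
    Lp ℂ 2 m →L[ℂ] Lp ℂ 2 m :=
  (ContinuousLinearMap.mul ℂ ℂ).holderL m ∞ 2 2 a

theorem coeFn_mulOp {S : Type*} [MeasurableSpace S] {m : Measure S} (a : Lp ℂ ∞ m)
    (f : Lp ℂ 2 m) : mulOp a f =ᵐ[m] fun s => a s * f s :=
  (ContinuousLinearMap.mul ℂ ℂ).coeFn_holder a f

theorem norm_mulOp_le {S : Type*} [MeasurableSpace S] {m : Measure S} (a : Lp ℂ ∞ m) :
    ‖mulOp a‖ ≤ ‖a‖ := by
  refine ((ContinuousLinearMap.mul ℂ ℂ).holderL m ∞ 2 2).le_opNorm a |>.trans ?_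
  have h1 := (ContinuousLinearMap.norm_holderL_le (μ := m) (p := ∞) (q := 2) (r := 2)
    (ContinuousLinearMap.mul ℂ ℂ)).trans (ContinuousLinearMap.opNorm_mul_le ℂ ℂ)
  exact mul_le_of_le_one_left (norm_nonneg _) h1

theorem mulOp_comm {S : Type*} [MeasurableSpace S] {m : Measure S} (a b : Lp ℂ ∞ m) :
    mulOp a * mulOp b = mulOp b * mulOp a := by
  ext1 f
  refine Lp.ext ?_
  filter_upwards [coeFn_mulOp a (mulOp b f), coeFn_mulOp b (mulOp a f), coeFn_mulOp a f,
    coeFn_mulOp b f] with s h1 h2 h3 h4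
  change mulOp a (mulOp b f) s = mulOp b (mulOp a f) s
  rw [h1, h2, h3, h4]
  ring

/-! ### The algebra `M̃ = (D ⊗̄ A) ⋊ Γ` -/

section Algebra

variable (Γ : Type*) {X : Type*} [MeasurableSpace X] (μ : Measure X) (ι : Type*)

/-- `L²(Z) ⊗ L²(X) = L²(Z × X)`. -/
abbrev Base : Type _ := Lp ℂ 2 ((gaussianMeasure ι).prod μ)

/-- The Hilbert space `L²(Z) ⊗ L²(X) ⊗ ℓ²(Γ)`, as the space of square summable functions from `Γ`
to `L²(Z × X)`. -/
abbrev Space : Type _ := lp (fun _ : Γ => Base μ ι) 2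

variable {Γ ι}

/-- The shift `f ↦ f(h⁻¹ ·)` in the variable of `Γ`. -/
def shift [Group Γ] (h : Γ) : Space Γ μ ι →ₗᵢ[ℂ] Space Γ μ ι where
  toFun f := ⟨fun g => f (h⁻¹ * g), by
    have h2 : 0 < (2 : ℝ≥0∞).toReal := by simp
    have := (memℓp_gen_iff h2).1 (lp.memℓp f)
    exact (memℓp_gen_iff h2).2 ((Equiv.mulLeft h⁻¹).summable_iff.2 this)⟩
  map_add' _ _ := rfl
  map_smul' _ _ := rfl
  norm_map' f := by
    have h2 : 0 < (2 : ℝ≥0∞).toReal := by simp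
    rw [lp.norm_eq_tsum_rpow h2, lp.norm_eq_tsum_rpow h2]
    congr 1
    exact (Equiv.mulLeft h⁻¹).tsum_eq fun g => ‖f g‖ ^ (2 : ℝ≥0∞).toReal

/-- The canonical unitary `u_h`. -/
def u [Group Γ] (h : Γ) : Space Γ μ ι →L[ℂ] Space Γ μ ι := (shift μ h).toContinuousLinearMap

theorem u_apply [Group Γ] (h : Γ) (f : Space Γ μ ι) (g : Γ) : u μ h f g = f (h⁻¹ * g) := rfl

variable [IsProbabilityMeasure μ]

/-- The unit vector `1 ⊗ 1 ⊗ δ_e`. -/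
def vacuum [Group Γ] : Space Γ μ ι :=
  open scoped Classical in lp.single 2 (1 : Γ) ((memLp_const (1 : ℂ)).toLp _)

/-- The canonical trace. -/
def trace [Group Γ] (x : Space Γ μ ι →L[ℂ] Space Γ μ ι) : ℂ :=
  inner ℂ (vacuum μ) (x (vacuum μ))

/-- The `2`-norm `‖x‖₂ = τ(x* x)^{1/2}`. -/
def norm2 [Group Γ] (x : Space Γ μ ι →L[ℂ] Space Γ μ ι) : ℝ :=
  Real.sqrt (trace μ (star x * x)).re

/-- The operator of multiplication by `a_g ∈ L^∞(Z × X)` in the fibre over `g`. -/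
def diag (a : Γ → Lp ℂ ∞ ((gaussianMeasure ι).prod μ)) (C : ℝ) (hC : 0 ≤ C)
    (ha : ∀ g, ‖a g‖ ≤ C) : Space Γ μ ι →L[ℂ] Space Γ μ ι :=
  lp.mapCLM 2 (fun g => mulOp (a g)) hC fun g => (norm_mulOp_le _).trans (ha g)

theorem diag_apply (a : Γ → Lp ℂ ∞ ((gaussianMeasure ι).prod μ)) (C : ℝ) (hC : 0 ≤ C)
    (ha : ∀ g, ‖a g‖ ≤ C) (f : Space Γ μ ι) (g : Γ) :
    diag μ a C hC ha f g = mulOp (a g) (f g) := rfl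

variable {H : Type*} [NormedAddCommGroup H] [InnerProductSpace ℝ H]

/-- The element `d ⊗ 1` of `L^∞(Z × X)`, for `d ∈ L^∞(Z)`. -/
def tensorOne (d : Lp ℂ ∞ (gaussianMeasure ι)) : Lp ℂ ∞ ((gaussianMeasure ι).prod μ) :=
  Lp.compMeasurePreserving Prod.fst measurePreserving_fst d

variable (ι) in
/-- The element `1 ⊗ a` of `L^∞(Z × X)`, for `a ∈ A = L^∞(X)`. -/
def oneTensor (a : Lp ℂ ∞ μ) : Lp ℂ ∞ ((gaussianMeasure ι).prod μ) :=
  Lp.compMeasurePreserving Prod.snd measurePreserving_snd a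

theorem norm_tensorOne (d : Lp ℂ ∞ (gaussianMeasure ι)) : ‖tensorOne μ d‖ = ‖d‖ :=
  Lp.norm_compMeasurePreserving d measurePreserving_fst

theorem norm_oneTensor (a : Lp ℂ ∞ μ) : ‖oneTensor μ ι a‖ = ‖a‖ :=
  Lp.norm_compMeasurePreserving a measurePreserving_snd

/-- The action of `Γ` on `A = L^∞(X)`, `(g · a)(x) = a(g⁻¹ x)`. -/
def translate [Group Γ] [MulAction Γ X] [MeasurableConstSMul Γ X] [SMulInvariantMeasure Γ X μ]
    (g : Γ) (a : Lp ℂ ∞ μ) : Lp ℂ ∞ μ :=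
  Lp.compMeasurePreserving (fun x => g⁻¹ • x) (measurePreserving_smul g⁻¹ μ) a

theorem norm_translate [Group Γ] [MulAction Γ X] [MeasurableConstSMul Γ X]
    [SMulInvariantMeasure Γ X μ] (g : Γ) (a : Lp ℂ ∞ μ) : ‖translate μ g a‖ = ‖a‖ :=
  Lp.norm_compMeasurePreserving a _

/-- The operator of multiplication by `ω(ξ_g) ⊗ 1` in the fibre over `g`. -/
def diagOmega (e : HilbertBasis ι ℝ H) (ξ : Γ → H) : Space Γ μ ι →L[ℂ] Space Γ μ ι :=
  diag μ (fun g => tensorOne μ (omega e (ξ g))) 1 zero_le_one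
    fun g => by rw [norm_tensorOne]; exact norm_omega_le e _

theorem diagOmega_apply (e : HilbertBasis ι ℝ H) (ξ : Γ → H) (f : Space Γ μ ι) (g : Γ) :
    diagOmega μ e ξ f g =ᵐ[(gaussianMeasure ι).prod μ] fun p => omegaFun e (ξ g) p.1 * f g p := by
  have h1 : tensorOne μ (omega e (ξ g)) =ᵐ[(gaussianMeasure ι).prod μ]
      fun p => omega e (ξ g) p.1 :=
    Lp.coeFn_compMeasurePreserving (omega e (ξ g)) measurePreserving_fst
  have h2 : ∀ᵐ p ∂(gaussianMeasure ι).prod μ, omega e (ξ g) p.1 = omegaFun e (ξ g) p.1 :=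
    Measure.quasiMeasurePreserving_fst.ae (coeFn_omega e (ξ g))
  filter_upwards [coeFn_mulOp (tensorOne μ (omega e (ξ g))) (f g), h1, h2] with p h3 h1 h2
  rw [← h2, ← h1, ← h3]
  rfl

theorem diagOmega_mul (e : HilbertBasis ι ℝ H) (ξ η : Γ → H) :
    diagOmega μ e ξ * diagOmega μ e η = diagOmega μ e (ξ + η) := by
  ext1 f
  ext1
  funext g
  refine Lp.ext ?_
  have h2 : ∀ᵐ p ∂(gaussianMeasure ι).prod μ, omegaFun e (ξ g + η g) p.1 =
      omegaFun e (ξ g) p.1 * omegaFun e (η g) p.1 :=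
    Measure.quasiMeasurePreserving_fst.ae (omegaFun_add e (ξ g) (η g))
  filter_upwards [diagOmega_apply μ e ξ (diagOmega μ e η f) g, diagOmega_apply μ e η f g,
    diagOmega_apply μ e (ξ + η) f g, h2] with p h3 h4 h5 h2
  rw [h5, Pi.add_apply, h2, mul_assoc, ← h4, ← h3]
  rfl

theorem diagOmega_zero (e : HilbertBasis ι ℝ H) : diagOmega (Γ := Γ) μ e 0 = 1 := by
  ext1 f
  ext1
  funext g
  refine Lp.ext ?_
  have h2 : ∀ᵐ p ∂(gaussianMeasure ι).prod μ, omegaFun e (0 : H) p.1 = 1 :=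
    Measure.quasiMeasurePreserving_fst.ae (omegaFun_zero e)
  filter_upwards [diagOmega_apply μ e 0 f g, h2] with p h3 h2
  rw [h3, Pi.zero_apply, h2, one_mul]
  rfl

theorem star_diagOmega (e : HilbertBasis ι ℝ H) (ξ : Γ → H) :
    star (diagOmega μ e ξ) = diagOmega μ e (-ξ) := by
  rw [ContinuousLinearMap.star_eq_adjoint, eq_comm, ContinuousLinearMap.eq_adjoint_iff]
  intro f k
  rw [lp.inner_eq_tsum, lp.inner_eq_tsum]
  congr 1
  funext g
  rw [L2.inner_def, L2.inner_def]
  refine integral_congr_ae ?_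
  have h2 : ∀ᵐ p ∂(gaussianMeasure ι).prod μ, omegaFun e (-ξ g) p.1 =
      star (omegaFun e (ξ g) p.1) :=
    Measure.quasiMeasurePreserving_fst.ae (omegaFun_neg e (ξ g))
  filter_upwards [diagOmega_apply μ e (-ξ) f g, diagOmega_apply μ e ξ k g, h2] with p h3 h4 h2
  rw [h3, h4, Pi.neg_apply, h2]
  simp only [RCLike.inner_apply, map_mul, Complex.star_def, Complex.conj_conj]
  ring

theorem diagOmega_comm_diag (e : HilbertBasis ι ℝ H) (ξ : Γ → H)
    (a : Γ → Lp ℂ ∞ ((gaussianMeasure ι).prod μ)) (C : ℝ) (hC : 0 ≤ C) (ha : ∀ g, ‖a g‖ ≤ C) :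
    diagOmega μ e ξ * diag μ a C hC ha = diag μ a C hC ha * diagOmega μ e ξ := by
  ext1 f
  ext1
  funext g
  exact congrArg (fun T => T (f g)) (mulOp_comm (tensorOne μ (omega e (ξ g))) (a g))

variable [Group Γ]

theorem u_mul_diagOmega (e : HilbertBasis ι ℝ H) (ξ : Γ → H) (h : Γ) :
    u μ h * diagOmega μ e ξ = diagOmega μ e (fun g => ξ (h⁻¹ * g)) * u μ h := rfl

/-- The operator on the crossed product space given by `ω(ξ) ⊗ 1`: in the fibre over `g` it is
multiplication by `g⁻¹ · ω(ξ) ⊗ 1 = ω(π(g)⁻¹ ξ) ⊗ 1`. -/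
def opD (e : HilbertBasis ι ℝ H) (π : Γ →* (H ≃ₗᵢ[ℝ] H)) (ξ : H) :
    Space Γ μ ι →L[ℂ] Space Γ μ ι :=
  diagOmega μ e fun g => π g⁻¹ ξ

theorem u_mul (g h : Γ) : u (ι := ι) μ g * u μ h = u μ (g * h) := by
  ext1 f
  ext1
  funext k
  change f (h⁻¹ * (g⁻¹ * k)) = f ((g * h)⁻¹ * k)
  rw [mul_inv_rev, mul_assoc]

theorem u_mul_opD (e : HilbertBasis ι ℝ H) (π : Γ →* (H ≃ₗᵢ[ℝ] H)) (g : Γ) (ξ : H) :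
    u μ g * opD μ e π ξ = opD μ e π (π g ξ) * u μ g := by
  rw [opD, u_mul_diagOmega, opD]
  congr 2
  funext k
  rw [mul_inv_rev, inv_inv, map_mul, LinearIsometryEquiv.coe_mul, Function.comp_apply]

/-! ### Cocycles and the implementing unitaries -/

/-- A 1-cocycle `b : Γ → H` for the representation `π`. -/
structure Cocycle (π : Γ →* (H ≃ₗᵢ[ℝ] H)) where
  /-- The underlying map. -/
  toFun : Γ → H
  map_mul : ∀ g h, toFun (g * h) = π g (toFun h) + toFun g

/-- The operator of multiplication by `ω(t π(g)⁻¹ b(g)) ⊗ 1` in the fibre over `g`. -/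
def implOp (e : HilbertBasis ι ℝ H) {π : Γ →* (H ≃ₗᵢ[ℝ] H)} (b : Cocycle π) (t : ℝ) :
    Space Γ μ ι →L[ℂ] Space Γ μ ι :=
  diagOmega μ e fun g => t • π g⁻¹ (b.toFun g)

variable (e : HilbertBasis ι ℝ H) {π : Γ →* (H ≃ₗᵢ[ℝ] H)} (b : Cocycle π)

theorem implOp_add (s t : ℝ) : implOp μ e b s * implOp μ e b t = implOp μ e b (s + t) := by
  rw [implOp, implOp, diagOmega_mul, implOp]
  congr 1
  funext g
  simp [add_smul]

theorem implOp_zero : implOp μ e b 0 = 1 := by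
  rw [implOp, ← diagOmega_zero μ e]
  congr 1
  funext g
  simp

theorem star_implOp (t : ℝ) : star (implOp μ e b t) = implOp μ e b (-t) := by
  rw [implOp, star_diagOmega, implOp]
  congr 1
  funext g
  simp

theorem implOp_neg_mul (t : ℝ) : implOp μ e b (-t) * implOp μ e b t = 1 := by
  rw [implOp_add, neg_add_cancel, implOp_zero]

theorem implOp_mul_neg (t : ℝ) : implOp μ e b t * implOp μ e b (-t) = 1 := by
  rw [implOp_add, add_neg_cancel, implOp_zero]

theorem implOp_mul_u (t : ℝ) (h : Γ) :
    implOp μ e b t * u μ h = opD μ e π (t • b.toFun h) * u μ h * implOp μ e b t := by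
  rw [mul_assoc, implOp, u_mul_diagOmega, ← mul_assoc, opD, diagOmega_mul]
  congr 2
  funext g
  have hb : b.toFun g = π h (b.toFun (h⁻¹ * g)) + b.toFun h := by
    rw [← b.map_mul, mul_inv_cancel_left]
  rw [Pi.add_apply, mul_inv_rev, inv_inv, map_mul, LinearIsometryEquiv.coe_mul,
    Function.comp_apply, hb, map_add, map_smul, smul_add, add_comm]

theorem implOp_conj_u (t : ℝ) (h : Γ) :
    implOp μ e b t * u μ h * star (implOp μ e b t) = opD μ e π (t • b.toFun h) * u μ h := by
  rw [implOp_mul_u, mul_assoc, star_implOp, implOp_mul_neg, mul_one]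

variable [MulAction Γ X] [MeasurableConstSMul Γ X] [SMulInvariantMeasure Γ X μ]

/-- The operator on the crossed product space given by `1 ⊗ a`, `a ∈ A`: in the fibre over `g` it is
multiplication by `1 ⊗ g⁻¹ · a`. -/
def opA (a : Lp ℂ ∞ μ) : Space Γ μ ι →L[ℂ] Space Γ μ ι :=
  diag μ (fun g : Γ => oneTensor μ ι (translate μ g⁻¹ a)) ‖a‖ (norm_nonneg a)
    fun g => by rw [norm_oneTensor, norm_translate]

theorem u_mul_opA (g : Γ) (a : Lp ℂ ∞ μ) :
    u (ι := ι) μ g * opA μ a = opA μ (translate μ g a) * u μ g := by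
  ext1 f
  ext1
  funext k
  have h : translate μ (g⁻¹ * k)⁻¹ a = translate μ k⁻¹ (translate μ g a) := by
    have h1 : (fun x : X => ((g⁻¹ * k)⁻¹)⁻¹ • x) =
        (fun x : X => g⁻¹ • x) ∘ fun x : X => (k⁻¹)⁻¹ • x := by
      funext x
      simp [mul_smul]
    unfold translate
    rw [← Lp.compMeasurePreserving_comp_apply]
    congr 2
  change mulOp (oneTensor μ ι (translate μ (g⁻¹ * k)⁻¹ a)) (f (g⁻¹ * k)) =
    mulOp (oneTensor μ ι (translate μ k⁻¹ (translate μ g a))) (f (g⁻¹ * k))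
  rw [h]

/-- The copy of `D ⊗̄ A` in the crossed product; `D` is generated by the unitaries `ω(ξ)`. -/
def algDA (e : HilbertBasis ι ℝ H) (π : Γ →* (H ≃ₗᵢ[ℝ] H)) : VonNeumannAlgebra (Space Γ μ ι) :=
  vnGen (Set.range (opD μ e π) ∪ Set.range (opA μ))

/-- The crossed product `M̃ = (D ⊗̄ A) ⋊ Γ`. -/
def algMtilde (e : HilbertBasis ι ℝ H) (π : Γ →* (H ≃ₗᵢ[ℝ] H)) :
    VonNeumannAlgebra (Space Γ μ ι) :=
  vnGen (algDA μ e π ∪ Set.range (u μ))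

variable (Γ ι) in
/-- The crossed product `M = A ⋊ Γ`, as the subalgebra `(1 ⊗ A) ⋊ Γ` of `M̃`. -/
def algM : VonNeumannAlgebra (Space Γ μ ι) :=
  vnGen (Set.range (opA (Γ := Γ) μ) ∪ Set.range (u μ))

variable (Γ ι) in
/-- `L²(A)` inside `L²(M)`: the `2`-norm closure of `1 ⊗ A`. -/
def L2A : Submodule ℂ (Space Γ μ ι) :=
  (Submodule.span ℂ (Set.range fun a : Lp ℂ ∞ μ =>
    opA (Γ := Γ) (ι := ι) μ a (vacuum μ))).topologicalClosure

instance : (L2A Γ μ ι).HasOrthogonalProjection := by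
  unfold L2A; infer_instance

/-- The Fourier coefficient `(x)_g = E_A(x u_g*)` of `x` with respect to `M = A ⋊ Γ`, as a vector of
`L²(A)`: the conditional expectation `E_A` is the restriction to `M` of the orthogonal projection of
`L²(M)` onto `L²(A)`. -/
def fourierCoefficient (x : Space Γ μ ι →L[ℂ] Space Γ μ ι) (g : Γ) : Space Γ μ ι :=
  (L2A Γ μ ι).starProjection ((x * star (u (ι := ι) μ g)) (vacuum μ))

/-! ### The deformation -/

/-- `Ad w` for `w = implOp μ e b t`, which fixes `D ⊗̄ A` pointwise. -/
theorem implOp_conj_of_mem_algDA (t : ℝ) {x : Space Γ μ ι →L[ℂ] Space Γ μ ι}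
    (hx : x ∈ algDA μ e π) : implOp μ e b t * x * star (implOp μ e b t) = x := by
  have hx' := hx
  rw [algDA, ← SetLike.mem_coe, coe_vnGen] at hx'
  have hgen : ∀ (s : ℝ), ∀ y ∈ Set.range (opD μ e π) ∪ Set.range (opA μ),
      y * implOp μ e b s = implOp μ e b s * y := by
    rintro s y (⟨ξ, rfl⟩ | ⟨a, rfl⟩)
    · unfold implOp opD
      conv_lhs => enter [1]; unfold diagOmega
      conv_rhs => enter [2]; unfold diagOmega
      rw [diagOmega_comm_diag]
    · unfold implOp opA
      rw [diagOmega_comm_diag]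
  have hw : implOp μ e b t ∈
      Set.centralizer (Set.range (opD μ e π) ∪ Set.range (opA (Γ := Γ) μ) ∪
        star (Set.range (opD μ e π) ∪ Set.range (opA μ))) := by
    rintro y (hy | hy)
    · exact hgen t y hy
    · have := congrArg star (hgen (-t) _ hy)
      rw [star_mul, star_mul, star_star, star_implOp, neg_neg] at this
      exact this.symm
  have h : implOp μ e b t * x = x * implOp μ e b t := hx' _ hw
  rw [h, mul_assoc, star_implOp, implOp_mul_neg, mul_one]

theorem opD_mem_algDA (ξ : H) : opD μ e π ξ ∈ algDA μ e π :=
  subset_vnGen _ (Or.inl ⟨ξ, rfl⟩)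

theorem opA_mem_algDA (a : Lp ℂ ∞ μ) : opA μ a ∈ algDA μ e π :=
  subset_vnGen _ (Or.inr ⟨a, rfl⟩)

theorem algDA_le : algDA μ e π ≤ algMtilde μ e π :=
  fun _ hx => subset_vnGen _ (Or.inl hx)

theorem u_mem (h : Γ) : u μ h ∈ algMtilde μ e π :=
  subset_vnGen _ (Or.inr ⟨h, rfl⟩)

theorem algM_le : algM Γ μ ι ≤ algMtilde μ e π := by
  refine vnGen_le ?_
  rintro _ (⟨a, rfl⟩ | ⟨h, rfl⟩)
  · exact algDA_le μ e (opA_mem_algDA μ e a)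
  · exact u_mem μ e h

theorem implOp_conj_mem (t : ℝ) {x : Space Γ μ ι →L[ℂ] Space Γ μ ι} (hx : x ∈ algMtilde μ e π) :
    implOp μ e b t * x * star (implOp μ e b t) ∈ algMtilde μ e π := by
  refine conj_mem_of_mem_vnGen ?_ ?_ ?_ hx
  · rw [star_implOp, implOp_neg_mul]
  · rw [star_implOp, implOp_mul_neg]
  · rintro s (hs | ⟨h, rfl⟩)
    · rw [implOp_conj_of_mem_algDA μ e b t hs]
      exact algDA_le μ e hs
    · rw [implOp_conj_u]
      exact mul_mem (algDA_le μ e (opD_mem_algDA μ e _)) (u_mem μ e h)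

/-- The automorphism `α_t` of `M̃`: it is the identity on `D ⊗̄ A`
(see `deformation_of_mem_algDA`) and maps `u_g` to `(ω(t b(g)) ⊗ 1) u_g` (see `deformation_u`). -/
def deformation (t : ℝ) : algMtilde μ e π ≃⋆ₐ[ℂ] algMtilde μ e π where
  toFun x := ⟨implOp μ e b t * x * star (implOp μ e b t), implOp_conj_mem μ e b t x.2⟩
  invFun x := ⟨implOp μ e b (-t) * x * star (implOp μ e b (-t)), implOp_conj_mem μ e b (-t) x.2⟩
  left_inv x := by
    ext1
    simp only [star_implOp, neg_neg]
    calc implOp μ e b (-t) * (implOp μ e b t * x * implOp μ e b (-t)) * implOp μ e b t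
        = (implOp μ e b (-t) * implOp μ e b t) * x * (implOp μ e b (-t) * implOp μ e b t) := by
          simp only [mul_assoc]
      _ = x := by rw [implOp_neg_mul, one_mul, mul_one]
  right_inv x := by
    ext1
    simp only [star_implOp, neg_neg]
    calc implOp μ e b t * (implOp μ e b (-t) * x * implOp μ e b t) * implOp μ e b (-t)
        = (implOp μ e b t * implOp μ e b (-t)) * x * (implOp μ e b t * implOp μ e b (-t)) := by
          simp only [mul_assoc]
      _ = x := by rw [implOp_mul_neg, one_mul, mul_one]
  map_mul' x y := by
    ext1
    change implOp μ e b t * (x * y) * star (implOp μ e b t) =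
      implOp μ e b t * x * star (implOp μ e b t) * (implOp μ e b t * y * star (implOp μ e b t))
    rw [star_implOp]
    calc implOp μ e b t * (x * y) * implOp μ e b (-t)
        = implOp μ e b t * x * 1 * y * implOp μ e b (-t) := by simp only [mul_assoc, one_mul]
      _ = _ := by rw [← implOp_neg_mul μ e b t]; simp only [mul_assoc]
  map_add' x y := by
    ext1
    change implOp μ e b t * (x + y) * star (implOp μ e b t) =
      implOp μ e b t * x * star (implOp μ e b t) + implOp μ e b t * y * star (implOp μ e b t)
    rw [mul_add, add_mul]
  map_star' x := by
    ext1
    change implOp μ e b t * star (x : Space Γ μ ι →L[ℂ] Space Γ μ ι) * star (implOp μ e b t) =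
      star (implOp μ e b t * x * star (implOp μ e b t))
    rw [star_mul, star_mul, star_star, mul_assoc]
  map_smul' c x := by
    ext1
    change implOp μ e b t * (c • (x : Space Γ μ ι →L[ℂ] Space Γ μ ι)) * star (implOp μ e b t) =
      c • (implOp μ e b t * x * star (implOp μ e b t))
    rw [mul_smul_comm, smul_mul_assoc]

theorem deformation_of_mem_algDA (t : ℝ) (x : algMtilde μ e π)
    (hx : (x : Space Γ μ ι →L[ℂ] Space Γ μ ι) ∈ algDA μ e π) : deformation μ e b t x = x :=
  Subtype.ext (implOp_conj_of_mem_algDA μ e b t hx)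

theorem deformation_u (t : ℝ) (h : Γ) :
    (deformation μ e b t ⟨u μ h, u_mem μ e h⟩ : Space Γ μ ι →L[ℂ] Space Γ μ ι) =
      opD μ e π (t • b.toFun h) * u μ h :=
  implOp_conj_u μ e b t h

end Algebra

end GaussianDeformation

end

open GaussianDeformation

/-! Write Ω for the vacuum, W for the unitary implementing α_t, and α_t(x) = W x W*, so that α_t(x)Ω
= W x Ω. The heart of the proof is a uniform bound Re τ(x* α_t(x)) ≥ 1/1000 for all unitaries x =
exp(ih), h = h* ∈ B (`le_inner_implOp`). These unitaries form a group because B is abelian. The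
element w of minimal 2-norm in the closed convex hull of the α_t(x) x* is then non-zero and
satisfies α_t(x) w = w x on the group (`exists_intertwiner`). Differentiating exp(ish) extends the
relation to B, and the polar part of w is the required partial isometry
(`exists_partialIsometry_mem`).

For the bound, suppose that τ(x* α_t(x)) has small real part. Put x' = v_n x v_n*. It lies in B, so
it commutes with x. By (a), α_t(x') is close in 2-norm to v_n α_t(x) v_n*. By (b) and mixing, for n
large the latter is close to an element y whose Gaussian vectors ξ in ω(ξ) are all orthogonal to a
prescribed finite-dimensional K ⊂ H (`eventually_conj_close`): v_n ω(ξ) is a right multiplication by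
ω(ξ) on v_n, in the fibre over g this puts ω(π(g)ξ) on the left, and π(g)ξ is almost orthogonal to K
off a finite set of g, on which v_n has little mass.

Let x₀ be a finite linear combination of elements (1 ⊗ a) u_g close to x. The equal products α_t(x)
α_t(x') and α_t(x') α_t(x) are approximated by α_t(x₀) y and y α_t(x₀), and these behave
differently:

(1) Against vectors orthogonal to K, α_t(x₀) acts as the image of x₀ under the multiplier φ(g) =
exp(-t²‖b(g)‖²) (`exists_compression`). That image has small 2-norm, since Σ φ(g)²‖x_g‖² ≤ Σ
φ(g)‖x_g‖² = τ(x* α_t(x)) for x ∈ M. So α_t(x₀) y Ω is almost orthogonal to all such vectors.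

(2) y α_t(x₀) Ω is itself almost such a vector, by mixing again, once the part of y over a finite
set F has been removed (`exists_finset_close`). If K contains b(F), that part is small for the
reason in (1), because y is close to α_t(x') (`norm_scal_ind_le`).

A unit vector cannot be close both to a vector of type (2) and to one almost orthogonal to all of
these.

Every orthogonality argument rests on the kernel ⟨ω(ξ), ω(η)⟩ = exp(-‖ξ - η‖²) (`inner_gen_same`),
which factors along orthogonal sums. Right multiplication is bounded in 2-norm because the trace is
tracial on M̃ (`trace_mul_comm`). -/

namespace GaussianDeformation

/-! ### Commutants, density and polar decomposition on a Hilbert space -/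

section Hilbert

variable {E : Type*} [NormedAddCommGroup E] [InnerProductSpace ℂ E] [CompleteSpace E]

theorem starProjection_comm_of_invariant (N : Submodule ℂ E) [N.HasOrthogonalProjection]
    {T : E →L[ℂ] E} (h1 : ∀ f ∈ N, T f ∈ N) (h2 : ∀ f ∈ N, star T f ∈ N) (f : E) :
    N.starProjection (T f) = T (N.starProjection f) := by
  refine Submodule.eq_starProjection_of_mem_orthogonal (h1 _ (N.starProjection_apply_mem f)) ?_
  rw [← map_sub, Submodule.mem_orthogonal]
  intro g hg
  rw [← ContinuousLinearMap.adjoint_inner_left]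
  exact (Submodule.mem_orthogonal _ _).1 (Submodule.sub_starProjection_mem_orthogonal f) _ (h2 g hg)

/-- Elements of a double commutant are approximated, on any two vectors, by elements of the
algebra. -/
theorem exists_approx_two (𝒜 : StarSubalgebra ℂ (E →L[ℂ] E)) {x : E →L[ℂ] E}
    (hx : x ∈ Set.centralizer (Set.centralizer (𝒜 : Set (E →L[ℂ] E)))) (f g : E) {ε : ℝ}
    (hε : 0 < ε) : ∃ a ∈ 𝒜, ‖x f - a f‖ < ε ∧ ‖x g - a g‖ < ε := by
  let Φ := WithLp.prodContinuousLinearEquiv 2 ℂ E E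
  -- The amplification T ⊕ T on E ⊕ E reduces approximation on two vectors to approximation on one.
  let dg : (E →L[ℂ] E) → (WithLp 2 (E × E) →L[ℂ] WithLp 2 (E × E)) := fun T =>
    Φ.symm.toContinuousLinearMap ∘L (T.prodMap T) ∘L Φ.toContinuousLinearMap
  have hdg : ∀ T p, dg T p = WithLp.toLp 2 (T p.fst, T p.snd) := fun T p => rfl
  have hstar : ∀ T, star (dg T) = dg (star T) := by
    intro T
    rw [ContinuousLinearMap.star_eq_adjoint, eq_comm, ContinuousLinearMap.eq_adjoint_iff]
    intro p q
    simp only [hdg, WithLp.prod_inner_apply]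
    simp [ContinuousLinearMap.star_eq_adjoint, ContinuousLinearMap.adjoint_inner_left]
  let lin : (E →L[ℂ] E) →ₗ[ℂ] WithLp 2 (E × E) :=
    { toFun := fun a => WithLp.toLp 2 (a f, a g)
      map_add' := fun _ _ => rfl
      map_smul' := fun _ _ => rfl }
  let N : Submodule ℂ (WithLp 2 (E × E)) :=
    (𝒜.toSubalgebra.toSubmodule.map lin).topologicalClosure
  have hinv : ∀ a ∈ 𝒜, ∀ p ∈ N, dg a p ∈ N := by
    intro a ha p hp
    refine map_mem_closure (dg a).continuous hp ?_
    rintro _ ⟨b, hb, rfl⟩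
    exact ⟨a * b, 𝒜.mul_mem ha hb, rfl⟩
  have hcomm : ∀ a ∈ 𝒜, ∀ p, N.starProjection (dg a p) = dg a (N.starProjection p) := by
    intro a ha
    refine starProjection_comm_of_invariant N (hinv a ha) ?_
    rw [hstar]
    exact hinv _ (star_mem ha)
  let i1 : E →L[ℂ] WithLp 2 (E × E) :=
    Φ.symm.toContinuousLinearMap ∘L ContinuousLinearMap.inl ℂ E E
  let i2 : E →L[ℂ] WithLp 2 (E × E) :=
    Φ.symm.toContinuousLinearMap ∘L ContinuousLinearMap.inr ℂ E E
  have hi1 : ∀ (T : E →L[ℂ] E) k, dg T (i1 k) = i1 (T k) := fun T k => by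
    change WithLp.toLp 2 (T k, T 0) = WithLp.toLp 2 (T k, 0)
    rw [map_zero]
  have hi2 : ∀ (T : E →L[ℂ] E) k, dg T (i2 k) = i2 (T k) := fun T k => by
    change WithLp.toLp 2 (T 0, T k) = WithLp.toLp 2 (0, T k)
    rw [map_zero]
  have hext : ∀ p q : WithLp 2 (E × E), p.fst = q.fst → p.snd = q.snd → p = q :=
    fun p q h1 h2 => WithLp.ofLp_injective 2 (Prod.ext h1 h2)
  -- The matrix entries of the projection onto N commute with 𝒜, so x commutes with them; hence x ⊕
  -- x commutes with the projection.
  have hentry : ∀ (π : WithLp 2 (E × E) →L[ℂ] E) (i : E →L[ℂ] WithLp 2 (E × E)),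
      (∀ T p, π (dg T p) = T (π p)) → (∀ (T : E →L[ℂ] E) k, dg T (i k) = i (T k)) →
      ∀ k, π (N.starProjection (dg x (i k))) = π (dg x (N.starProjection (i k))) := by
    intro π i hπ hi k
    have hmem : π ∘L N.starProjection ∘L i ∈ Set.centralizer (𝒜 : Set (E →L[ℂ] E)) := by
      intro a ha
      ext1 k
      change a (π (N.starProjection (i k))) = π (N.starProjection (i (a k)))
      rw [← hi, hcomm a ha, hπ]
    have := congrArg (fun T => T k) (hx _ hmem)
    change π (N.starProjection (i (x k))) = x (π (N.starProjection (i k))) at this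
    rw [hi, this, hπ]
  have hx' : ∀ p, N.starProjection (dg x p) = dg x (N.starProjection p) := by
    intro p
    have hp : p = i1 p.fst + i2 p.snd := by
      refine hext _ _ ?_ ?_
      · change p.fst = p.fst + 0; simp
      · change p.snd = 0 + p.snd; simp
    have h1 : ∀ (i : E →L[ℂ] WithLp 2 (E × E)), (∀ (T : E →L[ℂ] E) k, dg T (i k) = i (T k)) →
        ∀ k, N.starProjection (dg x (i k)) = dg x (N.starProjection (i k)) := by
      intro i hi k
      refine hext _ _ ?_ ?_
      · exact hentry (WithLp.fstL 2 ℂ E E) i (fun _ _ => rfl) hi k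
      · exact hentry (WithLp.sndL 2 ℂ E E) i (fun _ _ => rfl) hi k
    rw [hp]
    simp only [map_add, h1 i1 hi1, h1 i2 hi2]
  -- The unit of 𝒜 places (f, g) in N, and N is invariant under x ⊕ x.
  have h0 : WithLp.toLp 2 (f, g) ∈ N :=
    subset_closure ⟨1, one_mem 𝒜, rfl⟩
  have h1 : dg x (WithLp.toLp 2 (f, g)) ∈ N := by
    rw [← Submodule.starProjection_eq_self_iff.2 h0, ← hx']
    exact N.starProjection_apply_mem _
  obtain ⟨_, ⟨a, ha, rfl⟩, hd⟩ := Metric.mem_closure_iff.1 h1 ε hε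
  refine ⟨a, ha, ?_, ?_⟩
  · refine lt_of_le_of_lt ?_ hd
    rw [dist_eq_norm]
    exact WithLp.norm_fst_le (p := 2) E (dg x (WithLp.toLp 2 (f, g)) - lin a)
  · refine lt_of_le_of_lt ?_ hd
    rw [dist_eq_norm]
    exact WithLp.norm_snd_le (p := 2) E (dg x (WithLp.toLp 2 (f, g)) - lin a)

theorem mem_iff_comm_commutant {N : VonNeumannAlgebra E} {x : E →L[ℂ] E} :
    x ∈ N ↔ ∀ z ∈ N.commutant, z * x = x * z := by
  rw [← VonNeumannAlgebra.mem_commutant_iff, VonNeumannAlgebra.commutant_commutant]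

/-- The partial isometry in the polar decomposition of `w` satisfies the intertwining relations
that `w` satisfies. -/
theorem exists_partialIsometry {w : E →L[ℂ] E} (hw0 : w ≠ 0) :
    ∃ v : E →L[ℂ] E, v ≠ 0 ∧ IsStarProjection (star v * v) ∧
      ∀ x y : E →L[ℂ] E, y * w = w * x → star y * w = w * star x → y * v = v * x := by
  set a : E →L[ℂ] E := CFC.abs w with ha
  have haa : a * a = star w * w := CFC.abs_mul_abs w
  have hsa : star a = a := (CFC.abs_nonneg w).isSelfAdjoint
  have hnorm : ∀ f, ‖w f‖ = ‖a f‖ := by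
    intro f
    have h1 : inner ℂ (w f) (w f) = inner ℂ (a f) (a f) := by
      rw [← ContinuousLinearMap.adjoint_inner_right, ← ContinuousLinearMap.adjoint_inner_right a,
        ← ContinuousLinearMap.star_eq_adjoint, ← ContinuousLinearMap.star_eq_adjoint, hsa]
      change inner ℂ f ((star w * w) f) = inner ℂ f ((a * a) f)
      rw [haa]
    rw [inner_self_eq_norm_sq_to_K, inner_self_eq_norm_sq_to_K] at h1
    have h2 : ‖w f‖ ^ 2 = ‖a f‖ ^ 2 := by exact_mod_cast h1
    exact (sq_eq_sq₀ (norm_nonneg _) (norm_nonneg _)).1 h2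
  let R : Submodule ℂ E := (LinearMap.range a.toLinearMap).topologicalClosure
  have hR : ∀ f, a f ∈ R := fun f => subset_closure ⟨f, rfl⟩
  let e : E →ₗ[ℂ] R := a.toLinearMap.codRestrict R hR
  have hdense : DenseRange e := by
    intro r
    rw [closure_subtype]
    refine closure_mono ?_ r.2
    rintro _ ⟨f, rfl⟩
    exact ⟨e f, ⟨f, rfl⟩, rfl⟩
  have hbound : ∀ f, ‖w.toLinearMap f‖ ≤ 1 * ‖e f‖ := fun f => by
    rw [one_mul]; exact (hnorm f).le
  -- Since ‖w f‖ = ‖|w| f‖, the assignment |w| f ↦ w f is well defined and isometric; v extends it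
  -- by zero on the complement of R.
  let v0 : R →L[ℂ] E := w.toLinearMap.extendOfNorm e
  have hv0 : ∀ f, v0 (e f) = w f := LinearMap.extendOfNorm_eq hdense ⟨1, hbound⟩
  have hv0n : ∀ r, ‖v0 r‖ = ‖r‖ := by
    intro r
    refine hdense.induction_on (p := fun r => ‖v0 r‖ = ‖r‖) r
      (isClosed_eq (by fun_prop) (by fun_prop)) fun f => ?_
    rw [hv0]
    exact hnorm f
  let v : E →L[ℂ] E := v0 ∘L R.orthogonalProjectionOnto
  have hva : ∀ f, v (a f) = w f := by
    intro f
    rw [← hv0]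
    change v0 (R.orthogonalProjectionOnto (e f)) = _
    rw [Submodule.orthogonalProjectionOnto_mem_subspace_eq_self]
  have hvn : ∀ f, ‖v f‖ = ‖R.starProjection f‖ := fun f => hv0n _
  refine ⟨v, ?_, ?_, ?_⟩
  · rintro h0
    refine hw0 ?_
    ext1 f
    rw [← hva, h0]
    rfl
  · have : star v * v = R.starProjection := by
      refine ContinuousLinearMap.coe_injective ((ext_inner_map _ _).1 fun f => ?_)
      change inner ℂ ((star v) (v f)) f = inner ℂ (R.starProjection f) f
      rw [ContinuousLinearMap.star_eq_adjoint, ContinuousLinearMap.adjoint_inner_left,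
        inner_self_eq_norm_sq_to_K, hvn, ← inner_self_eq_norm_sq_to_K (𝕜 := ℂ),
        ← R.inner_starProjection_left_eq_right,
        Submodule.starProjection_eq_self_iff.2 (R.starProjection_apply_mem f)]
    rw [this]
    exact isStarProjection_starProjection
  · intro x y h1 h2
    -- The two relations together give w* w x = w* y w = x w* w. So x commutes with |w|, R reduces
    -- x, and y v |w| = w x = v x |w|.
    have hx : Commute (star w * w) x := by
      change star w * w * x = x * (star w * w)
      have h3 := congrArg star h2
      rw [star_mul, star_mul, star_star, star_star] at h3
      rw [mul_assoc, ← h1, ← mul_assoc, h3, mul_assoc]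
    have hax : a * x = x * a := by
      rw [ha, CFC.abs, CFC.sqrt]
      exact hx.cfcₙ_nnreal _
    have hx' : Commute (star w * w) (star x) := by
      have := congrArg star hx.eq
      simp only [star_mul, star_star] at this
      exact this.symm
    have hax' : a * star x = star x * a := by
      rw [ha, CFC.abs, CFC.sqrt]
      exact hx'.cfcₙ_nnreal _
    have hinv : ∀ z : E →L[ℂ] E, a * z = z * a → ∀ r ∈ R, z r ∈ R := by
      intro z hz r hr
      refine map_mem_closure z.continuous hr ?_
      rintro _ ⟨f, rfl⟩
      exact ⟨z f, congrArg (fun T => T f) hz⟩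
    have hP := starProjection_comm_of_invariant R (hinv x hax) (hinv _ hax')
    have hvP : ∀ f, v (R.starProjection f) = v f := by
      intro f
      change v0 (R.orthogonalProjectionOnto (R.orthogonalProjectionOnto f : E)) = _
      rw [Submodule.orthogonalProjectionOnto_mem_subspace_eq_self]
      rfl
    have hon : ∀ r ∈ R, y (v r) = v (x r) := by
      intro r hr
      refine closure_minimal (s := Set.range a) (t := {r | y (v r) = v (x r)}) ?_
        (isClosed_eq (by fun_prop) (by fun_prop)) hr
      rintro _ ⟨f, rfl⟩
      change y (v (a f)) = v ((x * a) f)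
      rw [hva, ← hax]
      change (y * w) f = v (a (x f))
      rw [hva, h1]
      rfl
    ext1 f
    change y (v f) = v (x f)
    rw [← hvP f, ← hvP (x f), hP, hon _ (R.starProjection_apply_mem f)]

/-- Each z in the commutant intertwines w with itself, and so does z*. The polar part inherits the
relation, so it lies in the double commutant. -/
theorem exists_partialIsometry_mem (N : VonNeumannAlgebra E) {w : E →L[ℂ] E} (hw : w ∈ N)
    (hw0 : w ≠ 0) :
    ∃ v ∈ N, v ≠ 0 ∧ IsStarProjection (star v * v) ∧
      ∀ x y : E →L[ℂ] E, y * w = w * x → star y * w = w * star x → y * v = v * x := by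
  obtain ⟨v, h0, h1, h2⟩ := exists_partialIsometry hw0
  refine ⟨v, mem_iff_comm_commutant.2 fun z hz => h2 z z ?_ ?_, h0, h1, h2⟩
  · exact mem_iff_comm_commutant.1 hw z hz
  · exact mem_iff_comm_commutant.1 hw _ (star_mem hz)

end Hilbert

end GaussianDeformation

noncomputable section

namespace GaussianDeformation

/-! ### The characteristic function of the Gaussian field -/

section GaussianIntegral

variable {ι H : Type*} [NormedAddCommGroup H] [InnerProductSpace ℝ H] (e : HilbertBasis ι ℝ H)

theorem integral_omegaFun_sum (c : ι → ℝ) (s : Finset ι) :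
    ∫ z, omegaFun e (∑ i ∈ s, c i • e i) z ∂gaussianMeasure ι =
      (Real.exp (-‖∑ i ∈ s, c i • e i‖ ^ 2) : ℂ) := by
  classical
  have hfield : field e (∑ i ∈ s, c i • e i) =ᵐ[gaussianMeasure ι] fun z => ∑ i ∈ s, c i * z i := by
    rw [map_sum]
    have h1 : ⇑(∑ i ∈ s, field e (c i • e i)) =ᵐ[gaussianMeasure ι]
        ∑ i ∈ s, ⇑(field e (c i • e i)) := Lp.coeFn_finsetSum _ _
    have h2 : ∀ᵐ z ∂gaussianMeasure ι, ∀ i ∈ s, field e (c i • e i) z = c i * z i := by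
      rw [s.eventually_all]
      intro i _
      have h3 : field e (c i • e i) = c i • coord i := by rw [map_smul, field_basis]
      rw [h3]
      filter_upwards [Lp.coeFn_smul (c i) (coord i), (memLp_coord (ι := ι) i).coeFn_toLp]
        with z h4 h5
      rw [h4, Pi.smul_apply, coord, h5, smul_eq_mul]
    filter_upwards [h1, h2] with z h1 h2
    rw [h1, Finset.sum_apply]
    exact Finset.sum_congr rfl h2
  have hX : ∀ i : ι, Measurable fun z : ι → ℝ => c i * z i := fun i => by fun_prop
  have hind : iIndepFun (fun (i : ι) (z : ι → ℝ) => c i * z i) (gaussianMeasure ι) :=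
    iIndepFun_infinitePi (P := fun _ : ι => gaussianReal 0 1) (X := fun i (x : ℝ) => c i * x)
      (fun i => by fun_prop)
  have hmap : ∀ i : ι, Measure.map (fun z : ι → ℝ => c i * z i) (gaussianMeasure ι) =
      gaussianReal 0 (NNReal.mk (c i ^ 2) (sq_nonneg _)) := by
    intro i
    have h1 : Measure.map (fun z : ι → ℝ => z i) (gaussianMeasure ι) = gaussianReal 0 1 :=
      (measurePreserving_eval_infinitePi (fun _ : ι => gaussianReal 0 1) i).map_eq
    have h2 : Measure.map (fun x : ℝ => c i * x) (gaussianReal 0 1) = _ :=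
      gaussianReal_map_const_mul (c i)
    rw [← h1, Measure.map_map (by fun_prop) (by fun_prop), mul_zero, mul_one] at h2
    exact h2
  have hprod := iIndepFun.charFun_map_finsetSum_eq_prod (s := s) (P := gaussianMeasure ι)
    (X := fun (i : ι) (z : ι → ℝ) => c i * z i) (fun i _ => (hX i).aemeasurable)
    (hind.precomp (g := ((↑) : s → ι)) Subtype.val_injective)
  -- At frequency √2 the i-th factor is exp(-(√2)² c_i²/2) = exp(-c_i²): the √2 in ω cancels the
  -- 1/2.
  have hval := congrFun hprod (Real.sqrt 2)
  rw [Finset.prod_apply] at hval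
  have hnorm : ‖∑ i ∈ s, c i • e i‖ ^ 2 = ∑ i ∈ s, c i ^ 2 := by
    rw [← real_inner_self_eq_norm_sq, e.orthonormal.inner_sum]
    simp [pow_two]
  have hlhs : ∫ z, omegaFun e (∑ i ∈ s, c i • e i) z ∂gaussianMeasure ι =
      charFun (Measure.map (∑ i ∈ s, fun z : ι → ℝ => c i * z i) (gaussianMeasure ι))
        (Real.sqrt 2) := by
    rw [charFun_apply_real, integral_map (by fun_prop) (by fun_prop)]
    refine integral_congr_ae ?_
    filter_upwards [hfield] with z hz
    rw [omegaFun, hz]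
    simp
  rw [hlhs, hval, hnorm, ← Finset.sum_neg_distrib, Real.exp_sum]
  push_cast
  refine Finset.prod_congr rfl fun i _ => ?_
  rw [hmap, charFun_gaussianReal]
  have h2 : ((Real.sqrt 2 : ℝ) : ℂ) ^ 2 = 2 := by
    rw [← Complex.ofReal_pow, Real.sq_sqrt (by norm_num)]; norm_num
  rw [h2]
  simp

/-- From |e^{is} - 1| ≤ |s| and L¹-norm ≤ L²-norm on a probability space. The resulting continuity
carries the formula from finite combinations of the basis to all of H. -/
theorem norm_integral_omegaFun_sub_le (ξ η : H) :
    ‖(∫ z, omegaFun e ξ z ∂gaussianMeasure ι) - ∫ z, omegaFun e η z ∂gaussianMeasure ι‖ ≤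
      Real.sqrt 2 * ‖ξ - η‖ := by
  have hInt : ∀ ζ, Integrable (omegaFun e ζ) (gaussianMeasure ι) :=
    fun ζ => (memLp_omegaFun e ζ).integrable le_top
  have hL : Integrable (fun z => field e (ξ - η) z) (gaussianMeasure ι) :=
    (Lp.memLp (field e (ξ - η))).integrable (by norm_num)
  rw [← integral_sub (hInt ξ) (hInt η)]
  have hsub : field e (ξ - η) =ᵐ[gaussianMeasure ι] fun z => field e ξ z - field e η z := by
    rw [map_sub]; exact Lp.coeFn_sub _ _
  calc _ ≤ ∫ z, ‖omegaFun e ξ z - omegaFun e η z‖ ∂gaussianMeasure ι :=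
        norm_integral_le_integral_norm _
    _ ≤ ∫ z, Real.sqrt 2 * ‖field e (ξ - η) z‖ ∂gaussianMeasure ι := by
        refine integral_mono_ae ((hInt ξ).sub (hInt η)).norm (hL.norm.const_mul _) ?_
        filter_upwards [hsub] with z hz
        have h1 : omegaFun e ξ z - omegaFun e η z = omegaFun e η z *
            (Complex.exp (Complex.I * ((Real.sqrt 2 * (field e ξ z - field e η z) : ℝ) : ℂ)) - 1) := by
          rw [mul_sub, mul_one, omegaFun, omegaFun, ← Complex.exp_add]
          congr 2
          push_cast
          ring
        simp only [hz]
        rw [h1, norm_mul, norm_omegaFun, one_mul]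
        refine (Real.norm_exp_I_mul_ofReal_sub_one_le).trans ?_
        rw [norm_mul, Real.norm_of_nonneg (Real.sqrt_nonneg 2)]
    _ = Real.sqrt 2 * ∫ z, ‖field e (ξ - η) z‖ ∂gaussianMeasure ι := integral_const_mul _ _
    _ ≤ Real.sqrt 2 * ‖ξ - η‖ := by
        refine mul_le_mul_of_nonneg_left ?_ (Real.sqrt_nonneg 2)
        rw [← LinearIsometry.norm_map (field e) (ξ - η), Lp.norm_def,
          integral_norm_eq_lintegral_enorm hL.aestronglyMeasurable,
          ← eLpNorm_one_eq_lintegral_enorm]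
        exact ENNReal.toReal_mono (Lp.eLpNorm_ne_top _)
          (eLpNorm_le_eLpNorm_of_exponent_le (by norm_num) hL.aestronglyMeasurable)

theorem integral_omegaFun (ξ : H) :
    ∫ z, omegaFun e ξ z ∂gaussianMeasure ι = (Real.exp (-‖ξ‖ ^ 2) : ℂ) := by
  have hcont : Continuous fun η => ∫ z, omegaFun e η z ∂gaussianMeasure ι := by
    refine LipschitzWith.continuous (K := Real.toNNReal (Real.sqrt 2))
      (LipschitzWith.of_dist_le_mul fun ξ η => ?_)
    rw [dist_eq_norm, dist_eq_norm, Real.coe_toNNReal _ (Real.sqrt_nonneg 2)]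
    exact norm_integral_omegaFun_sub_le e ξ η
  have hcont' : Continuous fun η : H => (Real.exp (-‖η‖ ^ 2) : ℂ) := by fun_prop
  have hs : Tendsto (fun s : Finset ι => ∑ i ∈ s, e.repr ξ i • e i) atTop (𝓝 ξ) :=
    e.hasSum_repr ξ
  refine tendsto_nhds_unique ((hcont.tendsto ξ).comp hs) (((hcont'.tendsto ξ).comp hs).congr ?_)
  intro s
  exact (integral_omegaFun_sum e _ s).symm

end GaussianIntegral

end GaussianDeformation

end

noncomputable section

namespace GaussianDeformation

/-! ### Multiplication operators and the elementary operators (ω(ξ) ⊗ a) u_g -/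

section MulOp

variable {S : Type*} [MeasurableSpace S] {m : Measure S}

/-- The product of two elements of `L^∞`. -/
def mulLinf (a b : Lp ℂ ∞ m) : Lp ℂ ∞ m := (ContinuousLinearMap.mul ℂ ℂ).holder ∞ a b

theorem coeFn_mulLinf (a b : Lp ℂ ∞ m) : mulLinf a b =ᵐ[m] fun s => a s * b s :=
  (ContinuousLinearMap.mul ℂ ℂ).coeFn_holder a b

theorem mulOp_mul (a b : Lp ℂ ∞ m) : mulOp a * mulOp b = mulOp (mulLinf a b) := by
  ext1 f
  refine Lp.ext ?_
  filter_upwards [coeFn_mulOp a (mulOp b f), coeFn_mulOp b f, coeFn_mulOp (mulLinf a b) f,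
    coeFn_mulLinf a b] with s h1 h2 h3 h4
  change mulOp a (mulOp b f) s = _
  rw [h1, h2, h3, h4, mul_assoc]

theorem norm_star_Linf (a : Lp ℂ ∞ m) : ‖star a‖ = ‖a‖ := by
  have h : ∀ᵐ s ∂m, ‖star a s‖ = ‖a s‖ := by
    filter_upwards [Lp.coeFn_star a] with s hs
    rw [hs, Pi.star_apply, norm_star]
  exact le_antisymm (Lp.norm_le_norm_of_ae_le (h.mono fun _ hs => hs.le))
    (Lp.norm_le_norm_of_ae_le (h.mono fun _ hs => hs.ge))

theorem inner_mulOp_left (a : Lp ℂ ∞ m) (f k : Lp ℂ 2 m) :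
    inner ℂ (mulOp (star a) f) k = inner ℂ f (mulOp a k) := by
  rw [L2.inner_def, L2.inner_def]
  refine integral_congr_ae ?_
  filter_upwards [coeFn_mulOp (star a) f, coeFn_mulOp a k, Lp.coeFn_star a] with s h1 h2 h3
  rw [h1, h2, h3]
  simp only [RCLike.inner_apply, map_mul, Pi.star_apply, Complex.star_def, Complex.conj_conj]
  ring

end MulOp

section Operators

variable {Γ X ι H : Type*} [MeasurableSpace X] (μ : Measure X)
  [IsProbabilityMeasure μ] [NormedAddCommGroup H] [InnerProductSpace ℝ H]

theorem u_one [Group Γ] : u (Γ := Γ) (ι := ι) μ 1 = 1 := by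
  ext1 f
  ext1
  funext g
  change f (1⁻¹ * g) = f g
  rw [inv_one, one_mul]

theorem star_u [Group Γ] (h : Γ) : star (u (ι := ι) μ h) = u μ h⁻¹ := by
  have h1 : star (u (ι := ι) μ h) * u μ h = 1 := by
    ext1 f
    refine ext_inner_left ℂ fun k => ?_
    change inner ℂ k (star (u μ h) (u μ h f)) = inner ℂ k f
    rw [ContinuousLinearMap.star_eq_adjoint, ContinuousLinearMap.adjoint_inner_right]
    exact (shift μ h).inner_map_map k f
  calc star (u (ι := ι) μ h) = star (u μ h) * (u μ h * u μ h⁻¹) := by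
        rw [u_mul, mul_inv_cancel, u_one, mul_one]
    _ = u μ h⁻¹ := by rw [← mul_assoc, h1, one_mul]

theorem star_diag (a : Γ → Lp ℂ ∞ ((gaussianMeasure ι).prod μ)) (C : ℝ) (hC : 0 ≤ C)
    (ha : ∀ g, ‖a g‖ ≤ C) (ha' : ∀ g, ‖star (a g)‖ ≤ C) :
    star (diag μ a C hC ha) = diag μ (fun g => star (a g)) C hC ha' := by
  rw [ContinuousLinearMap.star_eq_adjoint, eq_comm, ContinuousLinearMap.eq_adjoint_iff]
  intro f k
  rw [lp.inner_eq_tsum, lp.inner_eq_tsum]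
  congr 1
  funext g
  exact inner_mulOp_left (a g) (f g) (k g)

/-- The constant function `1` as a vector of `L²(Z × X)`. -/
def oneVec (ι : Type*) : Base μ ι := (memLp_const (1 : ℂ)).toLp _

theorem coeFn_oneVec : oneVec μ ι =ᵐ[(gaussianMeasure ι).prod μ] fun _ => 1 :=
  (memLp_const (1 : ℂ)).coeFn_toLp

/-- The vector `ω(ζ) ⊗ c` of `L²(Z × X)`. -/
def baseVec (e : HilbertBasis ι ℝ H) (ζ : H) (c : Lp ℂ ∞ μ) : Base μ ι :=
  mulOp (tensorOne μ (omega e ζ)) (mulOp (oneTensor μ ι c) (oneVec μ ι))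

theorem coeFn_tensorOne_omega (e : HilbertBasis ι ℝ H) (ζ : H) :
    tensorOne μ (omega e ζ) =ᵐ[(gaussianMeasure ι).prod μ] fun p => omegaFun e ζ p.1 := by
  have h1 := Lp.coeFn_compMeasurePreserving (omega e ζ)
    (measurePreserving_fst (μ := gaussianMeasure ι) (ν := μ))
  have h2 : ∀ᵐ p ∂(gaussianMeasure ι).prod μ, omega e ζ p.1 = omegaFun e ζ p.1 :=
    Measure.quasiMeasurePreserving_fst.ae (coeFn_omega e ζ)
  filter_upwards [h1, h2] with p h1 h2
  rw [← h2]
  exact h1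

theorem coeFn_baseVec (e : HilbertBasis ι ℝ H) (ζ : H) (c : Lp ℂ ∞ μ) :
    baseVec μ e ζ c =ᵐ[(gaussianMeasure ι).prod μ] fun p => omegaFun e ζ p.1 * c p.2 := by
  have h1 := Lp.coeFn_compMeasurePreserving c
    (measurePreserving_snd (μ := gaussianMeasure ι) (ν := μ))
  filter_upwards [coeFn_mulOp (tensorOne μ (omega e ζ)) (mulOp (oneTensor μ ι c) (oneVec μ ι)),
    coeFn_mulOp (oneTensor μ ι c) (oneVec μ ι), coeFn_oneVec μ (ι := ι),
    coeFn_tensorOne_omega μ e ζ, h1] with p h2 h3 h4 h5 h6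
  rw [baseVec, h2, h3, h4, h5, mul_one]
  congr 1

theorem integral_omegaFun_conj_mul (e : HilbertBasis ι ℝ H) (ζ ζ' : H) :
    ∫ z, star (omegaFun e ζ z) * omegaFun e ζ' z ∂gaussianMeasure ι =
      (Real.exp (-‖ζ - ζ'‖ ^ 2) : ℂ) := by
  rw [norm_sub_rev, ← integral_omegaFun e (ζ' - ζ)]
  refine integral_congr_ae ?_
  filter_upwards [omegaFun_add e (-ζ) ζ', omegaFun_neg e ζ] with z h1 h2
  rw [sub_eq_neg_add, h1, h2]

theorem inner_baseVec (e : HilbertBasis ι ℝ H) (ζ ζ' : H) (c c' : Lp ℂ ∞ μ) :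
    inner ℂ (baseVec μ e ζ c) (baseVec μ e ζ' c') =
      (Real.exp (-‖ζ - ζ'‖ ^ 2) : ℂ) * ∫ x, star (c x) * c' x ∂μ := by
  rw [L2.inner_def, ← integral_omegaFun_conj_mul e, ← integral_prod_mul]
  refine integral_congr_ae ?_
  filter_upwards [coeFn_baseVec μ e ζ c, coeFn_baseVec μ e ζ' c'] with p h1 h2
  rw [h1, h2]
  simp only [RCLike.inner_apply, map_mul, Complex.star_def]
  ring

variable [Group Γ]

open scoped Classical in
theorem u_vacuum (g : Γ) : u μ g (vacuum μ) = lp.single 2 g (oneVec μ ι) := by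
  ext1
  funext k
  change (lp.single (E := fun _ : Γ => Base μ ι) 2 (1 : Γ) (oneVec μ ι)) (g⁻¹ * k) = _
  by_cases h : k = g
  · subst h
    rw [inv_mul_cancel, lp.single_apply_self, lp.single_apply_self]
  · rw [lp.single_apply_ne _ _ _ h, lp.single_apply_ne]
    rwa [Ne, inv_mul_eq_one, eq_comm]

open scoped Classical in
theorem diag_single (a : Γ → Lp ℂ ∞ ((gaussianMeasure ι).prod μ)) (C : ℝ) (hC : 0 ≤ C)
    (ha : ∀ g, ‖a g‖ ≤ C) (g : Γ) (f : Base μ ι) :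
    diag μ a C hC ha (lp.single 2 g f) = lp.single 2 g (mulOp (a g) f) := by
  ext1
  funext k
  rw [diag_apply]
  by_cases h : k = g
  · subst h
    rw [lp.single_apply_self, lp.single_apply_self]
  · rw [lp.single_apply_ne _ _ _ h, lp.single_apply_ne _ _ _ h, map_zero]

variable [MulAction Γ X] [MeasurableConstSMul Γ X] [SMulInvariantMeasure Γ X μ]

theorem coeFn_translate (g : Γ) (a : Lp ℂ ∞ μ) : translate μ g a =ᵐ[μ] fun x => a (g⁻¹ • x) :=
  Lp.coeFn_compMeasurePreserving a (measurePreserving_smul g⁻¹ μ)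

theorem translate_mulLinf (g : Γ) (a b : Lp ℂ ∞ μ) :
    translate μ g (mulLinf a b) = mulLinf (translate μ g a) (translate μ g b) := by
  refine Lp.ext ?_
  have h := (measurePreserving_smul g⁻¹ μ).quasiMeasurePreserving.ae (coeFn_mulLinf a b)
  filter_upwards [coeFn_translate μ g (mulLinf a b), coeFn_translate μ g a, coeFn_translate μ g b,
    coeFn_mulLinf (translate μ g a) (translate μ g b), h] with x h1 h2 h3 h4 h5
  rw [h1, h4, h2, h3, h5]

theorem translate_star (g : Γ) (a : Lp ℂ ∞ μ) :
    translate μ g (star a) = star (translate μ g a) := by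
  refine Lp.ext ?_
  have h := (measurePreserving_smul g⁻¹ μ).quasiMeasurePreserving.ae (Lp.coeFn_star a)
  filter_upwards [coeFn_translate μ g (star a), coeFn_translate μ g a,
    Lp.coeFn_star (translate μ g a), h] with x h1 h2 h3 h4
  rw [h1, h3, Pi.star_apply, h2, h4, Pi.star_apply]

theorem oneTensor_mulLinf (a b : Lp ℂ ∞ μ) :
    oneTensor μ ι (mulLinf a b) = mulLinf (oneTensor μ ι a) (oneTensor μ ι b) := by
  have hmp := measurePreserving_snd (μ := gaussianMeasure ι) (ν := μ)
  refine Lp.ext ?_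
  filter_upwards [Lp.coeFn_compMeasurePreserving (mulLinf a b) hmp,
    Lp.coeFn_compMeasurePreserving a hmp, Lp.coeFn_compMeasurePreserving b hmp,
    coeFn_mulLinf (oneTensor μ ι a) (oneTensor μ ι b),
    hmp.quasiMeasurePreserving.ae (coeFn_mulLinf a b)] with x h1 h2 h3 h4 h5
  rw [h4]
  refine h1.trans (h5.trans ?_)
  exact congrArg₂ _ h2.symm h3.symm

theorem oneTensor_star (a : Lp ℂ ∞ μ) : oneTensor μ ι (star a) = star (oneTensor μ ι a) := by
  have hmp := measurePreserving_snd (μ := gaussianMeasure ι) (ν := μ)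
  refine Lp.ext ?_
  filter_upwards [Lp.coeFn_compMeasurePreserving (star a) hmp,
    Lp.coeFn_compMeasurePreserving a hmp, Lp.coeFn_star (oneTensor μ ι a),
    hmp.quasiMeasurePreserving.ae (Lp.coeFn_star a)] with x h1 h2 h3 h4
  rw [h3]
  refine h1.trans (h4.trans ?_)
  exact congrArg star h2.symm

theorem opA_mul (a b : Lp ℂ ∞ μ) :
    opA (Γ := Γ) (ι := ι) μ a * opA μ b = opA μ (mulLinf a b) := by
  ext1 f
  ext1
  funext g
  change (mulOp (oneTensor μ ι (translate μ g⁻¹ a)) * mulOp (oneTensor μ ι (translate μ g⁻¹ b)))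
    (f g) = mulOp (oneTensor μ ι (translate μ g⁻¹ (mulLinf a b))) (f g)
  rw [mulOp_mul, translate_mulLinf, oneTensor_mulLinf]

theorem star_opA (a : Lp ℂ ∞ μ) : star (opA (Γ := Γ) (ι := ι) μ a) = opA μ (star a) := by
  unfold opA
  rw [star_diag μ _ _ _ _ (fun g => by rw [norm_star_Linf, norm_oneTensor, norm_translate])]
  ext1 f
  ext1
  funext g
  change mulOp (star (oneTensor μ ι (translate μ g⁻¹ a))) (f g) =
    mulOp (oneTensor μ ι (translate μ g⁻¹ (star a))) (f g)
  rw [translate_star, oneTensor_star]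

/-- The constant function `1` in `L^∞(X)`. -/
def oneLinf : Lp ℂ ∞ μ := (memLp_const (1 : ℂ)).toLp _

theorem coeFn_oneLinf : oneLinf μ =ᵐ[μ] fun _ => 1 := (memLp_const (1 : ℂ)).coeFn_toLp

theorem opA_one : opA (Γ := Γ) (ι := ι) μ (oneLinf μ) = 1 := by
  ext1 f
  ext1
  funext g
  have h1 : oneTensor μ ι (translate μ g⁻¹ (oneLinf μ)) =ᵐ[(gaussianMeasure ι).prod μ]
      fun _ => 1 := by
    have hmp := measurePreserving_snd (μ := gaussianMeasure ι) (ν := μ)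
    filter_upwards [Lp.coeFn_compMeasurePreserving (translate μ g⁻¹ (oneLinf μ)) hmp,
      hmp.quasiMeasurePreserving.ae (coeFn_translate μ g⁻¹ (oneLinf μ)),
      hmp.quasiMeasurePreserving.ae
        ((measurePreserving_smul g⁻¹⁻¹ μ).quasiMeasurePreserving.ae (coeFn_oneLinf μ))]
      with p h1 h2 h3
    exact h1.trans (h2.trans h3)
  refine Lp.ext ?_
  filter_upwards [coeFn_mulOp (oneTensor μ ι (translate μ g⁻¹ (oneLinf μ))) (f g), h1] with p h2 h3
  change mulOp (oneTensor μ ι (translate μ g⁻¹ (oneLinf μ))) (f g) p = f g p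
  rw [h2, h3, one_mul]

variable (e : HilbertBasis ι ℝ H) (π : Γ →* (H ≃ₗᵢ[ℝ] H))

theorem opD_zero : opD μ e π 0 = 1 := by
  rw [opD, ← diagOmega_zero μ e]
  congr 1
  funext g
  simp

theorem opD_mul (ξ η : H) : opD μ e π ξ * opD μ e π η = opD μ e π (ξ + η) := by
  rw [opD, opD, diagOmega_mul, opD]
  congr 1
  funext g
  simp

theorem star_opD (ξ : H) : star (opD μ e π ξ) = opD μ e π (-ξ) := by
  rw [opD, star_diagOmega, opD]
  congr 1
  funext g
  simp

theorem opD_comm_opA (ξ : H) (a : Lp ℂ ∞ μ) :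
    opD μ e π ξ * opA μ a = opA μ a * opD μ e π ξ := by
  unfold opD opA
  rw [diagOmega_comm_diag]

/-- The elementary operators `(ω(ξ) ⊗ a) u_g`. -/
def gen (ξ : H) (a : Lp ℂ ∞ μ) (g : Γ) : Space Γ μ ι →L[ℂ] Space Γ μ ι :=
  opD μ e π ξ * opA μ a * u μ g

/-- The covariance relations move u_g to the right, which makes the span of these operators an
algebra. -/
theorem gen_mul (ξ ξ' : H) (a a' : Lp ℂ ∞ μ) (g g' : Γ) :
    gen μ e π ξ a g * gen μ e π ξ' a' g' =
      gen μ e π (ξ + π g ξ') (mulLinf a (translate μ g a')) (g * g') := by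
  unfold gen
  calc opD μ e π ξ * opA μ a * u μ g * (opD μ e π ξ' * opA μ a' * u μ g')
      = opD μ e π ξ * opA μ a * (u μ g * opD μ e π ξ') * opA μ a' * u μ g' := by
        simp only [mul_assoc]
    _ = opD μ e π ξ * (opA μ a * opD μ e π (π g ξ')) * (u μ g * opA μ a') * u μ g' := by
        rw [u_mul_opD]; simp only [mul_assoc]
    _ = (opD μ e π ξ * opD μ e π (π g ξ')) * (opA μ a * opA μ (translate μ g a')) *
          (u μ g * u μ g') := by
        rw [u_mul_opA, ← opD_comm_opA]; simp only [mul_assoc]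
    _ = _ := by rw [opD_mul, opA_mul, u_mul]

theorem star_gen (ξ : H) (a : Lp ℂ ∞ μ) (g : Γ) :
    star (gen μ e π ξ a g) = gen μ e π (-(π g⁻¹ ξ)) (translate μ g⁻¹ (star a)) g⁻¹ := by
  unfold gen
  rw [star_mul, star_mul, star_u, star_opA, star_opD, ← opD_comm_opA, ← mul_assoc, u_mul_opD,
    mul_assoc, u_mul_opA, ← mul_assoc, map_neg]

theorem gen_one : gen μ e π 0 (oneLinf μ) 1 = 1 := by
  rw [gen, opD_zero, opA_one, u_one, mul_one, mul_one]

open scoped Classical in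
theorem gen_vacuum (ξ : H) (a : Lp ℂ ∞ μ) (g : Γ) :
    gen μ e π ξ a g (vacuum μ) =
      lp.single 2 g (baseVec μ e (π g⁻¹ ξ) (translate μ g⁻¹ a)) := by
  change opD μ e π ξ (opA μ a (u μ g (vacuum μ))) = _
  rw [u_vacuum, opA, diag_single, opD, diagOmega, diag_single, baseVec]

theorem integral_translate (g : Γ) (a b : Lp ℂ ∞ μ) :
    ∫ x, star (translate μ g a x) * translate μ g b x ∂μ = ∫ x, star (a x) * b x ∂μ := by
  have hmp := measurePreserving_smul g⁻¹ μ
  rw [← integral_smul_eq_self (fun x => star (a x) * b x) (g := g⁻¹)]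
  refine integral_congr_ae ?_
  filter_upwards [coeFn_translate μ g a, coeFn_translate μ g b] with x h1 h2
  rw [h1, h2]

theorem inner_gen_of_ne (ξ ξ' : H) (a a' : Lp ℂ ∞ μ) {g g' : Γ} (h : g ≠ g') :
    inner ℂ (gen μ e π ξ a g (vacuum μ)) (gen μ e π ξ' a' g' (vacuum μ)) = 0 := by
  classical
  rw [gen_vacuum, gen_vacuum, lp.inner_single_left, lp.single_apply_ne _ _ _ h, inner_zero_right]

/-- The fibre over g carries the vectors moved by g⁻¹, and g⁻¹ preserves both the norm of H and μ.
The kernel exp(-‖ξ - ξ'‖²) turns Pythagoras in H into a product formula; every later use of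
orthogonality in H goes through it. -/
theorem inner_gen_same (ξ ξ' : H) (a a' : Lp ℂ ∞ μ) (g : Γ) :
    inner ℂ (gen μ e π ξ a g (vacuum μ)) (gen μ e π ξ' a' g (vacuum μ)) =
      (Real.exp (-‖ξ - ξ'‖ ^ 2) : ℂ) * ∫ x, star (a x) * a' x ∂μ := by
  classical
  rw [gen_vacuum, gen_vacuum, lp.inner_single_left, lp.single_apply_self, inner_baseVec,
    integral_translate, ← map_sub, LinearIsometryEquiv.norm_map]

end Operators

end GaussianDeformation

end

noncomputable section

/-! ### The trace on M̃, and Ω as a separating vector -/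

namespace GaussianDeformation

/-- An indicator function is the product of itself, as an element of L^∞, with the constant 1, and
such functions span a dense subspace of L². -/
theorem dense_bounded {S : Type*} [MeasurableSpace S] (m : Measure S) [IsProbabilityMeasure m]
    {k : Lp ℂ 2 m} (hk : k =ᵐ[m] fun _ => 1) (N : Submodule ℂ (Lp ℂ 2 m))
    (hN : IsClosed (N : Set (Lp ℂ 2 m))) (h : ∀ c : Lp ℂ ∞ m, mulOp c k ∈ N) (f : Lp ℂ 2 m) :
    f ∈ N := by
  refine Lp.induction (by norm_num) (motive := fun f => f ∈ N) ?_
    (fun _ _ _ _ _ h1 h2 => N.add_mem h1 h2) hN f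
  intro c s hs hμs
  rw [Lp.simpleFunc.coe_indicatorConst]
  have : indicatorConstLp 2 hs hμs.ne c = mulOp (indicatorConstLp ∞ hs hμs.ne c) k := by
    refine Lp.ext ?_
    filter_upwards [indicatorConstLp_coeFn (p := 2) (hs := hs) (hμs := hμs.ne) (c := c),
      indicatorConstLp_coeFn (p := ∞) (hs := hs) (hμs := hμs.ne) (c := c),
      coeFn_mulOp (indicatorConstLp ∞ hs hμs.ne c) k, hk] with x h1 h2 h3 h4
    rw [h1, h3, h2, h4, mul_one]
  rw [this]
  exact h _

section Trace

variable {Γ X ι H : Type*} [MeasurableSpace X] (μ : Measure X)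
  [IsProbabilityMeasure μ] [NormedAddCommGroup H] [InnerProductSpace ℝ H] [Group Γ]
  [MulAction Γ X] [MeasurableConstSMul Γ X] [SMulInvariantMeasure Γ X μ]
  (e : HilbertBasis ι ℝ H) (π : Γ →* (H ≃ₗᵢ[ℝ] H))

/-- The span of the elementary operators `(ω(ξ) ⊗ a) u_g` with `ξ ∈ V`. -/
def genSpan (V : Submodule ℝ H) : Submodule ℂ (Space Γ μ ι →L[ℂ] Space Γ μ ι) :=
  Submodule.span ℂ {x | ∃ ξ ∈ V, ∃ a g, x = gen μ e π ξ a g}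

variable {π} in
theorem gen_mem_genSpan {V : Submodule ℝ H} {ξ : H} (hξ : ξ ∈ V) (a : Lp ℂ ∞ μ) (g : Γ) :
    gen μ e π ξ a g ∈ genSpan μ e π V :=
  Submodule.subset_span ⟨ξ, hξ, a, g, rfl⟩

/-- Left multiplication by `(ω(ξ) ⊗ a) u_g`, `ξ ∈ V`, and right multiplication by elements of the
span for `V'`, `V'` invariant and contained in `V`. -/
theorem genSpan_mul {V V' : Submodule ℝ H} (hV : V' ≤ V) (hV' : ∀ g, ∀ ξ ∈ V', π g ξ ∈ V')
    {x y : Space Γ μ ι →L[ℂ] Space Γ μ ι} (hx : x ∈ genSpan μ e π V) (hy : y ∈ genSpan μ e π V') :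
    x * y ∈ genSpan μ e π V := by
  refine Submodule.span_induction₂ (p := fun x y _ _ => x * y ∈ genSpan μ e π V)
    ?_ ?_ ?_ ?_ ?_ ?_ ?_ hx hy
  · rintro _ _ ⟨ξ, hξ, a, g, rfl⟩ ⟨ξ', hξ', a', g', rfl⟩
    rw [gen_mul]
    exact gen_mem_genSpan μ e (V.add_mem hξ (hV (hV' g _ hξ'))) _ _
  · intro y _; rw [zero_mul]; exact zero_mem _
  · intro y _; rw [mul_zero]; exact zero_mem _
  · intro x y z _ _ _ h1 h2; rw [add_mul]; exact add_mem h1 h2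
  · intro x y z _ _ _ h1 h2; rw [mul_add]; exact add_mem h1 h2
  · intro r x y _ _ h; rw [smul_mul_assoc]; exact Submodule.smul_mem _ _ h
  · intro r x y _ _ h; rw [mul_smul_comm]; exact Submodule.smul_mem _ _ h

theorem genSpan_star {V : Submodule ℝ H} (hV : ∀ g, ∀ ξ ∈ V, π g ξ ∈ V)
    {x : Space Γ μ ι →L[ℂ] Space Γ μ ι} (hx : x ∈ genSpan μ e π V) :
    star x ∈ genSpan μ e π V := by
  refine Submodule.span_induction ?_ ?_ ?_ ?_ hx
  · rintro _ ⟨ξ, hξ, a, g, rfl⟩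
    rw [star_gen]
    exact gen_mem_genSpan μ e (V.neg_mem (hV _ _ hξ)) _ _
  · rw [star_zero]; exact zero_mem _
  · intro x y _ _ h1 h2; rw [star_add]; exact add_mem h1 h2
  · intro r x _ h; rw [star_smul]; exact Submodule.smul_mem _ _ h

theorem one_mem_genSpan (V : Submodule ℝ H) : (1 : Space Γ μ ι →L[ℂ] _) ∈ genSpan μ e π V := by
  rw [← gen_one μ e π]
  exact gen_mem_genSpan μ e V.zero_mem _ _

/-- The `*`-algebra spanned by the elementary operators `(ω(ξ) ⊗ a) u_g`, `ξ ∈ V`, for an invariant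
subspace `V`. -/
def genAlg (V : Submodule ℝ H) (hV : ∀ g, ∀ ξ ∈ V, π g ξ ∈ V) :
    StarSubalgebra ℂ (Space Γ μ ι →L[ℂ] Space Γ μ ι) where
  carrier := genSpan μ e π V
  mul_mem' := genSpan_mul μ e π le_rfl hV
  add_mem' := add_mem
  algebraMap_mem' r := by
    rw [Algebra.algebraMap_eq_smul_one]
    exact Submodule.smul_mem _ _ (one_mem_genSpan μ e π V)
  star_mem' := genSpan_star μ e π hV

theorem map_mem_bot (g : Γ) (ξ : H) (hξ : ξ ∈ (⊥ : Submodule ℝ H)) :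
    π g ξ ∈ (⊥ : Submodule ℝ H) := by
  rw [Submodule.mem_bot] at hξ ⊢
  rw [hξ, map_zero]

theorem opD_eq_gen (ξ : H) : opD μ e π ξ = gen μ e π ξ (oneLinf μ) 1 := by
  rw [gen, opA_one, u_one, mul_one, mul_one]

theorem opA_eq_gen (a : Lp ℂ ∞ μ) : opA μ a = gen μ e π 0 a 1 := by
  rw [gen, opD_zero, u_one, mul_one, one_mul]

theorem u_eq_gen (g : Γ) : u μ g = gen μ e π 0 (oneLinf μ) g := by
  rw [gen, opD_zero, opA_one, one_mul, one_mul]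

theorem vnGen_le_centralizer {E : Type*} [NormedAddCommGroup E] [InnerProductSpace ℂ E]
    [CompleteSpace E] {S : Set (E →L[ℂ] E)} {𝒜 : StarSubalgebra ℂ (E →L[ℂ] E)}
    (h : S ⊆ 𝒜) {x : E →L[ℂ] E} (hx : x ∈ vnGen S) :
    x ∈ Set.centralizer (Set.centralizer (𝒜 : Set (E →L[ℂ] E))) := by
  rw [← SetLike.mem_coe, coe_vnGen] at hx
  refine Set.centralizer_subset (Set.centralizer_subset (Set.union_subset h fun y hy => ?_)) hx
  simpa using star_mem (h hy : star y ∈ 𝒜)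

theorem mem_centralizer_of_mem_algM {x : Space Γ μ ι →L[ℂ] Space Γ μ ι} (hx : x ∈ algM Γ μ ι) :
    x ∈ Set.centralizer (Set.centralizer
      (genAlg μ e π ⊥ (map_mem_bot π) : Set (Space Γ μ ι →L[ℂ] Space Γ μ ι))) := by
  refine vnGen_le_centralizer ?_ hx
  rintro _ (⟨a, rfl⟩ | ⟨g, rfl⟩)
  · rw [opA_eq_gen μ e π]; exact gen_mem_genSpan μ e (zero_mem _) _ _
  · rw [u_eq_gen μ e π]; exact gen_mem_genSpan μ e (zero_mem _) _ _

theorem algMtilde_le_vnGen :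
    algMtilde μ e π ≤ vnGen (Set.range (opD μ e π) ∪ Set.range (opA μ) ∪ Set.range (u μ)) := by
  refine vnGen_le ?_
  rintro x (hx | hx)
  · refine (vnGen_le ?_ : algDA μ e π ≤ _) hx
    exact Set.subset_union_left.trans (subset_vnGen _)
  · exact subset_vnGen _ (Or.inr hx)

theorem mem_centralizer_of_mem_algMtilde {x : Space Γ μ ι →L[ℂ] Space Γ μ ι}
    (hx : x ∈ algMtilde μ e π) :
    x ∈ Set.centralizer (Set.centralizer
      (genAlg μ e π ⊤ (fun _ _ _ => trivial) : Set (Space Γ μ ι →L[ℂ] Space Γ μ ι))) := by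
  refine vnGen_le_centralizer ?_ (algMtilde_le_vnGen μ e π hx)
  rintro _ ((⟨ξ, rfl⟩ | ⟨a, rfl⟩) | ⟨g, rfl⟩)
  · rw [opD_eq_gen]; exact gen_mem_genSpan μ e (Submodule.mem_top (R := ℝ)) _ _
  · rw [opA_eq_gen μ e π]; exact gen_mem_genSpan μ e (Submodule.mem_top (R := ℝ)) _ _
  · rw [u_eq_gen μ e π]; exact gen_mem_genSpan μ e (Submodule.mem_top (R := ℝ)) _ _

variable {π} in
theorem gen_mem_algMtilde (ξ : H) (a : Lp ℂ ∞ μ) (g : Γ) :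
    gen μ e π ξ a g ∈ algMtilde μ e π :=
  mul_mem (mul_mem (algDA_le μ e (opD_mem_algDA μ e ξ)) (algDA_le μ e (opA_mem_algDA μ e a)))
    (u_mem μ e g)

theorem genSpan_le_algMtilde {V : Submodule ℝ H} {x : Space Γ μ ι →L[ℂ] Space Γ μ ι}
    (hx : x ∈ genSpan μ e π V) : x ∈ algMtilde μ e π := by
  refine Submodule.span_induction ?_ (zero_mem _) (fun _ _ _ _ => add_mem)
    (fun r x _ h => SMulMemClass.smul_mem r h) hx
  rintro _ ⟨ξ, _, a, g, rfl⟩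
  exact gen_mem_algMtilde μ e ξ a g

theorem vacuum_eq_gen : vacuum μ = gen μ e π 0 (oneLinf μ) 1 (vacuum (ι := ι) μ) := by
  rw [gen_one]; rfl

theorem trace_gen_of_ne (ξ : H) (a : Lp ℂ ∞ μ) {g : Γ} (hg : g ≠ 1) :
    trace μ (gen μ e π ξ a g) = 0 := by
  rw [trace]
  conv_lhs => enter [2]; rw [vacuum_eq_gen μ e π]
  exact inner_gen_of_ne μ e π _ _ _ _ hg.symm

theorem trace_gen_one (ξ : H) (a : Lp ℂ ∞ μ) :
    trace μ (gen μ e π ξ a 1) = (Real.exp (-‖ξ‖ ^ 2) : ℂ) * ∫ x, a x ∂μ := by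
  rw [trace]
  conv_lhs => enter [2]; rw [vacuum_eq_gen μ e π]
  rw [inner_gen_same, zero_sub, norm_neg]
  congr 1
  refine integral_congr_ae ?_
  filter_upwards [coeFn_oneLinf μ] with x hx
  rw [hx, star_one, one_mul]

theorem trace_add (x y : Space Γ μ ι →L[ℂ] Space Γ μ ι) :
    trace μ (x + y) = trace μ x + trace μ y := inner_add_right _ _ _

theorem trace_smul (r : ℂ) (x : Space Γ μ ι →L[ℂ] Space Γ μ ι) :
    trace μ (r • x) = r * trace μ x := inner_smul_right _ _ _

/-- Both traces vanish unless g' = g⁻¹. In that case the Gaussian vectors of the two products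
correspond under the isometry π(g), and the integrands under the measure-preserving map g. -/
theorem trace_gen_mul_comm (ξ ξ' : H) (a a' : Lp ℂ ∞ μ) (g g' : Γ) :
    trace μ (gen μ e π ξ a g * gen μ e π ξ' a' g') =
      trace μ (gen μ e π ξ' a' g' * gen μ e π ξ a g) := by
  rw [gen_mul, gen_mul]
  by_cases h : g * g' = 1
  · have hg' : g' = g⁻¹ := (inv_eq_of_mul_eq_one_right h).symm
    subst hg'
    rw [h, inv_mul_cancel, trace_gen_one, trace_gen_one]
    congr 1
    · have : ξ + π g ξ' = π g (ξ' + π g⁻¹ ξ) := by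
        rw [map_add, ← Function.comp_apply (f := π g) (g := π g⁻¹),
          ← LinearIsometryEquiv.coe_mul, ← map_mul, mul_inv_cancel, map_one]
        exact add_comm _ _
      rw [this, LinearIsometryEquiv.norm_map]
    · rw [← integral_smul_eq_self (fun x => mulLinf a (translate μ g a') x) (g := g)]
      refine integral_congr_ae ?_
      have hmp := (measurePreserving_smul g μ).quasiMeasurePreserving
      filter_upwards [hmp.ae (coeFn_mulLinf a (translate μ g a')), hmp.ae (coeFn_translate μ g a'),
        coeFn_mulLinf a' (translate μ g⁻¹ a), coeFn_translate μ g⁻¹ a] with x h1 h2 h3 h4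
      rw [h1, h2, h3, h4, inv_smul_smul, inv_inv, mul_comm]
  · have h' : g' * g ≠ 1 := fun h' => h (mul_eq_one_comm.1 h')
    rw [trace_gen_of_ne μ e π _ _ h, trace_gen_of_ne μ e π _ _ h']

theorem trace_mul_comm_genSpan {x y : Space Γ μ ι →L[ℂ] Space Γ μ ι}
    (hx : x ∈ genSpan μ e π ⊤) (hy : y ∈ genSpan μ e π ⊤) :
    trace μ (x * y) = trace μ (y * x) := by
  refine Submodule.span_induction₂ (p := fun x y _ _ => trace μ (x * y) = trace μ (y * x))
    ?_ ?_ ?_ ?_ ?_ ?_ ?_ hx hy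
  · rintro _ _ ⟨ξ, hξ, a, g, rfl⟩ ⟨ξ', hξ', a', g', rfl⟩
    exact trace_gen_mul_comm μ e π ξ ξ' a a' g g'
  · intro y _; rw [zero_mul, mul_zero]
  · intro y _; rw [zero_mul, mul_zero]
  · intro x y z _ _ _ h1 h2; rw [add_mul, mul_add, trace_add, trace_add, h1, h2]
  · intro x y z _ _ _ h1 h2; rw [add_mul, mul_add, trace_add, trace_add, h1, h2]
  · intro r x y _ _ h; rw [smul_mul_assoc, mul_smul_comm, trace_smul, trace_smul, h]
  · intro r x y _ _ h; rw [smul_mul_assoc, mul_smul_comm, trace_smul, trace_smul, h]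

theorem norm_vacuum : ‖(vacuum μ : Space Γ μ ι)‖ = 1 := by
  have h1 : ‖oneVec μ ι‖ = 1 := by
    rw [oneVec, Lp.norm_toLp, eLpNorm_const _ (by norm_num) (IsProbabilityMeasure.ne_zero _)]
    simp
  classical
  rw [vacuum, lp.norm_single (by norm_num)]
  exact h1

/-- Two operators that are limits of one net on the vectors that matter have the same trace. -/
theorem trace_mul_eq_of_approx {x y : Space Γ μ ι →L[ℂ] Space Γ μ ι}
    (h : ∀ ε > 0, ∃ a : Space Γ μ ι →L[ℂ] Space Γ μ ι, trace μ (a * y) = trace μ (y * a) ∧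
      ‖x (y (vacuum μ)) - a (y (vacuum μ))‖ < ε ∧ ‖x (vacuum μ) - a (vacuum μ)‖ < ε) :
    trace μ (x * y) = trace μ (y * x) := by
  rw [← sub_eq_zero, ← norm_le_zero_iff]
  refine le_of_forall_pos_le_add fun ε hε => ?_
  obtain ⟨a, h1, h2, h3⟩ := h (ε / (1 + ‖y‖)) (by positivity)
  have h4 : trace μ (x * y) - trace μ (y * x) =
      inner ℂ (vacuum μ) (x (y (vacuum μ)) - a (y (vacuum μ))) -
        inner ℂ (vacuum μ) (y (x (vacuum μ) - a (vacuum μ))) := by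
    rw [inner_sub_right, map_sub, inner_sub_right]
    have : inner ℂ (vacuum μ) (a (y (vacuum μ))) = inner ℂ (vacuum μ) (y (a (vacuum μ))) := h1
    rw [this]
    change inner ℂ (vacuum μ) (x (y (vacuum μ))) - inner ℂ (vacuum μ) (y (x (vacuum μ))) = _
    ring
  have h5 : ‖inner ℂ (vacuum μ) (x (y (vacuum μ)) - a (y (vacuum μ)))‖ ≤ ε / (1 + ‖y‖) := by
    refine (norm_inner_le_norm _ _).trans ?_
    rw [norm_vacuum, one_mul]
    exact h2.le
  have h6 : ‖inner ℂ (vacuum μ) (y (x (vacuum μ) - a (vacuum μ)))‖ ≤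
      ‖y‖ * (ε / (1 + ‖y‖)) := by
    refine (norm_inner_le_norm _ _).trans ?_
    rw [norm_vacuum, one_mul]
    exact (y.le_opNorm _).trans (by gcongr)
  rw [h4, zero_add]
  calc _ ≤ ε / (1 + ‖y‖) + ‖y‖ * (ε / (1 + ‖y‖)) := (norm_sub_le _ _).trans (add_le_add h5 h6)
    _ = ε := by field_simp

/-- The trace property on `M̃`. -/
theorem trace_mul_comm {x y : Space Γ μ ι →L[ℂ] Space Γ μ ι} (hx : x ∈ algMtilde μ e π)
    (hy : y ∈ algMtilde μ e π) : trace μ (x * y) = trace μ (y * x) := by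
  refine trace_mul_eq_of_approx μ fun ε hε => ?_
  obtain ⟨a, ha, h1, h2⟩ := exists_approx_two _ (mem_centralizer_of_mem_algMtilde μ e π hx)
    (y (vacuum μ)) (vacuum μ) hε
  refine ⟨a, ?_, h1, h2⟩
  -- The approximant of y is chosen after a, because it has to be close to y on a Ω; the
  -- approximants carry no common norm bound.
  symm
  refine trace_mul_eq_of_approx μ fun ε hε => ?_
  obtain ⟨b, hb, h1, h2⟩ := exists_approx_two _ (mem_centralizer_of_mem_algMtilde μ e π hy)
    (a (vacuum μ)) (vacuum μ) hε
  exact ⟨b, trace_mul_comm_genSpan μ e π hb ha, h1, h2⟩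

theorem trace_star_mul_self (x : Space Γ μ ι →L[ℂ] Space Γ μ ι) :
    trace μ (star x * x) = ((‖x (vacuum μ)‖ ^ 2 : ℝ) : ℂ) := by
  change inner ℂ (vacuum μ) (star x (x (vacuum μ))) = _
  rw [ContinuousLinearMap.star_eq_adjoint, ContinuousLinearMap.adjoint_inner_right,
    inner_self_eq_norm_sq_to_K]
  push_cast
  rfl

theorem norm2_eq (x : Space Γ μ ι →L[ℂ] Space Γ μ ι) : norm2 μ x = ‖x (vacuum μ)‖ := by
  rw [norm2, trace_star_mul_self, Complex.ofReal_re, Real.sqrt_sq (norm_nonneg _)]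

variable {π}

/-- This is τ(x x*) = τ(x* x). -/
theorem norm_star_vacuum {x : Space Γ μ ι →L[ℂ] Space Γ μ ι} (hx : x ∈ algMtilde μ e π) :
    ‖star x (vacuum μ)‖ = ‖x (vacuum μ)‖ := by
  have h := trace_mul_comm μ e π hx (star_mem hx)
  have h1 := trace_star_mul_self μ (star x)
  rw [star_star, h, trace_star_mul_self] at h1
  have h2 : ‖x (vacuum μ)‖ ^ 2 = ‖star x (vacuum μ)‖ ^ 2 := by exact_mod_cast h1
  exact ((sq_eq_sq₀ (norm_nonneg _) (norm_nonneg _)).1 h2).symm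

/-- Passing to adjoints turns the right multiplication by y into the left multiplication by y*,
which is bounded by ‖y‖. -/
theorem norm_mul_vacuum_le {x y : Space Γ μ ι →L[ℂ] Space Γ μ ι} (hx : x ∈ algMtilde μ e π)
    (hy : y ∈ algMtilde μ e π) : ‖x (y (vacuum μ))‖ ≤ ‖y‖ * ‖x (vacuum μ)‖ := by
  have h := norm_star_vacuum μ e (mul_mem hx hy)
  rw [star_mul] at h
  change ‖star y (star x (vacuum μ))‖ = ‖x (y (vacuum μ))‖ at h
  rw [← h, ← norm_star_vacuum μ e hx, ← norm_star y]
  exact (star y).le_opNorm _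

theorem norm_mul_unitary_vacuum {x y : Space Γ μ ι →L[ℂ] Space Γ μ ι} (hx : x ∈ algMtilde μ e π)
    (hy : y ∈ algMtilde μ e π) (hy' : y * star y = 1) :
    ‖x (y (vacuum μ))‖ = ‖x (vacuum μ)‖ := by
  have hn : ∀ f, ‖star y f‖ = ‖f‖ := by
    intro f
    have : inner ℂ (star y f) (star y f) = inner ℂ f f := by
      rw [ContinuousLinearMap.star_eq_adjoint, ContinuousLinearMap.adjoint_inner_left]
      change inner ℂ f ((y * star y) f) = _
      rw [hy']; rfl
    rw [inner_self_eq_norm_sq_to_K, inner_self_eq_norm_sq_to_K] at this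
    have h2 : ‖star y f‖ ^ 2 = ‖f‖ ^ 2 := by exact_mod_cast this
    exact (sq_eq_sq₀ (norm_nonneg _) (norm_nonneg _)).1 h2
  have h := norm_star_vacuum μ e (mul_mem hx hy)
  rw [star_mul] at h
  change ‖star y (star x (vacuum μ))‖ = ‖x (y (vacuum μ))‖ at h
  rw [← h, hn, norm_star_vacuum μ e hx]

/-- Multiplication by a function that does not depend on `g` commutes with `M̃`. -/
theorem diag_const_comm (c : Lp ℂ ∞ ((gaussianMeasure ι).prod μ)) (C : ℝ) (hC : 0 ≤ C)
    (hc : ∀ _ : Γ, ‖c‖ ≤ C) {x : Space Γ μ ι →L[ℂ] Space Γ μ ι} (hx : x ∈ algMtilde μ e π) :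
    x * diag μ (fun _ => c) C hC hc = diag μ (fun _ => c) C hC hc * x := by
  have hgen : ∀ c : Lp ℂ ∞ ((gaussianMeasure ι).prod μ), ∀ hc : ∀ _ : Γ, ‖c‖ ≤ C,
      ∀ y ∈ Set.range (opD μ e π) ∪ Set.range (opA μ) ∪ Set.range (u (Γ := Γ) μ),
        y * diag μ (fun _ => c) C hC hc = diag μ (fun _ => c) C hC hc * y := by
    rintro c hc _ ((⟨ξ, rfl⟩ | ⟨a, rfl⟩) | ⟨g, rfl⟩)
    · rw [opD, diagOmega_comm_diag]
    · ext1 f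
      ext1
      funext g
      exact congrArg (fun T => T (f g)) (mulOp_comm (oneTensor μ ι (translate μ g⁻¹ a)) c)
    · rfl
  have hx' := algMtilde_le_vnGen μ e π hx
  rw [← SetLike.mem_coe, coe_vnGen] at hx'
  refine (hx' (diag μ (fun _ => c) C hC hc) ?_).symm
  rintro y (hy | hy)
  · exact hgen c hc y hy
  · have hc' : ∀ _ : Γ, ‖star c‖ ≤ C := fun g => by rw [norm_star_Linf]; exact hc g
    have := congrArg star (hgen (star c) hc' _ hy)
    rw [star_mul, star_mul, star_star, star_diag μ _ _ _ _ (fun g => by rw [star_star]; exact hc g)]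
      at this
    simp only [star_star] at this
    exact this.symm

/-- A closed subspace that contains the vectors `c u_g Ω`, `c ∈ L^∞(Z × X)` acting on the right, is
everything. -/
theorem mem_of_diag_const_mem (N : Submodule ℂ (Space Γ μ ι))
    (hN : IsClosed (N : Set (Space Γ μ ι)))
    (h : ∀ (c : Lp ℂ ∞ ((gaussianMeasure ι).prod μ)) (g : Γ),
      diag μ (fun _ => c) ‖c‖ (norm_nonneg c) (fun _ => le_rfl) (u μ g (vacuum μ)) ∈ N)
    (f : Space Γ μ ι) : f ∈ N := by
  classical
  have h1 : ∀ (g : Γ) (k : Base μ ι), lp.single (E := fun _ : Γ => Base μ ι) 2 g k ∈ N := by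
    intro g k
    refine dense_bounded _ (coeFn_oneVec μ (ι := ι)) (N.comap (lp.lsingle (𝕜 := ℂ) (E := fun _ : Γ => Base μ ι) 2 g)) ?_ ?_ k
    · exact hN.preimage (lp.singleContinuousLinearMap ℂ (fun _ : Γ => Base μ ι) 2 g).continuous
    · intro c
      have := h c g
      rw [u_vacuum, diag_single] at this
      exact this
  refine hN.mem_of_tendsto (lp.hasSum_single (by norm_num) f)
    (Eventually.of_forall fun s => N.sum_mem fun g _ => h1 g _)

/-- Ω is separating: x u_g Ω = 0 by the bound on right multiplication, and x commutes with the
operators c acting on the right, whose vectors c u_g Ω are total. -/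
theorem eq_zero_of_vacuum {x : Space Γ μ ι →L[ℂ] Space Γ μ ι} (hx : x ∈ algMtilde μ e π)
    (h0 : x (vacuum μ) = 0) : x = 0 := by
  ext1 f
  refine mem_of_diag_const_mem μ (LinearMap.ker x.toLinearMap) x.isClosed_ker ?_ f
  intro c g
  have h1 := congrArg (fun T => T (u μ g (vacuum μ)))
    (diag_const_comm μ e c ‖c‖ (norm_nonneg c) (fun _ => le_rfl) hx)
  have h2 : ‖x (u μ g (vacuum μ))‖ ≤ 0 := by
    refine (norm_mul_vacuum_le μ e hx (u_mem μ e g)).trans ?_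
    rw [h0, norm_zero, mul_zero]
  refine h1.trans ?_
  change diag μ (fun _ => c) ‖c‖ (norm_nonneg c) (fun _ => le_rfl) (x (u μ g (vacuum μ))) = 0
  rw [norm_le_zero_iff.1 h2, map_zero]

/-- A bounded sequence in `M̃` that is Cauchy in `2`-norm converges strongly in `M̃`. -/
theorem exists_strong_limit {z : ℕ → Space Γ μ ι →L[ℂ] Space Γ μ ι} {C : ℝ}
    (hz : ∀ n, z n ∈ algMtilde μ e π) (hC : ∀ n, ‖z n‖ ≤ C)
    (hcau : CauchySeq fun n => z n (vacuum μ)) :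
    ∃ w ∈ algMtilde μ e π, ∀ f, Tendsto (fun n => z n f) atTop (𝓝 (w f)) := by
  have hC0 : 0 ≤ C := (norm_nonneg _).trans (hC 0)
  -- The vectors on which z n is Cauchy form a subspace, closed by the uniform bound on ‖z n‖. It
  -- contains c u_g Ω, because c commutes with z n and right multiplication by u_g is bounded in
  -- 2-norm.
  let N : Submodule ℂ (Space Γ μ ι) :=
    { carrier := {f | CauchySeq fun n => z n f}
      add_mem' := fun {f g} (hf : CauchySeq _) (hg : CauchySeq _) => by
        simp only [Set.mem_ofPred_eq, map_add]
        exact hf.add hg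
      zero_mem' := by
        simp only [Set.mem_ofPred_eq, map_zero]
        exact cauchySeq_const 0
      smul_mem' := fun r f (hf : CauchySeq _) => by
        simp only [Set.mem_ofPred_eq, map_smul]
        exact (uniformContinuous_const_smul r).comp_cauchySeq hf }
  have hN : IsClosed (N : Set (Space Γ μ ι)) := by
    rw [← isSeqClosed_iff_isClosed]
    intro f g hf hfg
    rw [SetLike.mem_coe]
    change CauchySeq fun n => z n g
    rw [Metric.cauchySeq_iff]
    intro ε hε
    obtain ⟨k, hk⟩ := (Metric.tendsto_atTop.1 hfg (ε / (3 * (C + 1))) (by positivity))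
    have hk := hk k le_rfl
    obtain ⟨n0, hn0⟩ := Metric.cauchySeq_iff.1 (hf k : CauchySeq fun n => z n (f k)) (ε / 3)
      (by positivity)
    have hb : ∀ n, dist (z n g) (z n (f k)) ≤ ε / 3 := by
      intro n
      rw [dist_eq_norm, ← map_sub]
      refine ((z n).le_of_opNorm_le (hC n) _).trans ?_
      rw [← dist_eq_norm, dist_comm]
      calc C * dist (f k) g ≤ (C + 1) * (ε / (3 * (C + 1))) := by gcongr; linarith
        _ = ε / 3 := by field_simp
    refine ⟨n0, fun m hm n hn => ?_⟩
    have h1 := hn0 m hm n hn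
    have h2 := hb m
    have h3 := hb n
    rw [dist_comm] at h3
    linarith [dist_triangle4 (z m g) (z m (f k)) (z n (f k)) (z n g)]
  have hall : ∀ f, CauchySeq fun n => z n f := by
    refine mem_of_diag_const_mem μ N hN ?_
    intro c g
    set R := diag μ (fun _ : Γ => c) ‖c‖ (norm_nonneg c) (fun _ => le_rfl) with hR
    have h1 : ∀ n, z n (R (u μ g (vacuum μ))) = R (z n (u μ g (vacuum μ))) := fun n =>
      congrArg (fun T => T (u μ g (vacuum μ)))
        (diag_const_comm μ e c ‖c‖ (norm_nonneg c) (fun _ => le_rfl) (hz n))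
    change CauchySeq fun n => z n (R (u μ g (vacuum μ)))
    simp only [h1]
    refine R.uniformContinuous.comp_cauchySeq ?_
    rw [Metric.cauchySeq_iff] at hcau ⊢
    intro ε hε
    obtain ⟨n0, hn0⟩ := hcau (ε / (‖u (ι := ι) μ g‖ + 1)) (by positivity)
    refine ⟨n0, fun m hm n hn => ?_⟩
    have h2 := hn0 m hm n hn
    rw [dist_eq_norm] at h2 ⊢
    have h3 := norm_mul_vacuum_le μ e (sub_mem (hz m) (hz n)) (u_mem μ e g)
    have h4 : ‖(z m - z n) (vacuum μ)‖ < ε / (‖u (ι := ι) μ g‖ + 1) := h2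
    calc _ ≤ ‖u (ι := ι) μ g‖ * ‖(z m - z n) (vacuum μ)‖ := h3
      _ ≤ ‖u (ι := ι) μ g‖ * (ε / (‖u (ι := ι) μ g‖ + 1)) := by gcongr
      _ < (‖u (ι := ι) μ g‖ + 1) * (ε / (‖u (ι := ι) μ g‖ + 1)) := by
          have : 0 < ε / (‖u (ι := ι) μ g‖ + 1) := by positivity
          nlinarith
      _ = ε := by field_simp
  choose F hF using fun f => cauchySeq_tendsto_of_complete (hall f)
  have hF' : Tendsto (fun n f => z n f) atTop (𝓝 F) := tendsto_pi_nhds.2 hF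
  refine ⟨continuousLinearMapOfTendsto z hF', ?_, hF⟩
  refine mem_iff_comm_commutant.2 fun y hy => ?_
  ext1 f
  change y (F f) = F (y f)
  refine tendsto_nhds_unique ((y.continuous.tendsto _).comp (hF f)) ((hF (y f)).congr fun n => ?_)
  exact (congrArg (fun T => T f) (mem_iff_comm_commutant.1 (hz n) y hy)).symm

end Trace

end GaussianDeformation

end

noncomputable section

namespace GaussianDeformation

/-! ### Fibrewise multipliers, closed spans of elementary vectors, Fourier coefficients -/

section VecSpan

variable {Γ X ι H : Type*} [MeasurableSpace X] (μ : Measure X)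
  [IsProbabilityMeasure μ]

/-- Multiplication by the scalar `κ g` in the fibre over `g`. -/
def scal (κ : Γ → ℝ) (hκ : ∀ g, |κ g| ≤ 2) : Space Γ μ ι →L[ℂ] Space Γ μ ι :=
  lp.mapCLM 2 (fun g => (κ g : ℂ) • ContinuousLinearMap.id ℂ (Base μ ι)) zero_le_two fun g => by
    refine (norm_smul_le _ _).trans ?_
    rw [Complex.norm_real, Real.norm_eq_abs]
    exact (mul_le_of_le_one_right (abs_nonneg _) ContinuousLinearMap.norm_id_le).trans (hκ g)

theorem scal_apply (κ : Γ → ℝ) (hκ : ∀ g, |κ g| ≤ 2) (f : Space Γ μ ι) (g : Γ) :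
    scal μ κ hκ f g = (κ g : ℂ) • f g := rfl

theorem inner_scal (κ : Γ → ℝ) (hκ : ∀ g, |κ g| ≤ 2) (f k : Space Γ μ ι) :
    inner ℂ (scal μ κ hκ f) k = inner ℂ f (scal μ κ hκ k) := by
  rw [lp.inner_eq_tsum, lp.inner_eq_tsum]
  congr 1
  funext g
  rw [scal_apply, scal_apply, inner_smul_left, inner_smul_right, Complex.conj_ofReal]

theorem summable_norm_sq (f : Space Γ μ ι) : Summable fun g => ‖f g‖ ^ 2 := by
  have h2 : 0 < (2 : ℝ≥0∞).toReal := by simp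
  have := (memℓp_gen_iff h2).1 (lp.memℓp f)
  simpa using this

theorem norm_sq_eq_tsum (f : Space Γ μ ι) : ‖f‖ ^ 2 = ∑' g, ‖f g‖ ^ 2 := by
  have h2 : 0 < (2 : ℝ≥0∞).toReal := by simp
  have := lp.norm_rpow_eq_tsum h2 f
  simpa using this

theorem summable_scal (κ : Γ → ℝ) (hκ : ∀ g, |κ g| ≤ 2) (f : Space Γ μ ι) :
    Summable fun g => κ g * ‖f g‖ ^ 2 := by
  refine Summable.of_norm_bounded ((summable_norm_sq μ f).mul_left 2) fun g => ?_
  rw [norm_mul, Real.norm_eq_abs, Real.norm_of_nonneg (sq_nonneg _)]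
  exact mul_le_mul_of_nonneg_right (hκ g) (sq_nonneg _)

theorem inner_scal_self (κ : Γ → ℝ) (hκ : ∀ g, |κ g| ≤ 2) (f : Space Γ μ ι) :
    inner ℂ f (scal μ κ hκ f) = ((∑' g, κ g * ‖f g‖ ^ 2 : ℝ) : ℂ) := by
  rw [lp.inner_eq_tsum, Complex.ofReal_tsum]
  congr 1
  funext g
  rw [scal_apply, inner_smul_right, inner_self_eq_norm_sq_to_K]
  push_cast
  rfl

theorem tsum_scal_le (κ : Γ → ℝ) (hκ : ∀ g, |κ g| ≤ 2) (F : Finset Γ) {ρ : ℝ} (hρ : 0 ≤ ρ)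
    (h : ∀ g ∉ F, κ g ≤ ρ) (f : Space Γ μ ι) :
    ∑' g, κ g * ‖f g‖ ^ 2 ≤ 2 * ∑ g ∈ F, ‖f g‖ ^ 2 + ρ * ‖f‖ ^ 2 := by
  have hs := summable_scal μ κ hκ f
  rw [norm_sq_eq_tsum, ← hs.sum_add_tsum_subtype_compl F, Finset.mul_sum]
  refine add_le_add (Finset.sum_le_sum fun g _ => ?_) ?_
  · exact mul_le_mul_of_nonneg_right ((le_abs_self _).trans (hκ g)) (sq_nonneg _)
  · rw [← tsum_mul_left]
    have hs2 := (summable_norm_sq μ f).mul_left ρ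
    calc ∑' g : {g // g ∉ F}, κ g * ‖f g‖ ^ 2
        ≤ ∑' g : {g // g ∉ F}, ρ * ‖f g‖ ^ 2 :=
          (hs.subtype _).tsum_le_tsum
            (fun g => mul_le_mul_of_nonneg_right (h g g.2) (sq_nonneg _)) (hs2.subtype _)
      _ ≤ ∑' g, ρ * ‖f g‖ ^ 2 := by
          refine (hs2.tsum_subtype_le (fun g => ρ * ‖f g‖ ^ 2) {g | g ∉ F} ?_)
          exact fun g => mul_nonneg hρ (sq_nonneg _)

variable [NormedAddCommGroup H] [InnerProductSpace ℝ H] [Group Γ]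
  [MulAction Γ X] [MeasurableConstSMul Γ X] [SMulInvariantMeasure Γ X μ]
  (e : HilbertBasis ι ℝ H) (π : Γ →* (H ≃ₗᵢ[ℝ] H))

theorem scal_gen (κ : Γ → ℝ) (hκ : ∀ g, |κ g| ≤ 2) (ξ : H) (a : Lp ℂ ∞ μ) (g : Γ) :
    scal μ κ hκ (gen μ e π ξ a g (vacuum μ)) = (κ g : ℂ) • gen μ e π ξ a g (vacuum μ) := by
  classical
  rw [gen_vacuum]
  ext1
  funext k
  rw [scal_apply, lp.coeFn_smul, Pi.smul_apply]
  by_cases h : k = g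
  · rw [h]
  · rw [lp.single_apply_ne _ _ _ h, smul_zero, smul_zero]

/-- Multiplication by ω(θ g) in the fibre over g is, on that fibre, left multiplication by ω(π(g)
θ_g). So W, right multiplication by ω(ζ) and its truncation all act on elementary vectors by
shifting ξ. -/
theorem diagOmega_gen (θ : Γ → H) (ξ : H) (a : Lp ℂ ∞ μ) (g : Γ) :
    diagOmega μ e θ (gen μ e π ξ a g (vacuum μ)) =
      gen μ e π (π g (θ g) + ξ) a g (vacuum μ) := by
  have h1 : gen μ e π (π g (θ g) + ξ) a g = opD μ e π (π g (θ g)) * gen μ e π ξ a g := by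
    rw [gen, gen, ← opD_mul]
    simp only [mul_assoc]
  rw [h1]
  change _ = opD μ e π (π g (θ g)) (gen μ e π ξ a g (vacuum μ))
  classical
  rw [gen_vacuum, opD, diagOmega, diagOmega, diag_single, diag_single]
  congr 5
  rw [← Function.comp_apply (f := π g⁻¹) (g := π g), ← LinearIsometryEquiv.coe_mul, ← map_mul,
    inv_mul_cancel, map_one]
  rfl

/-- The closed span of the vectors `(ω(ξ) ⊗ a) u_g Ω` with `ξ ∈ V`. -/
def vecSpan (V : Submodule ℝ H) : Submodule ℂ (Space Γ μ ι) :=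
  ((genSpan μ e π V).map
    (ContinuousLinearMap.apply ℂ (Space Γ μ ι) (vacuum μ)).toLinearMap).topologicalClosure

theorem isClosed_vecSpan (V : Submodule ℝ H) : IsClosed (vecSpan μ e π V : Set (Space Γ μ ι)) :=
  Submodule.isClosed_topologicalClosure _

variable {π}

theorem mem_vecSpan_of_genSpan {V : Submodule ℝ H} {y : Space Γ μ ι →L[ℂ] Space Γ μ ι}
    (hy : y ∈ genSpan μ e π V) : y (vacuum μ) ∈ vecSpan μ e π V :=
  subset_closure ⟨y, hy, rfl⟩

theorem exists_genSpan_approx {V : Submodule ℝ H} {f : Space Γ μ ι} (hf : f ∈ vecSpan μ e π V)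
    {ε : ℝ} (hε : 0 < ε) : ∃ y ∈ genSpan μ e π V, ‖f - y (vacuum μ)‖ < ε := by
  obtain ⟨_, ⟨y, hy, rfl⟩, h⟩ := Metric.mem_closure_iff.1 hf ε hε
  exact ⟨y, hy, by rwa [dist_eq_norm] at h⟩

theorem vecSpan_le {V : Submodule ℝ H} {N : Submodule ℂ (Space Γ μ ι)}
    (hN : IsClosed (N : Set (Space Γ μ ι)))
    (h : ∀ ξ ∈ V, ∀ a g, gen μ e π ξ a g (vacuum μ) ∈ N) : vecSpan μ e π V ≤ N := by
  refine Submodule.topologicalClosure_minimal _ ?_ hN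
  rw [Submodule.map_le_iff_le_comap, genSpan, Submodule.span_le]
  rintro _ ⟨ξ, hξ, a, g, rfl⟩
  exact h ξ hξ a g

theorem vecSpan_mono {V V' : Submodule ℝ H} (h : V ≤ V') : vecSpan μ e π V ≤ vecSpan μ e π V' :=
  vecSpan_le μ e (isClosed_vecSpan μ e π V')
    fun _ hξ _ _ => mem_vecSpan_of_genSpan μ e (gen_mem_genSpan μ e (h hξ) _ _)

theorem map_mem_of_gen {V : Submodule ℝ H} {N : Submodule ℂ (Space Γ μ ι)}
    (hN : IsClosed (N : Set (Space Γ μ ι))) (T : Space Γ μ ι →L[ℂ] Space Γ μ ι)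
    (h : ∀ ξ ∈ V, ∀ a g, T (gen μ e π ξ a g (vacuum μ)) ∈ N) {f : Space Γ μ ι}
    (hf : f ∈ vecSpan μ e π V) : T f ∈ N :=
  vecSpan_le μ e (N := N.comap T.toLinearMap) (hN.preimage T.continuous) h hf

/-- A sesquilinear identity between bounded operators that holds on elementary vectors holds on
their closed spans. -/
theorem inner_eq_of_gen {V V' : Submodule ℝ H} (S T S' T' : Space Γ μ ι →L[ℂ] Space Γ μ ι)
    (h : ∀ ξ ∈ V, ∀ a g, ∀ ξ' ∈ V', ∀ a' g',
      inner ℂ (S (gen μ e π ξ a g (vacuum μ))) (T (gen μ e π ξ' a' g' (vacuum μ))) =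
        inner ℂ (S' (gen μ e π ξ a g (vacuum μ))) (T' (gen μ e π ξ' a' g' (vacuum μ))))
    {f f' : Space Γ μ ι} (hf : f ∈ vecSpan μ e π V) (hf' : f' ∈ vecSpan μ e π V') :
    inner ℂ (S f) (T f') = inner ℂ (S' f) (T' f') := by
  have h1 : ∀ ξ ∈ V, ∀ a g, inner ℂ (S (gen μ e π ξ a g (vacuum μ))) (T f') =
      inner ℂ (S' (gen μ e π ξ a g (vacuum μ))) (T' f') := by
    intro ξ hξ a g
    -- The scalar difference is put in front of the non-zero vector Ω, so that its vanishing becomes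
    -- membership in ⊥.
    have := map_mem_of_gen μ e (N := ⊥) isClosed_singleton
      ((ContinuousLinearMap.toSpanSingleton ℂ (vacuum μ)) ∘L
        (((innerSL ℂ (S (gen μ e π ξ a g (vacuum μ)))) ∘L T) -
        ((innerSL ℂ (S' (gen μ e π ξ a g (vacuum μ)))) ∘L T'))) ?_ hf'
    · rw [Submodule.mem_bot] at this
      have hne : (vacuum μ : Space Γ μ ι) ≠ 0 := by
        rw [← norm_ne_zero_iff, norm_vacuum]; exact one_ne_zero
      exact sub_eq_zero.1 ((smul_eq_zero.1 this).resolve_right hne)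
    · intro ξ' hξ' a' g'
      rw [Submodule.mem_bot]
      change (inner ℂ (S (gen μ e π ξ a g (vacuum μ))) (T (gen μ e π ξ' a' g' (vacuum μ))) -
        inner ℂ (S' (gen μ e π ξ a g (vacuum μ))) (T' (gen μ e π ξ' a' g' (vacuum μ)))) •
          vacuum μ = 0
      rw [h ξ hξ a g ξ' hξ' a' g', sub_self, zero_smul]
  have hc : IsClosed {k : Space Γ μ ι | inner ℂ (S k) (T f') = inner ℂ (S' k) (T' f')} :=
    isClosed_eq (by fun_prop) (by fun_prop)
  let N : Submodule ℂ (Space Γ μ ι) :=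
    { carrier := {k | inner ℂ (S k) (T f') = inner ℂ (S' k) (T' f')}
      add_mem' := fun {k l} (hk : _ = _) (hl : _ = _) => by
        change inner ℂ (S (k + l)) (T f') = inner ℂ (S' (k + l)) (T' f')
        rw [map_add, map_add, inner_add_left, inner_add_left, hk, hl]
      zero_mem' := by
        change inner ℂ (S 0) (T f') = inner ℂ (S' 0) (T' f')
        rw [map_zero, map_zero, inner_zero_left, inner_zero_left]
      smul_mem' := fun r k (hk : _ = _) => by
        change inner ℂ (S (r • k)) (T f') = inner ℂ (S' (r • k)) (T' f')
        rw [map_smul, map_smul, inner_smul_left, inner_smul_left, hk] }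
  exact vecSpan_le μ e (N := N) hc h1 hf

theorem vacuum_mem_of_algM {Q : Space Γ μ ι →L[ℂ] Space Γ μ ι} (hQ : Q ∈ algM Γ μ ι) :
    Q (vacuum μ) ∈ vecSpan μ e π ⊥ := by
  refine Metric.mem_closure_iff.2 fun ε hε => ?_
  obtain ⟨a, ha, h, _⟩ := exists_approx_two _ (mem_centralizer_of_mem_algM μ e π hQ)
    (vacuum μ) (vacuum μ) hε
  exact ⟨a (vacuum μ), ⟨a, ha, rfl⟩, by rwa [dist_eq_norm]⟩

/-- Right multiplication by (1 ⊗ a) u_g adds nothing to the vectors ξ, so y keeps its constraint ξ ∈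
V after multiplication by elements of M. -/
theorem genSpan_apply_mem {V : Submodule ℝ H} {y : Space Γ μ ι →L[ℂ] Space Γ μ ι}
    (hy : y ∈ genSpan μ e π V) {f : Space Γ μ ι} (hf : f ∈ vecSpan μ e π ⊥) :
    y f ∈ vecSpan μ e π V := by
  refine map_mem_of_gen μ e (isClosed_vecSpan μ e π V) y (fun ξ hξ a g => ?_) hf
  exact mem_vecSpan_of_genSpan μ e (genSpan_mul μ e π bot_le (map_mem_bot π) hy
    (gen_mem_genSpan μ e hξ a g))

theorem inner_vacuum_eq_trace (x y : Space Γ μ ι →L[ℂ] Space Γ μ ι) :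
    inner ℂ (x (vacuum μ)) (y (vacuum μ)) = trace μ (star x * y) := by
  rw [← ContinuousLinearMap.adjoint_inner_right, ← ContinuousLinearMap.star_eq_adjoint]
  rfl

/-- The vector `x Ω` of `x ∈ M` in the fibre over `g` is controlled by the Fourier coefficient
of `x` at `g`. -/
theorem norm_apply_le_fourierCoefficient (e : HilbertBasis ι ℝ H) (π : Γ →* (H ≃ₗᵢ[ℝ] H))
    {x : Space Γ μ ι →L[ℂ] Space Γ μ ι} (hx : x ∈ algM Γ μ ι)
    (g : Γ) : ‖x (vacuum μ) g‖ ≤ ‖fourierCoefficient μ x g‖ := by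
  classical
  let κ : Γ → ℝ := fun h => if h = g then 1 else 0
  have hκ : ∀ h, |κ h| ≤ 2 := fun h => by
    by_cases hh : h = g <;> simp [κ, hh]
  set f := scal μ κ hκ (x (vacuum μ)) with hf
  have hfx : ‖x (vacuum μ) g‖ ≤ ‖f‖ := by
    have h1 : f g = x (vacuum μ) g := by simp [hf, scal_apply, κ]
    rw [← h1]
    exact lp.norm_apply_le_norm (by norm_num) f g
  let 𝒜 : Submodule ℂ (Space Γ μ ι →L[ℂ] Space Γ μ ι) := Submodule.span ℂ (Set.range (opA μ))
  have h𝒜 : ∀ c ∈ 𝒜, c ∈ algMtilde μ e π ∧ c (vacuum μ) ∈ L2A Γ μ ι := by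
    intro c hc
    refine ⟨?_, ?_⟩
    · refine Submodule.span_induction ?_ (zero_mem _) (fun _ _ _ _ => add_mem)
        (fun r x _ h => SMulMemClass.smul_mem r h) hc
      rintro _ ⟨a, rfl⟩
      exact algDA_le μ e (opA_mem_algDA μ e a)
    · refine subset_closure ?_
      refine Submodule.span_induction (p := fun c _ => c (vacuum μ) ∈
        (Submodule.span ℂ (Set.range fun a : Lp ℂ ∞ μ => opA (Γ := Γ) (ι := ι) μ a (vacuum μ))))
        ?_ (zero_mem _) (fun _ _ _ _ => add_mem) (fun r x _ h => Submodule.smul_mem _ r h) hc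
      rintro _ ⟨a, rfl⟩
      exact Submodule.subset_span ⟨a, rfl⟩
  have hxt : x ∈ algMtilde μ e π := algM_le μ e hx
  have hu : star (u (ι := ι) μ g) ∈ algMtilde μ e π := star_mem (u_mem μ e g)
  have huu : u (ι := ι) μ g * star (u μ g) = 1 := by
    rw [star_u, u_mul, mul_inv_cancel, u_one]
  -- By the trace property ⟨c u_g Ω, x Ω⟩ = τ(c* x u_g*) = ⟨c Ω, E_A(x u_g*)⟩ for c in the span of
  -- A, while ‖c u_g Ω‖ = ‖c Ω‖.
  have hbound : ∀ c ∈ 𝒜, ‖inner ℂ (c (u μ g (vacuum μ))) (x (vacuum μ))‖ ≤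
      ‖c (u μ g (vacuum μ))‖ * ‖fourierCoefficient μ x g‖ := by
    intro c hc
    have hcM := (h𝒜 c hc).1
    have h1 : inner ℂ (c (u μ g (vacuum μ))) (x (vacuum μ)) =
        inner ℂ (c (vacuum μ)) (x (star (u μ g) (vacuum μ))) := by
      have h2 := trace_mul_comm μ e π (mul_mem (star_mem hcM) hxt) hu
      have h3 := inner_vacuum_eq_trace μ c (x * star (u μ g))
      have h4 := inner_vacuum_eq_trace μ (c * u μ g) x
      refine h4.trans (Eq.trans ?_ h3.symm)
      rw [star_mul, ← mul_assoc, h2, mul_assoc]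
    have h2 : inner ℂ (c (vacuum μ)) (x (star (u μ g) (vacuum μ))) =
        inner ℂ (c (vacuum μ)) (fourierCoefficient μ x g) := by
      change _ = inner ℂ (c (vacuum μ))
        ((L2A Γ μ ι).starProjection (x (star (u μ g) (vacuum μ))))
      rw [← Submodule.inner_starProjection_left_eq_right,
        Submodule.starProjection_eq_self_iff.2 (h𝒜 c hc).2]
    rw [h1, h2, norm_mul_unitary_vacuum μ e hcM (u_mem μ e g) huu]
    exact norm_inner_le_norm _ _
  let N : Submodule ℂ (Space Γ μ ι) := (𝒜.map (ContinuousLinearMap.apply ℂ (Space Γ μ ι)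
    (u μ g (vacuum μ))).toLinearMap).topologicalClosure
  have hfN : f ∈ N := by
    refine map_mem_of_gen μ e (π := π) (Submodule.isClosed_topologicalClosure _) _ ?_
      (vacuum_mem_of_algM μ e hx)
    intro ξ hξ a h
    rw [scal_gen, (Submodule.mem_bot ℝ).1 hξ, gen, opD_zero, one_mul]
    by_cases hh : h = g
    · subst hh
      refine Submodule.smul_mem _ _ (subset_closure ?_)
      exact ⟨opA μ a, Submodule.subset_span ⟨a, rfl⟩, rfl⟩
    · simp only [κ, hh, if_false, Complex.ofReal_zero, zero_smul]
      exact zero_mem _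
  have hbound' : ‖inner ℂ f (x (vacuum μ))‖ ≤ ‖f‖ * ‖fourierCoefficient μ x g‖ := by
    refine closure_minimal (t := {k | ‖inner ℂ k (x (vacuum μ))‖ ≤
      ‖k‖ * ‖fourierCoefficient μ x g‖}) ?_ (isClosed_le (by fun_prop) (by fun_prop)) hfN
    rintro _ ⟨c, hc, rfl⟩
    exact hbound c hc
  -- Cutting down to the fibre over g is an orthogonal projection, hence ⟨f, x Ω⟩ = ‖f‖². With
  -- `hbound'` this yields the claim.
  have hff : inner ℂ f (x (vacuum μ)) = ((‖f‖ ^ 2 : ℝ) : ℂ) := by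
    have h1 : scal μ κ hκ f = f := by
      ext1
      funext h
      rw [hf, scal_apply, scal_apply, smul_smul]
      by_cases hh : h = g <;> simp [κ, hh]
    conv_lhs => rw [← h1]
    rw [inner_scal, ← hf, inner_self_eq_norm_sq_to_K]
    push_cast
    rfl
  rw [hff, Complex.norm_real, Real.norm_of_nonneg (sq_nonneg _)] at hbound'
  refine hfx.trans ?_
  by_contra hlt
  push Not at hlt
  have : 0 < ‖f‖ := (norm_nonneg _).trans_lt hlt
  nlinarith

end VecSpan

end GaussianDeformation

end

noncomputable section

/-! ### Mixing: conjugation by v_n pushes Gaussian vectors away from finite-dimensional subspaces -/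

namespace GaussianDeformation

/-- In an orthonormal basis of K the squared norm is a finite sum of squares of matrix coefficients
of π. -/
theorem tendsto_starProjection_of_mixing {Γ H : Type*} [Group Γ] [NormedAddCommGroup H]
    [InnerProductSpace ℝ H] {π : Γ →* (H ≃ₗᵢ[ℝ] H)}
    (hπ : ∀ ξ η : H, Tendsto (fun g : Γ => inner ℝ (π g ξ) η) cofinite (𝓝 0))
    (K : Submodule ℝ H) [FiniteDimensional ℝ K] [K.HasOrthogonalProjection] (ζ : H) :
    Tendsto (fun g : Γ => ‖K.starProjection (π g ζ)‖ ^ 2) cofinite (𝓝 0) := by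
  let b := stdOrthonormalBasis ℝ K
  have h1 : ∀ g : Γ, ‖K.starProjection (π g ζ)‖ ^ 2 = ∑ i, (inner ℝ (π g ζ) (b i : H)) ^ 2 := by
    intro g
    change ‖K.orthogonalProjectionOnto (π g ζ)‖ ^ 2 = _
    rw [← b.sum_sq_norm_inner_right]
    refine Finset.sum_congr rfl fun i _ => ?_
    rw [Real.norm_eq_abs, sq_abs]
    congr 1
    refine Eq.trans ?_ (real_inner_comm _ _)
    refine Eq.trans (real_inner_comm _ _) (Eq.trans ?_ (real_inner_comm _ _))
    exact (K.inner_starProjection_left_eq_right (π g ζ) (b i)).trans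
      (by rw [Submodule.starProjection_eq_self_iff.2 (b i).2])
  simp only [h1]
  have h2 := tendsto_finsetSum (f := fun i (g : Γ) => (inner ℝ (π g ζ) (b i : H)) ^ 2)
    (a := fun _ => 0) (x := cofinite) Finset.univ fun i _ => by
      simpa using (hπ ζ (b i : H)).pow 2
  simpa using h2

theorem inner_self_eq_ofReal {E : Type*} [NormedAddCommGroup E] [InnerProductSpace ℂ E] (f : E) :
    inner ℂ f f = ((‖f‖ ^ 2 : ℝ) : ℂ) := by
  rw [inner_self_eq_norm_sq_to_K]
  push_cast
  rfl

section Mixing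

variable {Γ X ι H : Type*} [MeasurableSpace X] (μ : Measure X)
  [IsProbabilityMeasure μ] [NormedAddCommGroup H] [InnerProductSpace ℝ H] [Group Γ]
  [MulAction Γ X] [MeasurableConstSMul Γ X] [SMulInvariantMeasure Γ X μ]
  (e : HilbertBasis ι ℝ H) (π : Γ →* (H ≃ₗᵢ[ℝ] H))

/-- Right multiplication by `ω(ζ) ⊗ 1`. -/
def rightOmega (ζ : H) : Space Γ μ ι →L[ℂ] Space Γ μ ι := diagOmega μ e fun _ => ζ

/-- The operator that multiplies the fibre over `g` by the part of `g · ω(ζ)` that is orthogonal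
to `K`. -/
def compOmega (K : Submodule ℝ H) [Kᗮ.HasOrthogonalProjection] (ζ : H) :
    Space Γ μ ι →L[ℂ] Space Γ μ ι :=
  diagOmega μ e fun g => π g⁻¹ (Kᗮ.starProjection (π g ζ))

theorem map_map_inv (g : Γ) (ξ : H) : π g (π g⁻¹ ξ) = ξ := by
  rw [← Function.comp_apply (f := π g) (g := π g⁻¹), ← LinearIsometryEquiv.coe_mul, ← map_mul,
    mul_inv_cancel, map_one]
  rfl

theorem rightOmega_gen (ζ ξ : H) (a : Lp ℂ ∞ μ) (g : Γ) :
    rightOmega μ e ζ (gen μ e π ξ a g (vacuum μ)) = gen μ e π (π g ζ + ξ) a g (vacuum μ) :=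
  diagOmega_gen μ e π _ ξ a g

theorem compOmega_gen (K : Submodule ℝ H) [Kᗮ.HasOrthogonalProjection] (ζ ξ : H) (a : Lp ℂ ∞ μ)
    (g : Γ) : compOmega μ e π K ζ (gen μ e π ξ a g (vacuum μ)) =
      gen μ e π (Kᗮ.starProjection (π g ζ) + ξ) a g (vacuum μ) := by
  rw [compOmega, diagOmega_gen, map_map_inv]

variable {π} in
theorem rightOmega_comm (ζ : H) {x : Space Γ μ ι →L[ℂ] Space Γ μ ι} (hx : x ∈ algMtilde μ e π)
    (f : Space Γ μ ι) : x (rightOmega μ e ζ f) = rightOmega μ e ζ (x f) :=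
  congrArg (fun T : Space Γ μ ι →L[ℂ] Space Γ μ ι => T f)
    (diag_const_comm μ e (tensorOne μ (omega e ζ)) 1 zero_le_one
      (fun _ => by rw [norm_tensorOne]; exact norm_omega_le e ζ) hx)

theorem rightOmega_vacuum (ζ : H) : rightOmega μ e ζ (vacuum μ) = opD μ e π ζ (vacuum μ) := by
  rw [vacuum_eq_gen μ e π, rightOmega_gen, ← vacuum_eq_gen, opD_eq_gen, map_one, add_zero]
  rfl

/-- The squared distance between `ω(ζ) ⊗ 1` moved by `g` and its part orthogonal to `K`. -/
def defect (K : Submodule ℝ H) [K.HasOrthogonalProjection] (ζ : H) (g : Γ) : ℝ :=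
  2 * (1 - Real.exp (-‖K.starProjection (π g ζ)‖ ^ 2))

theorem defect_nonneg (K : Submodule ℝ H) [K.HasOrthogonalProjection] (ζ : H) (g : Γ) :
    0 ≤ defect π K ζ g := by
  have : Real.exp (-‖K.starProjection (π g ζ)‖ ^ 2) ≤ 1 :=
    Real.exp_le_one_iff.2 (by simp)
  unfold defect
  linarith

/-- The bound 2 required by `scal` is set by this multiplier; the multiplier `phi` and the
indicators used later are at most 1. -/
theorem abs_defect_le (K : Submodule ℝ H) [K.HasOrthogonalProjection] (ζ : H) (g : Γ) :
    |defect π K ζ g| ≤ 2 := by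
  rw [abs_of_nonneg (defect_nonneg π K ζ g), defect]
  linarith [Real.exp_pos (-‖K.starProjection (π g ζ)‖ ^ 2)]

variable {π} in
theorem finite_defect (hπ : ∀ ξ η : H, Tendsto (fun g : Γ => inner ℝ (π g ξ) η) cofinite (𝓝 0))
    (K : Submodule ℝ H) [FiniteDimensional ℝ K] [K.HasOrthogonalProjection] (ζ : H) {ρ : ℝ}
    (hρ : 0 < ρ) : {g | ρ < defect π K ζ g}.Finite := by
  have h1 := tendsto_starProjection_of_mixing hπ K ζ
  have h2 : Tendsto (fun g : Γ => defect π K ζ g) cofinite (𝓝 (2 * (1 - Real.exp (-0)))) :=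
    ((h1.neg.rexp).const_sub 1).const_mul 2
  rw [neg_zero, Real.exp_zero, sub_self, mul_zero] at h2
  have h3 := (tendsto_order.1 h2).2 ρ hρ
  refine (Filter.eventually_cofinite.1 h3).subset fun g hg => ?_
  exact not_lt.2 (le_of_lt hg)

variable {π} in
-- Split π(g)ζ = p + q along K and Kᗮ. For ξ, ξ' in Kᗮ the two diagonal terms of the expanded inner
-- product equal exp(-‖ξ - ξ'‖²), and by Pythagoras each cross term carries the extra factor
-- exp(-‖p‖²). So the difference scales the inner product on the fibre by 2(1 - exp(-‖p‖²)).
theorem norm_right_sub_comp_sq (K : Submodule ℝ H) [K.HasOrthogonalProjection] (ζ : H)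
    {f : Space Γ μ ι} (hf : f ∈ vecSpan μ e π Kᗮ) :
    ‖rightOmega μ e ζ f - compOmega μ e π K ζ f‖ ^ 2 = ∑' g, defect π K ζ g * ‖f g‖ ^ 2 := by
  have h := inner_eq_of_gen μ e (rightOmega μ e ζ - compOmega μ e π K ζ)
    (rightOmega μ e ζ - compOmega μ e π K ζ) 1 (scal μ (defect π K ζ) (abs_defect_le π K ζ))
    ?_ hf hf
  · have h1 : inner ℂ ((1 : Space Γ μ ι →L[ℂ] Space Γ μ ι) f)
        (scal μ (defect π K ζ) (abs_defect_le π K ζ) f) =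
        ((∑' g, defect π K ζ g * ‖f g‖ ^ 2 : ℝ) : ℂ) := inner_scal_self μ _ _ f
    rw [h1, inner_self_eq_ofReal] at h
    exact Complex.ofReal_injective h
  · intro ξ hξ a g ξ' hξ' a' g'
    simp only [sub_apply, one_apply_eq_self, scal_gen,
      rightOmega_gen, compOmega_gen, inner_sub_left, inner_sub_right, inner_smul_right]
    by_cases hg : g = g'
    · subst hg
      simp only [inner_gen_same]
      set p := K.starProjection (π g ζ) with hp
      set q := Kᗮ.starProjection (π g ζ) with hq
      have hpq : π g ζ = p + q := (K.starProjection_add_starProjection_orthogonal _).symm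
      have hpy : ∀ η ∈ Kᗮ, ‖p + η‖ ^ 2 = ‖p‖ ^ 2 + ‖η‖ ^ 2 := by
        intro η hη
        rw [norm_add_sq_real, (Submodule.mem_orthogonal _ _).1 hη p (K.starProjection_apply_mem _)]
        ring
      have e1 : π g ζ + ξ - (π g ζ + ξ') = ξ - ξ' := by abel
      have e2 : q + ξ - (q + ξ') = ξ - ξ' := by abel
      have e3 : π g ζ + ξ - (q + ξ') = p + (ξ - ξ') := by rw [hpq]; abel
      have e4 : q + ξ - (π g ζ + ξ') = -(p + (ξ' - ξ)) := by rw [hpq]; abel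
      rw [e1, e2, e3, e4, norm_neg, hpy _ (sub_mem hξ hξ'), hpy _ (sub_mem hξ' hξ),
        norm_sub_rev ξ' ξ, neg_add, Real.exp_add, defect]
      push_cast
      ring
    · simp only [inner_gen_of_ne μ e π _ _ _ _ hg]
      simp

variable {π} in
theorem norm_right_sub_comp_le (K : Submodule ℝ H) [K.HasOrthogonalProjection] (ζ : H)
    {f : Space Γ μ ι} (hf : f ∈ vecSpan μ e π Kᗮ) (F : Finset Γ) {ρ : ℝ} (hρ : 0 ≤ ρ)
    (h : ∀ g ∉ F, defect π K ζ g ≤ ρ) :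
    ‖rightOmega μ e ζ f - compOmega μ e π K ζ f‖ ^ 2 ≤
      2 * ∑ g ∈ F, ‖f g‖ ^ 2 + ρ * ‖f‖ ^ 2 := by
  rw [norm_right_sub_comp_sq μ e K ζ hf]
  exact tsum_scal_le μ _ (abs_defect_le π K ζ) F hρ h f

variable {π} in
theorem compOmega_mem (K : Submodule ℝ H) [K.HasOrthogonalProjection] (ζ : H)
    {f : Space Γ μ ι} (hf : f ∈ vecSpan μ e π Kᗮ) :
    compOmega μ e π K ζ f ∈ vecSpan μ e π Kᗮ := by
  refine map_mem_of_gen μ e (isClosed_vecSpan μ e π _) _ (fun ξ hξ a g => ?_) hf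
  rw [compOmega_gen]
  exact mem_vecSpan_of_genSpan μ e
    (gen_mem_genSpan μ e (add_mem (Submodule.starProjection_apply_mem _ _) hξ) a g)

variable {π} in
-- By mixing the defect exceeds ε²/2 only on a finite set of g, and there the mass of f n tends to
-- 0.
theorem eventually_right_sub_comp_lt
    (hπ : ∀ ξ η : H, Tendsto (fun g : Γ => inner ℝ (π g ξ) η) cofinite (𝓝 0))
    (K : Submodule ℝ H) [FiniteDimensional ℝ K] [K.HasOrthogonalProjection] (ζ : H)
    {f : ℕ → Space Γ μ ι} (hf : ∀ n, f n ∈ vecSpan μ e π Kᗮ) (hf1 : ∀ n, ‖f n‖ ≤ 1)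
    (hf0 : ∀ g, Tendsto (fun n => ‖f n g‖) atTop (𝓝 0)) {ε : ℝ} (hε : 0 < ε) :
    ∀ᶠ n in atTop, ‖rightOmega μ e ζ (f n) - compOmega μ e π K ζ (f n)‖ < ε := by
  set F := (finite_defect hπ K ζ (ρ := ε ^ 2 / 2) (by positivity)).toFinset with hF
  have hs : Tendsto (fun n => 2 * ∑ g ∈ F, ‖f n g‖ ^ 2) atTop (𝓝 0) := by
    have := (tendsto_finsetSum (a := fun _ : Γ => (0 : ℝ)) F
      fun g _ => by simpa using (hf0 g).pow 2).const_mul 2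
    simpa using this
  filter_upwards [(tendsto_order.1 hs).2 (ε ^ 2 / 2) (by positivity)] with n hn
  have h1 := norm_right_sub_comp_le μ e K ζ (hf n) F (ρ := ε ^ 2 / 2) (by positivity)
    fun g hg => by simpa [hF] using hg
  have h2 : ε ^ 2 / 2 * ‖f n‖ ^ 2 ≤ ε ^ 2 / 2 :=
    mul_le_of_le_one_right (by positivity) (pow_le_one₀ (norm_nonneg _) (hf1 n))
  refine lt_of_pow_lt_pow_left₀ 2 hε.le ?_
  linarith

variable {π} in
/-- If the Fourier coefficients of the contractions `v n ∈ M` tend to `0`, then `v n T (v n)*`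
becomes orthogonal to every finite-dimensional subspace of `H`. -/
theorem eventually_conj_close
    (hπ : ∀ ξ η : H, Tendsto (fun g : Γ => inner ℝ (π g ξ) η) cofinite (𝓝 0))
    (K : Submodule ℝ H) [FiniteDimensional ℝ K] [K.HasOrthogonalProjection]
    {v : ℕ → Space Γ μ ι →L[ℂ] Space Γ μ ι} (hv : ∀ n, v n ∈ algM Γ μ ι)
    (hv1 : ∀ n, ‖v n‖ ≤ 1) (hv0 : ∀ g, Tendsto (fun n => ‖v n (vacuum μ) g‖) atTop (𝓝 0))
    {T : Space Γ μ ι →L[ℂ] Space Γ μ ι} (hT : T ∈ algMtilde μ e π) {ε : ℝ} (hε : 0 < ε) :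
    ∀ᶠ n in atTop, ∃ y ∈ genSpan μ e π Kᗮ,
      ‖v n (T (star (v n) (vacuum μ))) - y (vacuum μ)‖ < ε := by
  have hvΩ : ∀ n, ‖v n (vacuum μ)‖ ≤ 1 := fun n =>
    ((v n).le_of_opNorm_le (hv1 n) _).trans (by rw [norm_vacuum, one_mul])
  have hvs : ∀ n, ‖star (v n)‖ ≤ 1 := fun n => (norm_star (v n)).trans_le (hv1 n)
  let P : (Space Γ μ ι →L[ℂ] Space Γ μ ι) → Prop := fun T => ∀ ε > 0, ∀ᶠ n in atTop,
    ∃ f ∈ vecSpan μ e π Kᗮ, ‖v n (T (star (v n) (vacuum μ))) - f‖ < ε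
  -- On a generator, v n ω(ξ) is first approximated in 2-norm by y with vectors in Kᗮ. Multiplying
  -- on the right by Q0 (v n)* ∈ M costs at most the factor ‖Q0‖ and does not change the constraint
  -- on the vectors.
  have hgen : ∀ (ξ : H) (a : Lp ℂ ∞ μ) (g : Γ), P (gen μ e π ξ a g) := by
    intro ξ a g ε hε
    set Q0 : Space Γ μ ι →L[ℂ] Space Γ μ ι := opA μ a * u μ g with hQ0
    have hQ0M : Q0 ∈ algM Γ μ ι :=
      mul_mem (subset_vnGen _ (Or.inl ⟨a, rfl⟩)) (subset_vnGen _ (Or.inr ⟨g, rfl⟩))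
    have hfV : ∀ n, v n (vacuum μ) ∈ vecSpan μ e π Kᗮ := fun n =>
      vecSpan_mono μ e bot_le (vacuum_mem_of_algM μ e (hv n))
    filter_upwards [eventually_right_sub_comp_lt μ e hπ K ξ hfV hvΩ hv0
      (ε := ε / (2 * (‖Q0‖ + 1))) (by positivity)] with n hn
    obtain ⟨y, hy, hyd⟩ := exists_genSpan_approx μ e (compOmega_mem μ e K ξ (hfV n))
      (ε := ε / (2 * (‖Q0‖ + 1))) (by positivity)
    have hQ : Q0 * star (v n) ∈ algM Γ μ ι := mul_mem hQ0M (star_mem (hv n))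
    refine ⟨y ((Q0 * star (v n)) (vacuum μ)), genSpan_apply_mem μ e hy
      (vacuum_mem_of_algM μ e hQ), ?_⟩
    have h1 : v n * opD μ e π ξ - y ∈ algMtilde μ e π :=
      sub_mem (mul_mem (algM_le μ e (hv n)) (algDA_le μ e (opD_mem_algDA μ e ξ)))
        (genSpan_le_algMtilde μ e π hy)
    have h2 := norm_mul_vacuum_le μ e h1 (algM_le μ e hQ)
    have h3 : ‖(v n * opD μ e π ξ - y) (vacuum μ)‖ < ε / (‖Q0‖ + 1) := by
      -- Left and right multiplication by ω(ξ) agree on Ω, and the right one commutes with v n.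
      have h4 : (v n * opD μ e π ξ) (vacuum μ) = rightOmega μ e ξ (v n (vacuum μ)) := by
        change v n (opD μ e π ξ (vacuum μ)) = _
        rw [← rightOmega_vacuum μ e π, rightOmega_comm μ e (π := π) ξ (algM_le μ e (hv n))]
      rw [sub_apply, h4]
      calc _ ≤ ‖rightOmega μ e ξ (v n (vacuum μ)) - compOmega μ e π K ξ (v n (vacuum μ))‖ +
            ‖compOmega μ e π K ξ (v n (vacuum μ)) - y (vacuum μ)‖ :=
              norm_sub_le_norm_sub_add_norm_sub _ _ _
        _ < ε / (2 * (‖Q0‖ + 1)) + ε / (2 * (‖Q0‖ + 1)) := add_lt_add hn hyd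
        _ = ε / (‖Q0‖ + 1) := by field_simp; norm_num
    have h5 : ‖Q0 * star (v n)‖ ≤ ‖Q0‖ :=
      (norm_mul_le _ _).trans (mul_le_of_le_one_right (norm_nonneg _) (hvs n))
    have h6 : v n (gen μ e π ξ a g (star (v n) (vacuum μ))) -
        y ((Q0 * star (v n)) (vacuum μ)) =
        (v n * opD μ e π ξ - y) ((Q0 * star (v n)) (vacuum μ)) := rfl
    rw [h6]
    calc _ ≤ ‖Q0 * star (v n)‖ * ‖(v n * opD μ e π ξ - y) (vacuum μ)‖ := h2
      _ ≤ ‖Q0‖ * (ε / (‖Q0‖ + 1)) := by gcongr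
      _ < (‖Q0‖ + 1) * (ε / (‖Q0‖ + 1)) := by
          have : 0 < ε / (‖Q0‖ + 1) := by positivity
          nlinarith
      _ = ε := by field_simp
  have hspan : ∀ c ∈ genSpan μ e π ⊤, P c := by
    intro c hc
    refine Submodule.span_induction ?_ ?_ ?_ ?_ hc
    · rintro _ ⟨ξ, _, a, g, rfl⟩
      exact hgen ξ a g
    · intro ε hε
      refine Eventually.of_forall fun n => ⟨0, zero_mem _, ?_⟩
      simpa using hε
    · intro x y _ _ hx hy ε hε
      filter_upwards [hx (ε / 2) (by positivity), hy (ε / 2) (by positivity)] with n h1 h2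
      obtain ⟨f, hf, h1⟩ := h1
      obtain ⟨k, hk, h2⟩ := h2
      refine ⟨f + k, add_mem hf hk, ?_⟩
      have : v n ((x + y) (star (v n) (vacuum μ))) - (f + k) =
          (v n (x (star (v n) (vacuum μ))) - f) + (v n (y (star (v n) (vacuum μ))) - k) := by
        rw [add_apply, map_add]; abel
      rw [this]
      exact (norm_add_le _ _).trans_lt (by linarith)
    · intro r x _ hx ε hε
      filter_upwards [hx (ε / (‖r‖ + 1)) (by positivity)] with n h1
      obtain ⟨f, hf, h1⟩ := h1
      refine ⟨r • f, Submodule.smul_mem _ _ hf, ?_⟩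
      have : v n ((r • x) (star (v n) (vacuum μ))) - r • f =
          r • (v n (x (star (v n) (vacuum μ))) - f) := by
        rw [smul_apply, map_smul, smul_sub]
      rw [this, norm_smul]
      calc _ ≤ ‖r‖ * (ε / (‖r‖ + 1)) := by gcongr
        _ < (‖r‖ + 1) * (ε / (‖r‖ + 1)) := by
          have : 0 < ε / (‖r‖ + 1) := by positivity
          nlinarith
        _ = ε := by field_simp
  obtain ⟨c, hc, hcd, _⟩ := exists_approx_two _ (mem_centralizer_of_mem_algMtilde μ e π hT)
    (vacuum μ) (vacuum μ) (ε := ε / 3) (by positivity)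
  filter_upwards [hspan c hc (ε / 3) (by positivity)] with n hn
  obtain ⟨f, hf, h1⟩ := hn
  obtain ⟨y, hy, h2⟩ := exists_genSpan_approx μ e hf (ε := ε / 3) (by positivity)
  refine ⟨y, hy, ?_⟩
  -- Replacing T by c costs only the 2-norm of T - c, uniformly in n, since right multiplication by
  -- (v n)* is contractive in 2-norm.
  have h3 : ‖v n (T (star (v n) (vacuum μ))) - v n (c (star (v n) (vacuum μ)))‖ ≤ ε / 3 := by
    rw [← map_sub]
    refine ((v n).le_of_opNorm_le (hv1 n) _).trans ?_
    rw [one_mul]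
    have h4 := norm_mul_vacuum_le μ e (sub_mem hT (genSpan_le_algMtilde μ e π hc))
      (algM_le μ e (star_mem (hv n)))
    refine h4.trans ((mul_le_of_le_one_left (norm_nonneg _) (hvs n)).trans ?_)
    exact hcd.le
  calc _ = ‖(v n (T (star (v n) (vacuum μ))) - v n (c (star (v n) (vacuum μ)))) +
        (v n (c (star (v n) (vacuum μ))) - f) + (f - y (vacuum μ))‖ := by congr 1; abel
    _ ≤ _ := norm_add₃_le
    _ < ε := by linarith

end Mixing

end GaussianDeformation

end

namespace GaussianDeformation

/-! ### Exponentials of self-adjoint operators -/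

section Exp

variable {E : Type*} [NormedAddCommGroup E] [InnerProductSpace ℂ E] [CompleteSpace E]

theorem exp_mem (N : VonNeumannAlgebra E) {x : E →L[ℂ] E} (hx : x ∈ N) :
    NormedSpace.exp x ∈ N :=
  mem_iff_comm_commutant.2 fun z hz =>
    Commute.exp_right (show Commute z x from mem_iff_comm_commutant.1 hx z hz)

theorem exp_I_smul_mem_unitary {h : E →L[ℂ] E} (hh : IsSelfAdjoint h) :
    NormedSpace.exp (Complex.I • h) ∈ unitary (E →L[ℂ] E) :=
  selfAdjoint.expUnitary_coe ⟨h, hh⟩ ▸ (selfAdjoint.expUnitary ⟨h, hh⟩).2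

theorem norm_le_one_of_mem_unitary {x : E →L[ℂ] E} (hx : x ∈ unitary (E →L[ℂ] E)) : ‖x‖ ≤ 1 := by
  refine x.opNorm_le_bound zero_le_one fun f => ?_
  rw [one_mul]
  refine le_of_pow_le_pow_left₀ two_ne_zero (norm_nonneg _) (le_of_eq ?_)
  have h1 : inner ℂ (x f) (x f) = inner ℂ f f := by
    rw [← ContinuousLinearMap.adjoint_inner_right, ← ContinuousLinearMap.star_eq_adjoint]
    change inner ℂ f ((star x * x) f) = _
    rw [Unitary.star_mul_self_of_mem hx, one_apply_eq_self]
  rw [inner_self_eq_ofReal, inner_self_eq_ofReal] at h1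
  exact Complex.ofReal_injective h1

theorem real_smul_mem (N : VonNeumannAlgebra E) (s : ℝ) {x : E →L[ℂ] E} (hx : x ∈ N) :
    s • x ∈ N := by
  rw [← Complex.coe_smul]
  exact SMulMemClass.smul_mem _ hx

theorem norm_exp_smul_le_one {h : E →L[ℂ] E} (hh : IsSelfAdjoint h) (s : ℝ) :
    ‖NormedSpace.exp (s • Complex.I • h)‖ ≤ 1 := by
  have hs : IsSelfAdjoint ((s : ℂ) • h) := by
    rw [IsSelfAdjoint, star_smul, hh.star_eq, Complex.star_def, Complex.conj_ofReal]
  rw [← Complex.coe_smul, smul_comm (s : ℂ) Complex.I h]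
  exact norm_le_one_of_mem_unitary (exp_I_smul_mem_unitary hs)

/-- Duhamel's formula: the derivative of exp(sx) exp((1-s)y) is exp(sx)(x - y) exp((1-s)y), and
exp(sx) is a contraction for x = ih. -/
theorem norm_exp_sub_exp_apply_le {h k : E →L[ℂ] E} (hh : IsSelfAdjoint h)
    (f : E) {C : ℝ}
    (hC : ∀ s : ℝ, ‖(h - k) (NormedSpace.exp (s • Complex.I • k) f)‖ ≤ C) :
    ‖NormedSpace.exp (Complex.I • h) f - NormedSpace.exp (Complex.I • k) f‖ ≤ C := by
  set x := Complex.I • h with hx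
  set y := Complex.I • k with hy
  let G : ℝ → E →L[ℂ] E := fun s =>
    NormedSpace.exp (s • x) * NormedSpace.exp ((1 - s) • y)
  have hG : ∀ s : ℝ, HasDerivAt G
      (NormedSpace.exp (s • x) * ((x - y) * NormedSpace.exp ((1 - s) • y))) s := by
    intro s
    have h1 : HasDerivAt (fun s : ℝ => NormedSpace.exp (s • x)) (NormedSpace.exp (s • x) * x) s :=
      hasDerivAt_exp_smul_const (𝕂 := ℝ) x s
    have h2 := (hasDerivAt_exp_smul_const' (𝕂 := ℝ) y (1 - s)).scomp s
      ((hasDerivAt_id s).const_sub 1)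
    have h3 := h1.mul h2
    refine h3.congr_deriv ?_
    simp only [Function.comp_apply, neg_smul, one_smul, mul_neg, mul_assoc, sub_eq_add_neg,
      add_mul, mul_add, neg_mul]
  let ev : (E →L[ℂ] E) →L[ℝ] E := (ContinuousLinearMap.apply ℂ E f).restrictScalars ℝ
  have hF : ∀ s : ℝ, HasDerivAt (fun s => ev (G s))
      (ev (NormedSpace.exp (s • x) * ((x - y) * NormedSpace.exp ((1 - s) • y)))) s := fun s =>
    ev.hasFDerivAt.comp_hasDerivAt s (hG s)
  have hb : ∀ s : ℝ, ‖ev (NormedSpace.exp (s • x) * ((x - y) * NormedSpace.exp ((1 - s) • y)))‖ ≤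
      C := by
    intro s
    change ‖NormedSpace.exp (s • x) ((x - y) (NormedSpace.exp ((1 - s) • y) f))‖ ≤ _
    refine ((NormedSpace.exp (s • x)).le_of_opNorm_le (norm_exp_smul_le_one hh s) _).trans ?_
    rw [one_mul]
    refine le_trans (le_of_eq ?_) (hC (1 - s))
    rw [hx, hy, ← smul_sub, smul_apply, norm_smul, Complex.norm_I, one_mul]
  have := norm_image_sub_le_of_norm_deriv_le_segment_01'
    (fun s _ => (hF s).hasDerivWithinAt) (fun s _ => hb s)
  refine le_trans (le_of_eq ?_) this
  have e1 : G 1 = NormedSpace.exp x := by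
    simp only [G, one_smul, sub_self, zero_smul, NormedSpace.exp_zero, mul_one]
  have e0 : G 0 = NormedSpace.exp y := by
    simp only [G, sub_zero, one_smul, zero_smul, NormedSpace.exp_zero, one_mul]
  rw [e1, e0]
  rfl

theorem exp_mem_closure (𝒜 : StarSubalgebra ℂ (E →L[ℂ] E)) {x : E →L[ℂ] E} (hx : x ∈ 𝒜) :
    NormedSpace.exp x ∈ closure (𝒜 : Set (E →L[ℂ] E)) := by
  refine mem_closure_of_tendsto (NormedSpace.exp_series_hasSum_exp' (𝕂 := ℂ) x)
    (Eventually.of_forall fun s => ?_)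
  exact sum_mem fun n _ => SMulMemClass.smul_mem _ (pow_mem hx n)

/-- An operator whose one-parameter group is intertwined by `w` is intertwined by `w`. -/
theorem intertwines_of_exp {V V' w x : E →L[ℂ] E}
    (h : ∀ s : ℝ, V * NormedSpace.exp (s • x) * V' * w = w * NormedSpace.exp (s • x)) :
    V * x * V' * w = w * x := by
  have h1 : HasDerivAt (fun s : ℝ => NormedSpace.exp (s • x)) x 0 := by
    have := hasDerivAt_exp_smul_const (𝕂 := ℝ) x (0 : ℝ)
    simpa using this
  have h2 : HasDerivAt (fun s : ℝ => V * NormedSpace.exp (s • x) * V' * w) (V * x * V' * w) 0 :=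
    ((h1.const_mul V).mul_const V').mul_const w
  have h3 : HasDerivAt (fun s : ℝ => w * NormedSpace.exp (s • x)) (w * x) 0 := h1.const_mul w
  simp_rw [h] at h2
  exact h2.unique h3

end Exp

/-! ### 2-norm approximation of exp(ih) with bounded operator norm -/

section Deformed

variable {Γ X ι H : Type*} [MeasurableSpace X] (μ : Measure X)
  [IsProbabilityMeasure μ] [NormedAddCommGroup H] [InnerProductSpace ℝ H] [Group Γ]
  [MulAction Γ X] [MeasurableConstSMul Γ X] [SMulInvariantMeasure Γ X μ]
  (e : HilbertBasis ι ℝ H) {π : Γ →* (H ≃ₗᵢ[ℝ] H)} (b : Cocycle π)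

theorem norm_exp_sub_exp_vacuum_le {h k : Space Γ μ ι →L[ℂ] Space Γ μ ι}
    (hh : h ∈ algMtilde μ e π) (hk : k ∈ algMtilde μ e π) (hsh : IsSelfAdjoint h)
    (hsk : IsSelfAdjoint k) :
    ‖NormedSpace.exp (Complex.I • h) (vacuum μ) - NormedSpace.exp (Complex.I • k) (vacuum μ)‖ ≤
      ‖h (vacuum μ) - k (vacuum μ)‖ := by
  refine norm_exp_sub_exp_apply_le hsh _ fun s => ?_
  have h1 : NormedSpace.exp (s • Complex.I • k) ∈ algMtilde μ e π :=
    exp_mem _ (real_smul_mem _ s (SMulMemClass.smul_mem _ hk))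
  refine (norm_mul_vacuum_le μ e (sub_mem hh hk) h1).trans ?_
  exact mul_le_of_le_one_left (norm_nonneg _) (norm_exp_smul_le_one hsk s)

/-- The unitaries `exp(ih)`, `h = h* ∈ M`, are approximated in `2`-norm by elements of the span of
the `(1 ⊗ a) u_g`, with control of the operator norm. -/
theorem exists_genSpan_approx_exp (π : Γ →* (H ≃ₗᵢ[ℝ] H)) {h : Space Γ μ ι →L[ℂ] Space Γ μ ι}
    (hh : h ∈ algM Γ μ ι) (hsh : IsSelfAdjoint h) {ε : ℝ} (hε : 0 < ε) :
    ∃ y ∈ genSpan μ e π ⊥, ‖y‖ ≤ 2 ∧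
      ‖NormedSpace.exp (Complex.I • h) (vacuum μ) - y (vacuum μ)‖ < ε := by
  obtain ⟨c, hc, hcd, _⟩ := exists_approx_two _ (mem_centralizer_of_mem_algM μ e π hh)
    (vacuum μ) (vacuum μ) (ε := ε / 2) (by positivity)
  -- The adjoint preserves the 2-norm on M̃, so the self-adjoint part of c approximates h as well as
  -- c does.
  set k : Space Γ μ ι →L[ℂ] Space Γ μ ι := (2⁻¹ : ℂ) • (c + star c) with hk
  have hk𝒜 : k ∈ genAlg μ e π ⊥ (map_mem_bot π) :=
    SMulMemClass.smul_mem _ (add_mem hc (star_mem hc))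
  have hsk : IsSelfAdjoint k := by
    rw [IsSelfAdjoint, hk, star_smul, star_add, star_star, add_comm]
    simp
  have hhM : h ∈ algMtilde μ e π := algM_le μ e hh
  have hcM : c ∈ algMtilde μ e π := genSpan_le_algMtilde μ e π hc
  have hkM : k ∈ algMtilde μ e π := genSpan_le_algMtilde μ e π hk𝒜
  have h1 : ‖h (vacuum μ) - k (vacuum μ)‖ < ε / 2 := by
    have h2 : h (vacuum μ) - k (vacuum μ) =
        (2⁻¹ : ℂ) • ((h - c) (vacuum μ)) + (2⁻¹ : ℂ) • (star (h - c) (vacuum μ)) := by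
      rw [star_sub, hsh.star_eq, hk, smul_apply, add_apply, sub_apply, sub_apply]
      module
    have h3 := norm_star_vacuum μ e (sub_mem hhM hcM)
    rw [h2]
    refine (norm_add_le _ _).trans_lt ?_
    rw [norm_smul, norm_smul, h3, sub_apply]
    norm_num
    linarith
  -- Operator-norm distance below 1 from the contraction exp(ik) gives ‖y‖ ≤ 2. This takes the place
  -- of Kaplansky's density theorem.
  obtain ⟨y, hy, hyd⟩ := Metric.mem_closure_iff.1 (exp_mem_closure _
    (SMulMemClass.smul_mem Complex.I hk𝒜)) (min (ε / 2) 1) (by positivity)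
  rw [dist_eq_norm] at hyd
  have hn := norm_le_one_of_mem_unitary (exp_I_smul_mem_unitary hsk)
  refine ⟨y, hy, ?_, ?_⟩
  · have := norm_sub_norm_le y (NormedSpace.exp (Complex.I • k))
    rw [norm_sub_rev] at this
    linarith [min_le_right (ε / 2) 1]
  · have h4 := norm_exp_sub_exp_vacuum_le μ e hhM hkM hsh hsk
    have h5 : ‖NormedSpace.exp (Complex.I • k) (vacuum μ) - y (vacuum μ)‖ < ε / 2 := by
      rw [← sub_apply]
      refine (ContinuousLinearMap.le_opNorm _ _).trans_lt ?_
      rw [norm_vacuum, mul_one]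
      exact hyd.trans_le (min_le_left _ _)
    calc _ ≤ _ := norm_sub_le_norm_sub_add_norm_sub _
          (NormedSpace.exp (Complex.I • k) (vacuum μ)) _
      _ < ε := by linarith

end Deformed

end GaussianDeformation

namespace GaussianDeformation

/-! ### Elements of minimal norm in convex sets of operators -/

section Minimizing

variable {E : Type*} [NormedAddCommGroup E] [InnerProductSpace ℂ E] [CompleteSpace E]

theorem real_smul_apply (s : ℝ) (x : E →L[ℂ] E) (f : E) : (s • x) f = (s : ℂ) • x f := by
  rw [← Complex.coe_smul s x, smul_apply]

/-- Sequences in a convex set of operators that minimize `‖z f‖`. -/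
theorem exists_minimizing {C : Set (E →L[ℂ] E)} (hC : Convex ℝ C) (hne : C.Nonempty) {f : E}
    (hC1 : ∀ z ∈ C, ‖z f‖ ≤ 1) :
    ∃ z : ℕ → E →L[ℂ] E, (∀ n, z n ∈ C) ∧ CauchySeq (fun n => z n f) ∧
      ∀ z' : ℕ → E →L[ℂ] E, (∀ n, z' n ∈ C) → (∀ n, ‖z' n f‖ ≤ ‖z n f‖) →
        Tendsto (fun n => z' n f - z n f) atTop (𝓝 0) := by
  let S : Set ℝ := (fun z => ‖z f‖) '' C
  have hSb : BddBelow S := ⟨0, by rintro _ ⟨z, _, rfl⟩; exact norm_nonneg _⟩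
  set d := sInf S with hd
  have hdle : ∀ z ∈ C, d ≤ ‖z f‖ := fun z hz => csInf_le hSb ⟨z, hz, rfl⟩
  have hd0 : 0 ≤ d := le_csInf (hne.image _) (by rintro _ ⟨z, _, rfl⟩; exact norm_nonneg _)
  have hd1 : d ≤ 1 := by
    obtain ⟨z, hz⟩ := hne
    exact (hdle z hz).trans (hC1 z hz)
  -- The parallelogram law and ‖(z + z') f‖ ≥ 2d give the bound 4(d + η)² - 4d² = 8dη + 4η², at most
  -- 12η because d, η ≤ 1.
  have hpar : ∀ z ∈ C, ∀ z' ∈ C, ∀ η ≤ 1, ‖z f‖ ≤ d + η → ‖z' f‖ ≤ d + η →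
      ‖z f - z' f‖ ^ 2 ≤ 12 * η := by
    intro z hz z' hz' η hη h1 h2
    have hη0 : 0 ≤ η := by linarith [hdle z hz]
    have h3 : (2⁻¹ : ℝ) • z + (2⁻¹ : ℝ) • z' ∈ C :=
      hC hz hz' (by norm_num) (by norm_num) (by norm_num)
    have h4 := hdle _ h3
    rw [add_apply, real_smul_apply, real_smul_apply, ← smul_add, norm_smul, Complex.norm_real]
      at h4
    norm_num at h4
    have h6 := parallelogram_law_with_norm ℂ (z f) (z' f)
    have h7 : ‖z f‖ * ‖z f‖ ≤ (d + η) * (d + η) :=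
      mul_self_le_mul_self (norm_nonneg _) h1
    have h8 : ‖z' f‖ * ‖z' f‖ ≤ (d + η) * (d + η) :=
      mul_self_le_mul_self (norm_nonneg _) h2
    have h9 : (2 * d) * (2 * d) ≤ ‖z f + z' f‖ * ‖z f + z' f‖ :=
      mul_self_le_mul_self (by positivity) (by linarith)
    nlinarith
  have hex : ∀ n : ℕ, ∃ z ∈ C, ‖z f‖ ≤ d + 1 / ((n : ℝ) + 1) := by
    intro n
    obtain ⟨_, ⟨z, hz, rfl⟩, h⟩ := exists_lt_of_csInf_lt (hne.image _)
      (show sInf S < d + 1 / ((n : ℝ) + 1) by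
        rw [← hd]; linarith [Nat.one_div_pos_of_nat (α := ℝ) (n := n)])
    exact ⟨z, hz, h.le⟩
  choose z hzC hzd using hex
  have hη : Tendsto (fun n : ℕ => Real.sqrt (12 * (1 / ((n : ℝ) + 1)))) atTop (𝓝 0) := by
    have := ((tendsto_one_div_add_atTop_nhds_zero_nat (𝕜 := ℝ)).const_mul 12).sqrt
    simpa using this
  have hη1 : ∀ n : ℕ, 1 / ((n : ℝ) + 1) ≤ 1 := fun n => by
    rw [div_le_one (by positivity)]
    linarith [n.cast_nonneg (α := ℝ)]
  refine ⟨z, hzC, ?_, fun z' hz'C hz' => squeeze_zero_norm (fun n => ?_) hη⟩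
  · refine cauchySeq_of_le_tendsto_0 _ (fun n m N hn hm => ?_) hη
    rw [dist_eq_norm]
    have hmono : ∀ k, N ≤ k → 1 / ((k : ℝ) + 1) ≤ 1 / ((N : ℝ) + 1) := fun k hk => by
      gcongr
    exact Real.le_sqrt_of_sq_le (hpar _ (hzC n) _ (hzC m) _ (hη1 N)
      ((hzd n).trans (by linarith [hmono n hn])) ((hzd m).trans (by linarith [hmono m hm])))
  · exact Real.le_sqrt_of_sq_le
      (hpar _ (hz'C n) _ (hzC n) _ (hη1 n) ((hz' n).trans (hzd n)) (hzd n))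

/-- Membership in N, contractivity and the lower bound δ are convex conditions, so they pass from S
to its hull. A linear map z ↦ x z y that preserves S preserves the hull too, so where it does not
increase the norms it sends the minimizing sequence to an asymptotically equal one. -/
theorem exists_minimizing_unitary (N : VonNeumannAlgebra E) {S : Set (E →L[ℂ] E)}
    (hne : S.Nonempty) (hSN : ∀ z ∈ S, z ∈ N) (hSu : ∀ z ∈ S, z ∈ unitary (E →L[ℂ] E))
    {f : E} (hf : ‖f‖ = 1) {δ : ℝ} (hδ : ∀ z ∈ S, δ ≤ (inner ℂ f (z f)).re) :
    ∃ z : ℕ → E →L[ℂ] E, (∀ n, z n ∈ N) ∧ (∀ n, ‖z n‖ ≤ 1) ∧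
      (∀ n, δ ≤ (inner ℂ f (z n f)).re) ∧ CauchySeq (fun n => z n f) ∧
      ∀ x y : E →L[ℂ] E, (∀ s ∈ S, x * s * y ∈ S) → (∀ n, ‖x (z n (y f))‖ ≤ ‖z n f‖) →
        Tendsto (fun n => x (z n (y f)) - z n f) atTop (𝓝 0) := by
  have hCN : ∀ z ∈ convexHull ℝ S, z ∈ N := by
    refine convexHull_min (t := (N : Set (E →L[ℂ] E))) hSN ?_
    intro x hx y hy r s _ _ _
    exact add_mem (real_smul_mem _ r hx) (real_smul_mem _ s hy)
  have hC1 : ∀ z ∈ convexHull ℝ S, ‖z‖ ≤ 1 := by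
    intro z hz
    have : convexHull ℝ S ⊆ Metric.closedBall 0 1 := by
      refine convexHull_min (fun x hx => ?_) (convex_closedBall _ _)
      rw [mem_closedBall_zero_iff]
      exact norm_le_one_of_mem_unitary (hSu x hx)
    exact mem_closedBall_zero_iff.1 (this hz)
  have hCδ : ∀ z ∈ convexHull ℝ S, δ ≤ (inner ℂ f (z f)).re := by
    refine convexHull_min (t := {z : E →L[ℂ] E | δ ≤ (inner ℂ f (z f)).re}) hδ ?_
    intro x hx y hy r s hr hs hrs
    rw [Set.mem_ofPred_eq] at *
    rw [add_apply, inner_add_right, real_smul_apply, real_smul_apply, inner_smul_right,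
      inner_smul_right, Complex.add_re, Complex.re_ofReal_mul, Complex.re_ofReal_mul]
    have : s = 1 - r := by linarith
    subst this
    nlinarith
  obtain ⟨z, hzC, hcau, hmin⟩ := exists_minimizing (convex_convexHull ℝ S) hne.convexHull
    (f := f) fun z hz => (z.le_of_opNorm_le (hC1 z hz) _).trans_eq (by rw [hf, one_mul])
  refine ⟨z, fun n => hCN _ (hzC n), fun n => hC1 _ (hzC n), fun n => hCδ _ (hzC n), hcau, ?_⟩
  intro x y hxy hle
  refine hmin (fun n => x * z n * y) (fun n => ?_) hle
  exact convexHull_min (t := (LinearMap.mulLeftRight ℝ (x, y)) ⁻¹' convexHull ℝ S)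
    (fun s hs => subset_convexHull ℝ S (hxy s hs))
    ((convex_convexHull ℝ _).linear_preimage _) (hzC n)

end Minimizing

/-! ### The intertwiner obtained from a uniform lower bound -/

section ConvexHull

variable {Γ X ι H : Type*} [MeasurableSpace X] (μ : Measure X)
  [IsProbabilityMeasure μ] [NormedAddCommGroup H] [InnerProductSpace ℝ H] [Group Γ]
  [MulAction Γ X] [MeasurableConstSMul Γ X] [SMulInvariantMeasure Γ X μ]
  (e : HilbertBasis ι ℝ H) {π : Γ →* (H ≃ₗᵢ[ℝ] H)} (b : Cocycle π)

theorem Cocycle.map_one : b.toFun 1 = 0 := by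
  have h := b.map_mul 1 1
  rw [_root_.map_one, mul_one] at h
  exact left_eq_add.1 h

theorem implOp_gen (t : ℝ) (ξ : H) (a : Lp ℂ ∞ μ) (g : Γ) :
    implOp μ e b t (gen μ e π ξ a g (vacuum μ)) =
      gen μ e π (t • b.toFun g + ξ) a g (vacuum μ) := by
  rw [implOp, diagOmega_gen, map_smul, map_map_inv]

/-- Ω lies over the identity of Γ, where the cocycle vanishes. -/
theorem implOp_vacuum (t : ℝ) : implOp μ e b t (vacuum μ) = vacuum μ := by
  conv_lhs => rw [vacuum_eq_gen μ e π]
  rw [implOp_gen, b.map_one, smul_zero, zero_add, ← vacuum_eq_gen]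

theorem implOp_mem_unitary (t : ℝ) : implOp μ e b t ∈ unitary (Space Γ μ ι →L[ℂ] Space Γ μ ι) := by
  rw [Unitary.mem_iff, star_implOp]
  exact ⟨implOp_neg_mul μ e b t, implOp_mul_neg μ e b t⟩

/-- `α_t(x) Ω = W x Ω`, where `W` is the unitary implementing `α_t`. -/
theorem conj_vacuum (t : ℝ) (x : Space Γ μ ι →L[ℂ] Space Γ μ ι) :
    (implOp μ e b t * x * star (implOp μ e b t)) (vacuum μ) = implOp μ e b t (x (vacuum μ)) := by
  change implOp μ e b t (x (star (implOp μ e b t) (vacuum μ))) = _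
  rw [star_implOp, implOp_vacuum]

/-- If `τ(x* α_t(x))` is bounded below on a group `G` of unitaries, the element of minimal
`2`-norm in the closed convex hull of the `α_t(x) x*` intertwines `α_t` and the identity on `G`. -/
theorem exists_intertwiner (t : ℝ) {G : Set (Space Γ μ ι →L[ℂ] Space Γ μ ι)}
    (hne : G.Nonempty) (hGM : ∀ x ∈ G, x ∈ algMtilde μ e π)
    (hGu : ∀ x ∈ G, x ∈ unitary (Space Γ μ ι →L[ℂ] Space Γ μ ι))
    (hmul : ∀ x ∈ G, ∀ y ∈ G, x * y ∈ G) {δ : ℝ} (hδ : 0 < δ)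
    (hG : ∀ x ∈ G, δ ≤ (inner ℂ (x (vacuum μ)) (implOp μ e b t (x (vacuum μ)))).re) :
    ∃ w ∈ algMtilde μ e π, w ≠ 0 ∧
      ∀ x ∈ G, implOp μ e b t * x * star (implOp μ e b t) * w = w * x := by
  set W := implOp μ e b t with hW
  let α : (Space Γ μ ι →L[ℂ] Space Γ μ ι) → Space Γ μ ι →L[ℂ] Space Γ μ ι :=
    fun x => W * x * star W
  have hWu := implOp_mem_unitary μ e b t
  have hWW : star W * W = 1 := Unitary.star_mul_self_of_mem hWu
  have hαM : ∀ x ∈ G, α x ∈ algMtilde μ e π := fun x hx => implOp_conj_mem μ e b t (hGM x hx)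
  have hαu : ∀ x ∈ G, α x ∈ unitary (Space Γ μ ι →L[ℂ] Space Γ μ ι) := fun x hx =>
    mul_mem (mul_mem hWu (hGu x hx)) (Unitary.star_mem hWu)
  have hαmul : ∀ x y, α (x * y) = α x * α y := by
    intro x y
    change W * (x * y) * star W = W * x * star W * (W * y * star W)
    calc _ = W * x * 1 * y * star W := by simp only [mul_assoc, one_mul]
      _ = _ := by rw [← hWW]; simp only [mul_assoc]
  obtain ⟨z, hzM, hz1, hzδ, hcau, hmin⟩ := exists_minimizing_unitary (algMtilde μ e π)
    (S := (fun x => α x * star x) '' G) (hne.image _) (by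
      rintro _ ⟨x, hx, rfl⟩
      exact mul_mem (hαM x hx) (star_mem (hGM x hx))) (by
      rintro _ ⟨x, hx, rfl⟩
      exact mul_mem (hαu x hx) (Unitary.star_mem (hGu x hx))) (norm_vacuum μ) (δ := δ) (by
      rintro _ ⟨x, hx, rfl⟩
      refine (hG x hx).trans (le_of_eq ?_)
      have h1 := trace_mul_comm μ e π (hαM x hx) (star_mem (hGM x hx))
      have h2 := inner_vacuum_eq_trace μ x (α x)
      rw [conj_vacuum] at h2
      exact congrArg Complex.re (h2.trans h1.symm))
  obtain ⟨w, hwM, hw⟩ := exists_strong_limit μ e hzM hz1 hcau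
  refine ⟨w, hwM, ?_, fun x hx => ?_⟩
  -- The bound Re τ(z n) ≥ δ > 0 survives the strong limit, which excludes w = 0.
  · rintro rfl
    have h1 : Tendsto (fun n => (inner ℂ (vacuum μ) (z n (vacuum μ))).re) atTop
        (𝓝 (inner ℂ (vacuum μ) ((0 : Space Γ μ ι →L[ℂ] Space Γ μ ι) (vacuum μ))).re) :=
      (Complex.continuous_re.tendsto _).comp (tendsto_const_nhds.inner (hw (vacuum μ)))
    have h2 := ge_of_tendsto' h1 hzδ
    rw [zero_apply, inner_zero_right, Complex.zero_re] at h2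
    linarith
  · have hxx : star x * x = 1 := Unitary.star_mul_self_of_mem (hGu x hx)
    have hxn : ∀ n, ‖α x (z n (star x (vacuum μ)))‖ ≤ ‖z n (vacuum μ)‖ := by
      intro n
      have h1 : ‖z n (star x (vacuum μ))‖ = ‖z n (vacuum μ)‖ :=
        norm_mul_unitary_vacuum μ e (hzM n) (star_mem (hGM x hx)) (by rwa [star_star])
      rw [← h1]
      exact ((α x).le_of_opNorm_le (norm_le_one_of_mem_unitary (hαu x hx)) _).trans_eq (one_mul _)
    have h0 : (α x * w * star x - w) (vacuum μ) = 0 := by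
      have h1 : Tendsto (fun n => α x (z n (star x (vacuum μ))) - z n (vacuum μ)) atTop
          (𝓝 (α x (w (star x (vacuum μ))) - w (vacuum μ))) :=
        (((α x).continuous.tendsto _).comp (hw (star x (vacuum μ)))).sub (hw _)
      -- As α(x) (α(y) y*) x* = α(xy) (xy)* and G is closed under products, z ↦ α(x) z x* preserves
      -- the generating set.
      exact tendsto_nhds_unique h1
        (hmin (α x) (star x) (by
          rintro _ ⟨y, hy, rfl⟩
          refine ⟨x * y, hmul x hx y hy, ?_⟩
          simp only [hαmul, star_mul, mul_assoc]) hxn)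
    have h1 := eq_zero_of_vacuum μ e (sub_mem (mul_mem (mul_mem (hαM x hx) hwM)
      (star_mem (hGM x hx))) hwM) h0
    have h2 : α x * w * star x * x = w * x := congrArg (· * x) (sub_eq_zero.1 h1)
    rwa [mul_assoc, hxx, mul_one] at h2

end ConvexHull

end GaussianDeformation

noncomputable section

namespace GaussianDeformation

/-! ### Compression of α_t to the multiplier exp(-t²‖b(g)‖²) -/

section Compression

variable {Γ X ι H : Type*} [MeasurableSpace X] (μ : Measure X)
  [IsProbabilityMeasure μ] [NormedAddCommGroup H] [InnerProductSpace ℝ H] [Group Γ]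
  [MulAction Γ X] [MeasurableConstSMul Γ X] [SMulInvariantMeasure Γ X μ]
  (e : HilbertBasis ι ℝ H) {π : Γ →* (H ≃ₗᵢ[ℝ] H)} (b : Cocycle π)

/-- The positive definite function `exp(-t² ‖b(g)‖²)`. -/
def phi (t : ℝ) (g : Γ) : ℝ := Real.exp (-‖t • b.toFun g‖ ^ 2)

theorem phi_le_one (t : ℝ) (g : Γ) : phi b t g ≤ 1 := Real.exp_le_one_iff.2 (by simp)

theorem phi_nonneg (t : ℝ) (g : Γ) : 0 ≤ phi b t g := (Real.exp_pos _).le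

theorem abs_phi_le (t : ℝ) (g : Γ) : |phi b t g| ≤ 2 := by
  rw [abs_of_nonneg (phi_nonneg b t g)]
  linarith [phi_le_one b t g]

/-- Fibrewise this is κ² ≤ κ. -/
theorem norm_scal_sq_le {κ : Γ → ℝ} (hκ : ∀ g, |κ g| ≤ 2) (h0 : ∀ g, 0 ≤ κ g)
    (h1 : ∀ g, κ g ≤ 1) (f : Space Γ μ ι) :
    ‖scal μ κ hκ f‖ ^ 2 ≤ (inner ℂ f (scal μ κ hκ f)).re := by
  rw [inner_scal_self, Complex.ofReal_re, norm_sq_eq_tsum]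
  refine (summable_norm_sq μ _).tsum_le_tsum (fun g => ?_) (summable_scal μ κ hκ f)
  rw [scal_apply, norm_smul, Complex.norm_real, Real.norm_of_nonneg (h0 g), mul_pow, pow_two (κ g)]
  refine mul_le_mul_of_nonneg_right ?_ (sq_nonneg _)
  exact mul_le_of_le_one_left (h0 g) (h1 g)

theorem norm_add_sq_of_orthogonal {ξ η : H} (h : inner ℝ ξ η = 0) :
    ‖ξ + η‖ ^ 2 = ‖ξ‖ ^ 2 + ‖η‖ ^ 2 := by
  rw [norm_add_sq_real, h]
  ring

/-- On the fibres over the `g` with `b(g)` orthogonal to `V`, the unitary implementing `α_t`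
compresses to the multiplier `phi`. -/
theorem inner_scal_implOp (t : ℝ) {V : Submodule ℝ H} {κ : Γ → ℝ} (hκ : ∀ g, |κ g| ≤ 2)
    (hV : ∀ g, κ g ≠ 0 → ∀ ξ ∈ V, inner ℝ (b.toFun g) ξ = 0) {f q : Space Γ μ ι}
    (hf : f ∈ vecSpan μ e π V) (hq : q ∈ vecSpan μ e π ⊥) :
    inner ℂ (scal μ κ hκ f) (implOp μ e b t q) =
      inner ℂ (scal μ κ hκ f) (scal μ (phi b t) (abs_phi_le b t) q) := by
  refine inner_eq_of_gen μ e _ _ _ _ ?_ hf hq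
  intro ξ hξ a g ξ' hξ' a' g'
  rw [(Submodule.mem_bot ℝ).1 hξ', implOp_gen, scal_gen, scal_gen, inner_smul_left,
    inner_smul_left, inner_smul_right]
  by_cases hg : g = g'
  · subst hg
    rw [inner_gen_same, inner_gen_same]
    by_cases hk : κ g = 0
    · rw [hk]; simp
    · have h1 : ‖ξ - (t • b.toFun g + 0)‖ ^ 2 = ‖t • b.toFun g‖ ^ 2 + ‖ξ - 0‖ ^ 2 := by
        rw [add_zero, sub_zero, norm_sub_rev, sub_eq_add_neg, norm_add_sq_of_orthogonal, norm_neg]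
        rw [inner_neg_right, inner_smul_left, hV g hk ξ hξ]
        simp
      rw [h1, neg_add, Real.exp_add, phi]
      push_cast
      ring
  · rw [inner_gen_of_ne μ e π _ _ _ _ hg, inner_gen_of_ne μ e π _ _ _ _ hg, mul_zero, mul_zero,
      mul_zero]

/-- With V = 0 there is no condition on b. For q = x Ω, x ∈ M, the left side is τ(x* α_t(x)), which
thereby becomes Σ φ(g)‖q_g‖². -/
theorem inner_implOp (t : ℝ) {q : Space Γ μ ι} (hq : q ∈ vecSpan μ e π ⊥) :
    inner ℂ q (implOp μ e b t q) = inner ℂ q (scal μ (phi b t) (abs_phi_le b t) q) := by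
  have h := inner_scal_implOp μ e b t (V := ⊥) (κ := fun _ => 1) (fun _ => by norm_num)
    (fun g _ ξ hξ => by rw [(Submodule.mem_bot ℝ).1 hξ, inner_zero_right]) hq hq
  have h1 : scal μ (fun _ : Γ => (1 : ℝ)) (fun _ => by norm_num) q = q := by
    ext1
    funext g
    rw [scal_apply, Complex.ofReal_one, one_smul]
  rwa [h1] at h

/-- Modulo vectors orthogonal to a finite-dimensional subspace of `H`, the operator `α_t(x)` agrees
with the image of `x` under the multiplier `phi`. -/
theorem exists_compression (t : ℝ) {x : Space Γ μ ι →L[ℂ] Space Γ μ ι}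
    (hx : x ∈ genSpan μ e π ⊥) :
    ∃ K : Submodule ℝ H, FiniteDimensional ℝ K ∧ ∃ y ∈ genSpan μ e π ⊥,
      y (vacuum μ) = scal μ (phi b t) (abs_phi_le b t) (x (vacuum μ)) ∧
      ∀ f ∈ vecSpan μ e π Kᗮ, ∀ k ∈ vecSpan μ e π Kᗮ,
        inner ℂ (implOp μ e b t (x (star (implOp μ e b t) f))) k = inner ℂ (y f) k := by
  refine Submodule.span_induction ?_ ?_ ?_ ?_ hx
  · rintro _ ⟨ξ, hξ, a, g, rfl⟩
    rw [(Submodule.mem_bot ℝ).1 hξ]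
    -- Two orthogonality relations are needed: b(g) ⊥ ζ, and b(g) ⊥ π(g)ξ, that is π(g)⁻¹ b(g) ⊥ ξ.
    refine ⟨Submodule.span ℝ {b.toFun g, π g⁻¹ (b.toFun g)},
      FiniteDimensional.span_of_finite ℝ (by simp), (phi b t g : ℂ) • gen μ e π 0 a g,
      Submodule.smul_mem _ _ (gen_mem_genSpan μ e (zero_mem _) a g), ?_, ?_⟩
    · rw [scal_gen, smul_apply]
    · intro f hf k hk
      refine inner_eq_of_gen μ e
        (implOp μ e b t * gen μ e π 0 a g * star (implOp μ e b t)) 1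
        ((phi b t g : ℂ) • gen μ e π 0 a g) 1 ?_ hf hk
      intro ξ hξ a' g' ζ hζ a'' g''
      have h1 : ∀ η a' g', gen μ e π 0 a g (gen μ e π η a' g' (vacuum μ)) =
          gen μ e π (π g η) (mulLinf a (translate μ g a')) (g * g') (vacuum μ) := by
        intro η a' g'
        have := congrArg (fun T : Space Γ μ ι →L[ℂ] Space Γ μ ι => T (vacuum μ))
          (gen_mul μ e π 0 η a a' g g')
        rwa [zero_add] at this
      have h2 : (implOp μ e b t * gen μ e π 0 a g * star (implOp μ e b t))
          (gen μ e π ξ a' g' (vacuum μ)) = gen μ e π (t • b.toFun g + π g ξ)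
            (mulLinf a (translate μ g a')) (g * g') (vacuum μ) := by
        change implOp μ e b t (gen μ e π 0 a g (star (implOp μ e b t)
          (gen μ e π ξ a' g' (vacuum μ)))) = _
        -- W* contributes -t b(g') and W contributes t b(gg') = t π(g) b(g') + t b(g); only t b(g)
        -- remains.
        rw [star_implOp, implOp_gen, h1, implOp_gen, b.map_mul, map_add, map_smul]
        congr 2
        module
      rw [h2, smul_apply, h1, one_apply_eq_self, inner_smul_left, Complex.conj_ofReal]
      by_cases hg : g * g' = g''
      · subst hg
        rw [inner_gen_same, inner_gen_same]
        have h3 : inner ℝ (b.toFun g) ζ = 0 :=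
          (Submodule.mem_orthogonal _ _).1 hζ _ (Submodule.subset_span (by simp))
        have h4 : inner ℝ (b.toFun g) (π g ξ) = 0 := by
          have := (Submodule.mem_orthogonal _ _).1 hξ (π g⁻¹ (b.toFun g))
            (Submodule.subset_span (by simp))
          rwa [← (π g).inner_map_map, map_map_inv] at this
        have h5 : ‖t • b.toFun g + π g ξ - ζ‖ ^ 2 = ‖t • b.toFun g‖ ^ 2 + ‖π g ξ - ζ‖ ^ 2 := by
          rw [add_sub_assoc, norm_add_sq_of_orthogonal]
          rw [inner_smul_left, inner_sub_right, h3, h4]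
          simp
        rw [h5, neg_add, Real.exp_add, phi]
        push_cast
        ring
      · rw [inner_gen_of_ne μ e π _ _ _ _ hg, inner_gen_of_ne μ e π _ _ _ _ hg, mul_zero]
  · refine ⟨⊥, inferInstance, 0, zero_mem _, ?_, ?_⟩
    · rw [zero_apply, map_zero]
    · intro f _ k _
      simp only [zero_apply, map_zero]
  · rintro x y _ _ ⟨K, hK, x', hx', h1, h2⟩ ⟨K', hK', y', hy', h3, h4⟩
    refine ⟨K ⊔ K', inferInstance, x' + y', add_mem hx' hy', ?_, ?_⟩
    · rw [add_apply, add_apply, map_add, h1, h3]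
    · intro f hf k hk
      have l1 := vecSpan_mono μ e (π := π) (Submodule.orthogonal_le (le_sup_left : K ≤ K ⊔ K'))
      have l2 := vecSpan_mono μ e (π := π) (Submodule.orthogonal_le (le_sup_right : K' ≤ K ⊔ K'))
      rw [add_apply, add_apply, map_add, inner_add_left, inner_add_left,
        h2 f (l1 hf) k (l1 hk), h4 f (l2 hf) k (l2 hk)]
  · rintro r x _ ⟨K, hK, x', hx', h1, h2⟩
    refine ⟨K, hK, r • x', Submodule.smul_mem _ _ hx', ?_, ?_⟩
    · rw [smul_apply, smul_apply, map_smul, h1]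
    · intro f hf k hk
      rw [smul_apply, smul_apply, map_smul, inner_smul_left, inner_smul_left, h2 f hf k hk]

/-- If `y Ω` is orthogonal to the finite-dimensional `K` and vanishes on a suitable finite subset
of `Γ`, then `y α_t(x) Ω` is almost orthogonal to `K`. -/
theorem exists_finset_close
    (hπ : ∀ ξ η : H, Tendsto (fun g : Γ => inner ℝ (π g ξ) η) cofinite (𝓝 0)) (t : ℝ)
    (K : Submodule ℝ H) [FiniteDimensional ℝ K] [K.HasOrthogonalProjection]
    {x : Space Γ μ ι →L[ℂ] Space Γ μ ι} (hx : x ∈ genSpan μ e π ⊥) :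
    ∀ ε > 0, ∃ F : Finset Γ, ∀ y ∈ algMtilde μ e π, y (vacuum μ) ∈ vecSpan μ e π Kᗮ →
      ‖y (vacuum μ)‖ ≤ 2 → (∀ g ∈ F, y (vacuum μ) g = 0) →
      ∃ k ∈ vecSpan μ e π Kᗮ, ‖y (implOp μ e b t (x (vacuum μ))) - k‖ < ε := by
  refine Submodule.span_induction ?_ ?_ ?_ ?_ hx
  · rintro _ ⟨ξ, hξ, a, g, rfl⟩ ε hε
    rw [(Submodule.mem_bot ℝ).1 hξ]
    set Q : Space Γ μ ι →L[ℂ] Space Γ μ ι := opA μ a * u μ g with hQ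
    set ζ : H := t • b.toFun g with hζ
    have hQM : Q ∈ algM Γ μ ι :=
      mul_mem (subset_vnGen _ (Or.inl ⟨a, rfl⟩)) (subset_vnGen _ (Or.inr ⟨g, rfl⟩))
    set ρ := ε / (4 * (‖Q‖ + 1)) with hρ
    have hρ0 : 0 < ρ := by positivity
    -- F depends on x, K and ε but not on y, so K may be enlarged later by b(F). Off F the defect is
    -- at most (ρ/2)², and ‖y Ω‖ ≤ 2 turns this into ρ².
    set F := (finite_defect hπ K ζ (ρ := (ρ / 2) ^ 2) (by positivity)).toFinset with hF
    refine ⟨F, fun y hy hyK hy2 hyF => ?_⟩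
    have h1 : ‖rightOmega μ e ζ (y (vacuum μ)) - compOmega μ e π K ζ (y (vacuum μ))‖ ≤ ρ := by
      have h2 := norm_right_sub_comp_le μ e K ζ hyK F (ρ := (ρ / 2) ^ 2) (by positivity)
        fun g hg => by simpa [hF] using hg
      rw [Finset.sum_eq_zero fun g hg => by rw [hyF g hg, norm_zero]; ring, mul_zero, zero_add]
        at h2
      refine le_of_pow_le_pow_left₀ two_ne_zero hρ0.le (h2.trans ?_)
      have h3 : ‖y (vacuum μ)‖ ^ 2 ≤ 2 ^ 2 := pow_le_pow_left₀ (norm_nonneg _) hy2 2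
      calc (ρ / 2) ^ 2 * ‖y (vacuum μ)‖ ^ 2 ≤ (ρ / 2) ^ 2 * 2 ^ 2 := by gcongr
        _ = ρ ^ 2 := by ring
    obtain ⟨z, hz, hzd⟩ := exists_genSpan_approx μ e (compOmega_mem μ e K ζ hyK) hρ0
    refine ⟨z (Q (vacuum μ)), genSpan_apply_mem μ e hz (vacuum_mem_of_algM μ e hQM), ?_⟩
    have h4 : y * opD μ e π ζ - z ∈ algMtilde μ e π :=
      sub_mem (mul_mem hy (algDA_le μ e (opD_mem_algDA μ e ζ))) (genSpan_le_algMtilde μ e π hz)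
    have h5 : ‖(y * opD μ e π ζ - z) (vacuum μ)‖ ≤ 2 * ρ := by
      -- On Ω, ω(ζ) also acts from the right, so y ω(ζ) Ω arises from y Ω by the operator that
      -- mixing allows to be truncated to Kᗮ.
      have h6 : (y * opD μ e π ζ) (vacuum μ) = rightOmega μ e ζ (y (vacuum μ)) := by
        change y (opD μ e π ζ (vacuum μ)) = _
        rw [← rightOmega_vacuum μ e π, rightOmega_comm μ e (π := π) ζ hy]
      rw [sub_apply, h6]
      calc _ ≤ _ := norm_sub_le_norm_sub_add_norm_sub _
            (compOmega μ e π K ζ (y (vacuum μ))) _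
        _ ≤ 2 * ρ := by linarith
    have h6 : y (implOp μ e b t (gen μ e π 0 a g (vacuum μ))) - z (Q (vacuum μ)) =
        (y * opD μ e π ζ - z) (Q (vacuum μ)) := by
      rw [implOp_gen, add_zero]
      rfl
    rw [h6]
    calc _ ≤ ‖Q‖ * ‖(y * opD μ e π ζ - z) (vacuum μ)‖ :=
          norm_mul_vacuum_le μ e h4 (algM_le μ e hQM)
      _ ≤ ‖Q‖ * (2 * ρ) := by gcongr
      _ < (‖Q‖ + 1) * (4 * ρ) := by nlinarith [norm_nonneg Q]
      _ = ε := by rw [hρ]; field_simp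
  · intro ε hε
    refine ⟨∅, fun y _ _ _ _ => ⟨0, zero_mem _, ?_⟩⟩
    simpa using hε
  · intro x x' _ _ h1 h2 ε hε
    classical
    obtain ⟨F, hF⟩ := h1 (ε / 2) (by positivity)
    obtain ⟨F', hF'⟩ := h2 (ε / 2) (by positivity)
    refine ⟨F ∪ F', fun y hy hyK hy2 hyF => ?_⟩
    obtain ⟨k, hk, hkd⟩ := hF y hy hyK hy2 fun g hg => hyF g (Finset.mem_union_left _ hg)
    obtain ⟨k', hk', hkd'⟩ := hF' y hy hyK hy2 fun g hg => hyF g (Finset.mem_union_right _ hg)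
    refine ⟨k + k', add_mem hk hk', ?_⟩
    rw [add_apply, map_add, map_add, add_sub_add_comm]
    exact (norm_add_le _ _).trans_lt (by linarith)
  · intro r x _ h1 ε hε
    obtain ⟨F, hF⟩ := h1 (ε / (‖r‖ + 1)) (by positivity)
    refine ⟨F, fun y hy hyK hy2 hyF => ?_⟩
    obtain ⟨k, hk, hkd⟩ := hF y hy hyK hy2 hyF
    refine ⟨r • k, Submodule.smul_mem _ _ hk, ?_⟩
    rw [smul_apply, map_smul, map_smul, ← smul_sub, norm_smul]
    calc _ ≤ ‖r‖ * (ε / (‖r‖ + 1)) := by gcongr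
      _ < (‖r‖ + 1) * (ε / (‖r‖ + 1)) := by
        have : 0 < ε / (‖r‖ + 1) := by positivity
        nlinarith
      _ = ε := by field_simp

/-- Multiplying the coefficients of an element of the span by `κ`. -/
theorem exists_scal_vacuum {V : Submodule ℝ H} {κ : Γ → ℝ} (hκ : ∀ g, |κ g| ≤ 2)
    {y : Space Γ μ ι →L[ℂ] Space Γ μ ι} (hy : y ∈ genSpan μ e π V) :
    ∃ z ∈ genSpan μ e π V, z (vacuum μ) = scal μ κ hκ (y (vacuum μ)) := by
  refine Submodule.span_induction ?_ ?_ ?_ ?_ hy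
  · rintro _ ⟨ξ, hξ, a, g, rfl⟩
    refine ⟨(κ g : ℂ) • gen μ e π ξ a g, Submodule.smul_mem _ _ (gen_mem_genSpan μ e hξ a g), ?_⟩
    rw [scal_gen, smul_apply]
  · exact ⟨0, zero_mem _, by rw [zero_apply, map_zero]⟩
  · rintro x y _ _ ⟨x', hx', h1⟩ ⟨y', hy', h2⟩
    exact ⟨x' + y', add_mem hx' hy', by rw [add_apply, add_apply, map_add, h1, h2]⟩
  · rintro r x _ ⟨x', hx', h1⟩
    exact ⟨r • x', Submodule.smul_mem _ _ hx', by rw [smul_apply, smul_apply, map_smul, h1]⟩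

end Compression

end GaussianDeformation

end

noncomputable section

namespace GaussianDeformation

/-! ### Quantitative estimates -/

section Numerical

variable {E : Type*} [NormedAddCommGroup E] [InnerProductSpace ℂ E]

theorem re_inner_le_add {f g k : E} (hf : ‖f‖ ≤ 1) {c d : ℝ} (hk : ‖k - g‖ ≤ c)
    (hg : (inner ℂ f g).re ≤ d) : (inner ℂ f k).re ≤ d + c := by
  have h1 : (inner ℂ f k).re = (inner ℂ f g).re + (inner ℂ f (k - g)).re := by
    rw [← Complex.add_re, ← inner_add_right, add_sub_cancel]
  have h2 : (inner ℂ f (k - g)).re ≤ 1 * c :=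
    (Complex.re_le_norm _).trans ((norm_inner_le_norm _ _).trans
      (mul_le_mul hf hk (norm_nonneg _) zero_le_one))
  linarith

/-- Expand 1 = ⟨f, f⟩ = ⟨f, f - k⟩ + ⟨f - p, k⟩ + ⟨p, k⟩. -/
theorem norm_inner_ge {f p k : E} (hf : ‖f‖ = 1) {c d : ℝ} (hp : ‖f - p‖ ≤ c)
    (hk : ‖f - k‖ ≤ d) : 1 - d - c * ‖k‖ ≤ ‖inner ℂ p k‖ := by
  have h1 : ((‖f‖ ^ 2 : ℝ) : ℂ) = inner ℂ f (f - k) + inner ℂ (f - p) k + inner ℂ p k := by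
    rw [← inner_self_eq_ofReal, inner_sub_right, inner_sub_left]
    ring
  have h2 := congrArg norm h1
  rw [Complex.norm_real, Real.norm_of_nonneg (sq_nonneg _), hf, one_pow] at h2
  have h3 : ‖inner ℂ f (f - k)‖ ≤ 1 * d :=
    (norm_inner_le_norm _ _).trans (mul_le_mul hf.le hk (norm_nonneg _) zero_le_one)
  have h4 : ‖inner ℂ (f - p) k‖ ≤ c * ‖k‖ :=
    (norm_inner_le_norm _ _).trans (mul_le_mul_of_nonneg_right hp (norm_nonneg _))
  have h5 := norm_add₃_le (a := inner ℂ f (f - k)) (b := inner ℂ (f - p) k) (c := inner ℂ p k)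
  linarith

end Numerical

section Estimate

variable {Γ X ι H : Type*} [MeasurableSpace X] (μ : Measure X)
  [IsProbabilityMeasure μ] [NormedAddCommGroup H] [InnerProductSpace ℝ H] [Group Γ]
  [MulAction Γ X] [MeasurableConstSMul Γ X] [SMulInvariantMeasure Γ X μ]
  (e : HilbertBasis ι ℝ H) {π : Γ →* (H ≃ₗᵢ[ℝ] H)} (b : Cocycle π)

open scoped Classical in
/-- The indicator function of a finite set. -/
def ind (F : Finset Γ) (g : Γ) : ℝ := if g ∈ F then 1 else 0

theorem abs_ind_le (F : Finset Γ) (g : Γ) : |ind F g| ≤ 2 := by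
  unfold ind
  split_ifs <;> simp

theorem ind_mul_self (F : Finset Γ) (g : Γ) : ind F g * ind F g = ind F g := by
  unfold ind
  split_ifs <;> simp

theorem scal_ind_apply (F : Finset Γ) (f : Space Γ μ ι) {g : Γ} (hg : g ∈ F) :
    scal μ (ind F) (abs_ind_le F) f g = f g := by
  rw [scal_apply, ind, if_pos hg, Complex.ofReal_one, one_smul]

theorem norm_scal_phi_le (t : ℝ) {q : Space Γ μ ι} (hq : q ∈ vecSpan μ e π ⊥) {d : ℝ}
    (hd : 0 ≤ d) (hqd : (inner ℂ q (implOp μ e b t q)).re ≤ d ^ 2) :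
    ‖scal μ (phi b t) (abs_phi_le b t) q‖ ≤ d := by
  refine le_of_pow_le_pow_left₀ two_ne_zero hd (le_trans ?_ hqd)
  rw [inner_implOp μ e b t hq]
  exact norm_scal_sq_le μ _ (phi_nonneg b t) (phi_le_one b t) q

/-- Let p be the part of f over F. Then ‖p‖² = ⟨p, f⟩, and f may be replaced by W q at cost c‖p‖.
Over F the vectors b(g) are orthogonal to V, so ⟨p, W q⟩ = ⟨p, φ q⟩ with ‖φ q‖ ≤ d. -/
theorem norm_scal_ind_le (t : ℝ) {V : Submodule ℝ H} {F : Finset Γ}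
    (hF : ∀ g ∈ F, ∀ ξ ∈ V, inner ℝ (b.toFun g) ξ = 0) {f q : Space Γ μ ι}
    (hf : f ∈ vecSpan μ e π V) (hq : q ∈ vecSpan μ e π ⊥) {c d : ℝ} (hd : 0 ≤ d)
    (hfq : ‖implOp μ e b t q - f‖ ≤ c) (hqd : (inner ℂ q (implOp μ e b t q)).re ≤ d ^ 2) :
    ‖scal μ (ind F) (abs_ind_le F) f‖ ≤ d + c := by
  set p := scal μ (ind F) (abs_ind_le F) f with hp
  have hpp : scal μ (ind F) (abs_ind_le F) p = p := by
    ext1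
    funext g
    rw [hp, scal_apply, scal_apply, smul_smul, ← Complex.ofReal_mul, ind_mul_self]
  have h1 : inner ℂ p (implOp μ e b t q) =
      inner ℂ p (scal μ (phi b t) (abs_phi_le b t) q) := by
    refine inner_scal_implOp μ e b t (abs_ind_le F) (fun g hg => hF g ?_) hf hq
    by_contra h
    exact hg (if_neg h)
  have h2 : ‖p‖ ^ 2 ≤ ‖p‖ * d + ‖p‖ * c := by
    have h3 : ((‖p‖ ^ 2 : ℝ) : ℂ) = inner ℂ p f := by
      rw [← inner_self_eq_ofReal]
      conv_lhs => enter [2]; rw [hp]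
      rw [← inner_scal, hpp]
    have h4 : inner ℂ p f = inner ℂ p (scal μ (phi b t) (abs_phi_le b t) q) -
        inner ℂ p (implOp μ e b t q - f) := by
      rw [inner_sub_right, h1]; ring
    have h5 := congrArg norm (h3.trans h4)
    rw [Complex.norm_real, Real.norm_of_nonneg (sq_nonneg _)] at h5
    rw [h5]
    refine (norm_sub_le _ _).trans (add_le_add ?_ ?_)
    · refine (norm_inner_le_norm _ _).trans ?_
      exact mul_le_mul_of_nonneg_left (norm_scal_phi_le μ e b t hq hd hqd) (norm_nonneg _)
    · refine (norm_inner_le_norm _ _).trans ?_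
      exact mul_le_mul_of_nonneg_left hfq (norm_nonneg _)
  by_contra h
  push Not at h
  have : 0 ≤ c := (norm_nonneg _).trans hfq
  nlinarith

variable {μ e} in
theorem norm_mul_unitary_apply_le {x y : Space Γ μ ι →L[ℂ] Space Γ μ ι} (hx : x ∈ algMtilde μ e π)
    (hy : y ∈ algMtilde μ e π) (hy1 : ‖y‖ ≤ 1) : ‖x (y (vacuum μ))‖ ≤ ‖x (vacuum μ)‖ :=
  (norm_mul_vacuum_le μ e hx hy).trans (mul_le_of_le_one_left (norm_nonneg _) hy1)

/-- From a T a* - v T v* = (a - v) T a* + v T (a - v)*, where each term has 2-norm at most c. It is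
meant for a = α_t(v). -/
theorem norm_conj_sub_conj_le {a v T : Space Γ μ ι →L[ℂ] Space Γ μ ι}
    (ha : a ∈ algMtilde μ e π) (hv : v ∈ algMtilde μ e π) (hT : T ∈ algMtilde μ e π)
    (ha1 : ‖a‖ ≤ 1) (hv1 : ‖v‖ ≤ 1) (hT1 : ‖T‖ ≤ 1) {c : ℝ}
    (hav : ‖a (vacuum μ) - v (vacuum μ)‖ ≤ c) :
    ‖a (T (star a (vacuum μ))) - v (T (star v (vacuum μ)))‖ ≤ 2 * c := by
  have h1 : a (T (star a (vacuum μ))) - v (T (star v (vacuum μ))) =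
      (a - v) ((T * star a) (vacuum μ)) + (v * T) (star (a - v) (vacuum μ)) := by
    change _ = (a - v) (T (star a (vacuum μ))) + v (T (star (a - v) (vacuum μ)))
    rw [star_sub, sub_apply, sub_apply, map_sub, map_sub]
    abel
  have h2 : ‖T * star a‖ ≤ 1 :=
    (norm_mul_le _ _).trans (mul_le_one₀ hT1 (norm_nonneg _) ((norm_star a).trans_le ha1))
  have h3 : ‖v * T‖ ≤ 1 := (norm_mul_le _ _).trans (mul_le_one₀ hv1 (norm_nonneg _) hT1)
  have h4 := norm_mul_unitary_apply_le (sub_mem ha hv) (mul_mem hT (star_mem ha)) h2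
  have h5 := (v * T).le_of_opNorm_le h3 (star (a - v) (vacuum μ))
  rw [norm_star_vacuum μ e (sub_mem ha hv), one_mul] at h5
  rw [← sub_apply] at hav
  rw [h1]
  exact (norm_add_le _ _).trans (by linarith)

theorem inner_conj_vacuum {v x T : Space Γ μ ι →L[ℂ] Space Γ μ ι}
    (hv : v ∈ algMtilde μ e π) (hx : x ∈ algMtilde μ e π) (hT : T ∈ algMtilde μ e π)
    (hvu : star v * v = 1) :
    inner ℂ (v (x (star v (vacuum μ)))) (v (T (star v (vacuum μ)))) =
      inner ℂ (x (vacuum μ)) (T (vacuum μ)) := by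
  have h1 := inner_vacuum_eq_trace μ (v * x * star v) (v * T * star v)
  have h2 : star (v * x * star v) * (v * T * star v) = v * (star x * T * star v) := by
    rw [star_mul, star_mul, star_star]
    calc v * (star x * star v) * (v * T * star v) =
        v * (star x * (star v * v) * T * star v) := by simp only [mul_assoc]
      _ = _ := by rw [hvu, mul_one]
  rw [h2, trace_mul_comm μ e π hv (mul_mem (mul_mem (star_mem hx) hT) (star_mem hv)),
    mul_assoc (star x * T) (star v) v, hvu, mul_one] at h1
  exact h1.trans (inner_vacuum_eq_trace μ x T).symm

theorem commute_conj {W x y : Space Γ μ ι →L[ℂ] Space Γ μ ι} (hW : star W * W = 1)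
    (h : x * y = y * x) :
    (W * x * star W) * (W * y * star W) = (W * y * star W) * (W * x * star W) := by
  have h1 : ∀ x y : Space Γ μ ι →L[ℂ] Space Γ μ ι,
      (W * x * star W) * (W * y * star W) = W * (x * y) * star W := by
    intro x y
    calc _ = W * x * (star W * W) * y * star W := by simp only [mul_assoc]
      _ = _ := by rw [hW, mul_one]; simp only [mul_assoc]
  rw [h1, h1, h]

/-- The two products `α_t(x) α_t(v x v*)` and `α_t(v x v*) α_t(x)` are approximated by `α_t(x) y`
and `y α_t(x)`, where `y` is close to `v α_t(x) v*`. -/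
theorem approx_products (t : ℝ) {v x x₀ y : Space Γ μ ι →L[ℂ] Space Γ μ ι}
    (hv : v ∈ algMtilde μ e π) (hvu : v ∈ unitary (Space Γ μ ι →L[ℂ] Space Γ μ ι))
    (hx : x ∈ algMtilde μ e π) (hxu : x ∈ unitary (Space Γ μ ι →L[ℂ] Space Γ μ ι))
    (hx₀ : x₀ ∈ algMtilde μ e π) (hx₀2 : ‖x₀‖ ≤ 2) (hy : y ∈ algMtilde μ e π)
    (hvt : ‖implOp μ e b t (v (vacuum μ)) - v (vacuum μ)‖ ≤ 1 / 200)
    (hxx : ‖x (vacuum μ) - x₀ (vacuum μ)‖ ≤ 1 / 1000)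
    (hcomm : x * (v * x * star v) = (v * x * star v) * x)
    (hvy : ‖v ((implOp μ e b t * x * star (implOp μ e b t)) (star v (vacuum μ))) -
      y (vacuum μ)‖ ≤ 1 / 1000) :
    ‖implOp μ e b t ((v * x * star v) (vacuum μ)) - y (vacuum μ)‖ ≤ 11 / 1000 ∧
    (inner ℂ ((v * x * star v) (vacuum μ)) (implOp μ e b t ((v * x * star v) (vacuum μ)))).re ≤
      (inner ℂ (x (vacuum μ)) (implOp μ e b t (x (vacuum μ)))).re + 1 / 100 ∧
    ∃ f : Space Γ μ ι, ‖f‖ = 1 ∧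
      ‖f - implOp μ e b t (x₀ (star (implOp μ e b t) (y (vacuum μ))))‖ ≤ 13 / 1000 ∧
      ‖f - y (implOp μ e b t (x₀ (vacuum μ)))‖ ≤ 13 / 1000 := by
  set W := implOp μ e b t with hW
  have hWu : W ∈ unitary (Space Γ μ ι →L[ℂ] Space Γ μ ι) := implOp_mem_unitary μ e b t
  have hWW : star W * W = 1 := Unitary.star_mul_self_of_mem hWu
  have hW1 : ‖W‖ ≤ 1 := norm_le_one_of_mem_unitary hWu
  have hWs : ‖star W‖ ≤ 1 := (norm_star W).trans_le hW1
  have hconj : ∀ z : Space Γ μ ι →L[ℂ] Space Γ μ ι, (W * z * star W) (vacuum μ) =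
      W (z (vacuum μ)) := conj_vacuum μ e b t
  have hcM : ∀ z ∈ algMtilde μ e π, W * z * star W ∈ algMtilde μ e π := fun z hz =>
    implOp_conj_mem μ e b t hz
  have hcu : ∀ z ∈ unitary (Space Γ μ ι →L[ℂ] Space Γ μ ι),
      W * z * star W ∈ unitary (Space Γ μ ι →L[ℂ] Space Γ μ ι) := fun z hz =>
    mul_mem (mul_mem hWu hz) (Unitary.star_mem hWu)
  set U := W * x * star W with hU
  have hUM : U ∈ algMtilde μ e π := hcM x hx
  have hUu : U ∈ unitary (Space Γ μ ι →L[ℂ] Space Γ μ ι) := hcu x hxu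
  have hU1 : ‖U‖ ≤ 1 := norm_le_one_of_mem_unitary hUu
  set U₀ := W * x₀ * star W with hU₀
  have hU₀M : U₀ ∈ algMtilde μ e π := hcM x₀ hx₀
  have hU₀2 : ‖U₀‖ ≤ 2 := by
    calc ‖U₀‖ ≤ ‖W‖ * ‖x₀‖ * ‖star W‖ :=
          (norm_mul_le _ _).trans (by gcongr; exact norm_mul_le _ _)
      _ ≤ 1 * 2 * 1 := by gcongr
      _ = 2 := by norm_num
  have hUU₀ : ‖(U - U₀) (vacuum μ)‖ ≤ 1 / 1000 := by
    rw [sub_apply, hconj, hconj, ← map_sub]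
    exact (W.le_of_opNorm_le hW1 _).trans (by rwa [one_mul])
  set x₁ := v * x * star v with hx₁
  have hx₁M : x₁ ∈ algMtilde μ e π := mul_mem (mul_mem hv hx) (star_mem hv)
  have hx₁u : x₁ ∈ unitary (Space Γ μ ι →L[ℂ] Space Γ μ ι) :=
    mul_mem (mul_mem hvu hxu) (Unitary.star_mem hvu)
  set U₁ := W * x₁ * star W with hU₁
  have hU₁M : U₁ ∈ algMtilde μ e π := hcM x₁ hx₁M
  have hU₁u : U₁ ∈ unitary (Space Γ μ ι →L[ℂ] Space Γ μ ι) := hcu x₁ hx₁u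
  set η := v * U * star v with hη
  have hηM : η ∈ algMtilde μ e π := mul_mem (mul_mem hv hUM) (star_mem hv)
  have hη1 : ‖η‖ ≤ 1 :=
    norm_le_one_of_mem_unitary (mul_mem (mul_mem hvu hUu) (Unitary.star_mem hvu))
  -- α_t(v x v*) is the conjugate of α_t(x) by α_t(v), and α_t(v) is within 1/200 of v.
  have hU₁η : ‖(U₁ - η) (vacuum μ)‖ ≤ 1 / 100 := by
    have h1 := norm_conj_sub_conj_le μ e (hcM v hv) hv hUM
      (norm_le_one_of_mem_unitary (hcu v hvu)) (norm_le_one_of_mem_unitary hvu) hU1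
      (c := 1 / 200) (by rw [hconj]; exact hvt)
    have h2 : U₁ = (W * v * star W) * U * star (W * v * star W) := by
      rw [hU₁, hx₁, hU, star_mul, star_mul, star_star]
      calc W * (v * x * star v) * star W = W * v * 1 * x * 1 * star v * star W := by
            simp only [mul_assoc, one_mul]
        _ = _ := by rw [← hWW]; simp only [mul_assoc]
    rw [h2, hη]
    exact h1.trans (by norm_num)
  have hηy : ‖(η - y) (vacuum μ)‖ ≤ 1 / 1000 := hvy
  -- The vector is α_t(x) α_t(v x v*) Ω. In either order of the factors the errors are 1/100 from U₁
  -- to η, 1/1000 from U to U₀, and 2 · 1/1000 from η to y, where 2 bounds ‖U₀‖.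
  refine ⟨?_, ?_, U (U₁ (vacuum μ)), ?_, ?_, ?_⟩
  · rw [← hconj]
    have h1 : U₁ (vacuum μ) - y (vacuum μ) = (U₁ - η) (vacuum μ) + (η - y) (vacuum μ) := by
      simp only [sub_apply]; abel
    rw [h1]
    exact (norm_add_le _ _).trans (by linarith)
  · rw [← hconj, ← hconj]
    have h1 := inner_conj_vacuum μ e hv hx hUM (Unitary.star_mul_self_of_mem hvu)
    have h2 : ‖x₁ (vacuum μ)‖ ≤ 1 := by
      rw [x₁.norm_map_of_mem_unitary hx₁u, norm_vacuum]
    refine re_inner_le_add h2 hU₁η (le_of_eq ?_)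
    exact congrArg Complex.re h1
  · rw [U.norm_map_of_mem_unitary hUu, U₁.norm_map_of_mem_unitary hU₁u, norm_vacuum]
  · have h1 : U (U₁ (vacuum μ)) - U₀ (y (vacuum μ)) = U ((U₁ - η) (vacuum μ)) +
        (U - U₀) (η (vacuum μ)) + U₀ ((η - y) (vacuum μ)) := by
      simp only [sub_apply, map_sub]; abel
    have h2 := U.le_of_opNorm_le hU1 ((U₁ - η) (vacuum μ))
    have h3 := norm_mul_unitary_apply_le (sub_mem hUM hU₀M) hηM hη1
    have h4 := U₀.le_of_opNorm_le hU₀2 ((η - y) (vacuum μ))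
    change ‖U (U₁ (vacuum μ)) - U₀ (y (vacuum μ))‖ ≤ _
    rw [h1]
    exact norm_add₃_le.trans (by linarith)
  · have h0 : U (U₁ (vacuum μ)) = U₁ (U (vacuum μ)) :=
      congrArg (fun T : Space Γ μ ι →L[ℂ] Space Γ μ ι => T (vacuum μ))
        (commute_conj μ hWW hcomm)
    have h1 : U₁ (U (vacuum μ)) - y (U₀ (vacuum μ)) = (U₁ - η) (U (vacuum μ)) +
        η ((U - U₀) (vacuum μ)) + (η - y) (U₀ (vacuum μ)) := by
      simp only [sub_apply, map_sub]; abel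
    have h2 := norm_mul_unitary_apply_le (sub_mem hU₁M hηM) hUM hU1
    have h3 := η.le_of_opNorm_le hη1 ((U - U₀) (vacuum μ))
    have h4 := (norm_mul_vacuum_le μ e (sub_mem hηM hy) hU₀M).trans
      (mul_le_mul_of_nonneg_right hU₀2 (norm_nonneg _))
    rw [h0, ← hconj, h1]
    exact norm_add₃_le.trans (by linarith)

end Estimate

end GaussianDeformation

end

namespace GaussianDeformation

/-! ### The lower bound for τ(x* α_t(x)) -/

section LowerBound

variable {Γ X ι H : Type*} [MeasurableSpace X] (μ : Measure X)
  [IsProbabilityMeasure μ] [NormedAddCommGroup H] [InnerProductSpace ℝ H] [Group Γ]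
  [MulAction Γ X] [MeasurableConstSMul Γ X] [SMulInvariantMeasure Γ X μ]
  (e : HilbertBasis ι ℝ H) {π : Γ →* (H ≃ₗᵢ[ℝ] H)} (b : Cocycle π)

/-- If `τ(x* α_t(x))` is small, then `α_t(x₀) y Ω` is almost orthogonal to all vectors orthogonal
to `K`. -/
theorem norm_inner_compression_le (t : ℝ) {x x₀ x₁ y η : Space Γ μ ι →L[ℂ] Space Γ μ ι}
    {K : Submodule ℝ H} (hx1 : ‖x (vacuum μ)‖ ≤ 1)
    (hx₀ : x₀ (vacuum μ) ∈ vecSpan μ e π ⊥) (hx₁M : x₁ ∈ algMtilde μ e π)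
    (hx₁ : x₁ (vacuum μ) = scal μ (phi b t) (abs_phi_le b t) (x₀ (vacuum μ)))
    (hK : ∀ f ∈ vecSpan μ e π Kᗮ, ∀ k ∈ vecSpan μ e π Kᗮ,
      inner ℂ (implOp μ e b t (x₀ (star (implOp μ e b t) f))) k = inner ℂ (x₁ f) k)
    (hxx : ‖x (vacuum μ) - x₀ (vacuum μ)‖ ≤ 1 / 1000)
    (hτ : (inner ℂ (x (vacuum μ)) (implOp μ e b t (x (vacuum μ)))).re ≤ 1 / 1000)
    (hη : η ∈ algMtilde μ e π) (hη1 : ‖η‖ ≤ 1)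
    (hηy : ‖x₁‖ * ‖η (vacuum μ) - y (vacuum μ)‖ ≤ 1 / 1000)
    (hy : y (vacuum μ) ∈ vecSpan μ e π Kᗮ) {k : Space Γ μ ι} (hk : k ∈ vecSpan μ e π Kᗮ) :
    ‖inner ℂ (implOp μ e b t (x₀ (star (implOp μ e b t) (y (vacuum μ))))) k‖ ≤
      71 / 1000 * ‖k‖ := by
  set W := implOp μ e b t with hW
  have hWn : ∀ f, ‖W f‖ = ‖f‖ := W.norm_map_of_mem_unitary (implOp_mem_unitary μ e b t)
  -- Replacing x by x₀ costs 1/1000 in one argument and 2/1000 in the other, where the fixed vector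
  -- W x₀ Ω has norm at most 2. The total 4/1000 is below (7/100)².
  have h1 : (inner ℂ (x₀ (vacuum μ)) (W (x₀ (vacuum μ)))).re ≤ (7 / 100) ^ 2 := by
    have h2 : (inner ℂ (x (vacuum μ)) (W (x₀ (vacuum μ)))).re ≤ 1 / 1000 + 1 / 1000 :=
      re_inner_le_add hx1 (by rw [← map_sub, hWn, norm_sub_rev]; exact hxx) hτ
    have h3 : (inner ℂ (W (x₀ (vacuum μ))) (x₀ (vacuum μ))).re ≤
        (1 / 1000 + 1 / 1000) + 2 / 1000 := by
      have h4 : ‖W (x₀ (vacuum μ))‖ ≤ 2 := by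
        rw [hWn]
        have := norm_sub_norm_le (x₀ (vacuum μ)) (x (vacuum μ))
        rw [norm_sub_rev] at this
        linarith
      -- The factor 1/2 brings W x₀ Ω into the unit ball.
      have h5 : (inner ℂ ((2⁻¹ : ℂ) • W (x₀ (vacuum μ))) (x₀ (vacuum μ))).re ≤
          1 / 1000 + 1 / 1000 := by
        refine re_inner_le_add (g := x (vacuum μ)) (c := 1 / 1000) (d := 1 / 1000) ?_ ?_ ?_
        · rw [norm_smul]
          norm_num
          linarith
        · rwa [norm_sub_rev]
        · have h6 := inner_re_symm (𝕜 := ℂ) (W (x₀ (vacuum μ))) (x (vacuum μ))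
          simp only [RCLike.re_eq_complex_re] at h6
          rw [inner_smul_left]
          norm_num
          rw [h6]
          linarith
      rw [inner_smul_left] at h5
      norm_num at h5
      linarith
    have h6 := inner_re_symm (𝕜 := ℂ) (W (x₀ (vacuum μ))) (x₀ (vacuum μ))
    simp only [RCLike.re_eq_complex_re] at h6
    rw [← h6]
    exact h3.trans (by norm_num)
  rw [hK _ hy k hk]
  refine (norm_inner_le_norm _ _).trans (mul_le_mul_of_nonneg_right ?_ (norm_nonneg _))
  have h7 : ‖x₁ (vacuum μ)‖ ≤ 7 / 100 := by
    rw [hx₁]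
    exact norm_scal_phi_le μ e b t hx₀ (by norm_num) h1
  have h8 := norm_mul_unitary_apply_le hx₁M hη hη1
  have h9 := x₁.le_opNorm (η (vacuum μ) - y (vacuum μ))
  -- On η, a contraction multiplying from the right, the 2-norm of x₁ suffices. On η - y only the
  -- operator norm of x₁ is available, which is why y is chosen after x₁.
  have h10 : x₁ (y (vacuum μ)) = x₁ (η (vacuum μ)) - x₁ (η (vacuum μ) - y (vacuum μ)) := by
    rw [map_sub]; abel
  rw [h10]
  exact (norm_sub_le _ _).trans (by linarith)

/-- The lower bound for `τ(x* α_t(x))` in the presence of unitaries `v n` with small Fourier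
coefficients, almost fixed by `α_t`, such that `x` commutes with `v n x (v n)*`. -/
theorem le_inner_implOp
    (hπ : ∀ ξ η : H, Tendsto (fun g : Γ => inner ℝ (π g ξ) η) cofinite (𝓝 0)) (t : ℝ)
    {v : ℕ → Space Γ μ ι →L[ℂ] Space Γ μ ι} (hv : ∀ n, v n ∈ algM Γ μ ι)
    (hvu : ∀ n, v n ∈ unitary (Space Γ μ ι →L[ℂ] Space Γ μ ι))
    (hv0 : ∀ g, Tendsto (fun n => ‖v n (vacuum μ) g‖) atTop (𝓝 0))
    (hvt : ∀ n, ‖implOp μ e b t (v n (vacuum μ)) - v n (vacuum μ)‖ ≤ 1 / 200)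
    {x : Space Γ μ ι →L[ℂ] Space Γ μ ι} (hx : x ∈ algM Γ μ ι)
    (hxu : x ∈ unitary (Space Γ μ ι →L[ℂ] Space Γ μ ι))
    (hxe : ∃ y ∈ genSpan μ e π ⊥, ‖y‖ ≤ 2 ∧ ‖x (vacuum μ) - y (vacuum μ)‖ < 1 / 1000)
    (hcomm : ∀ n, x * (v n * x * star (v n)) = (v n * x * star (v n)) * x) :
    1 / 1000 ≤ (inner ℂ (x (vacuum μ)) (implOp μ e b t (x (vacuum μ)))).re := by
  by_contra! hτ
  obtain ⟨x₀, hx₀, hx₀2, hxx⟩ := hxe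
  have hx₀M := genSpan_le_algMtilde μ e π hx₀
  obtain ⟨K₀, _, x₁, hx₁, hx₁φ, hK₀⟩ := exists_compression μ e b t hx₀
  obtain ⟨F, hF⟩ := exists_finset_close μ e b hπ t K₀ hx₀ (1 / 1000) (by norm_num)
  -- K₀ serves the compression of α_t(x₀) and determines F; adding b(F) makes the part of y over F
  -- small.
  set K : Submodule ℝ H := K₀ ⊔ Submodule.span ℝ (b.toFun '' F) with hK
  have : FiniteDimensional ℝ (Submodule.span ℝ (b.toFun '' F)) :=
    FiniteDimensional.span_of_finite ℝ (F.finite_toSet.image _)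
  have hKF : ∀ g ∈ F, ∀ ξ ∈ Kᗮ, inner ℝ (b.toFun g) ξ = 0 := fun g hg ξ hξ =>
    (Submodule.mem_orthogonal _ _).1 hξ _
      (Submodule.mem_sup_right (Submodule.subset_span ⟨g, hg, rfl⟩))
  have hKK : vecSpan μ e π Kᗮ ≤ vecSpan μ e π K₀ᗮ :=
    vecSpan_mono μ e (Submodule.orthogonal_le le_sup_left)
  have hxM : x ∈ algMtilde μ e π := algM_le μ e hx
  set U := implOp μ e b t * x * star (implOp μ e b t) with hU
  have hUM : U ∈ algMtilde μ e π := implOp_conj_mem μ e b t hxM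
  have hUu : U ∈ unitary (Space Γ μ ι →L[ℂ] Space Γ μ ι) :=
    mul_mem (mul_mem (implOp_mem_unitary μ e b t) hxu)
      (Unitary.star_mem (implOp_mem_unitary μ e b t))
  -- The tolerance absorbs the operator norm of x₁, for which there is no universal bound.
  obtain ⟨n, y, hy, hyd⟩ := (eventually_conj_close μ e hπ K hv
    (fun n => norm_le_one_of_mem_unitary (hvu n)) hv0 hUM
    (ε := 1 / (1000 * (‖x₁‖ + 1))) (by positivity)).exists
  have hvM : v n ∈ algMtilde μ e π := algM_le μ e (hv n)
  have hyM := genSpan_le_algMtilde μ e π hy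
  have hyΩ := mem_vecSpan_of_genSpan μ e hy
  have hyd1 : ‖v n (U (star (v n) (vacuum μ))) - y (vacuum μ)‖ ≤ 1 / 1000 := by
    refine hyd.le.trans ?_
    gcongr
    linarith [norm_nonneg x₁]
  have hyd2 : ‖x₁‖ * ‖v n (U (star (v n) (vacuum μ))) - y (vacuum μ)‖ ≤ 1 / 1000 := by
    calc _ ≤ (‖x₁‖ + 1) * (1 / (1000 * (‖x₁‖ + 1))) := by
          gcongr
          linarith
      _ = 1 / 1000 := by field_simp
  obtain ⟨h1, h2, f, hf, h3, h4⟩ := approx_products μ e b t hvM (hvu n) hxM hxu hx₀M hx₀2 hyM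
    (hvt n) hxx.le (hcomm n) hyd1
  set q := (v n * x * star (v n)) (vacuum μ) with hq
  have hqV : q ∈ vecSpan μ e π ⊥ :=
    vacuum_mem_of_algM μ e (mul_mem (mul_mem (hv n) hx) (star_mem (hv n)))
  -- τ(q* α_t(q)) is read off from q = v x v* Ω: it is at most 1/1000 + 1/100, below (11/100)².
  have hind := norm_scal_ind_le μ e b t hKF hyΩ hqV (d := 11 / 100) (by norm_num) h1
    (h2.trans (by linarith))
  obtain ⟨y₁, hy₁, hy₁Ω⟩ := exists_scal_vacuum μ e (abs_ind_le F) hy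
  rw [← hy₁Ω] at hind
  have hy₁M := genSpan_le_algMtilde μ e π hy₁
  have hyn : ‖y (vacuum μ)‖ ≤ 3 / 2 := by
    have h5 := norm_sub_norm_le (y (vacuum μ)) (implOp μ e b t q)
    rw [norm_sub_rev, (implOp μ e b t).norm_map_of_mem_unitary (implOp_mem_unitary μ e b t), hq,
      (v n * x * star (v n)).norm_map_of_mem_unitary
        (mul_mem (mul_mem (hvu n) hxu) (Unitary.star_mem (hvu n))), norm_vacuum] at h5
    linarith
  -- y - y₁ is y with its coefficients over F deleted, so y α_t(x₀) Ω is within 2 · (121/1000) +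
  -- 1/1000 of a vector k orthogonal to K₀.
  obtain ⟨k, hk, hkd⟩ := hF (y - y₁) (sub_mem hyM hy₁M)
    (hKK (sub_mem hyΩ (mem_vecSpan_of_genSpan μ e hy₁)))
    (by rw [sub_apply]; exact (norm_sub_le _ _).trans (by linarith))
    (fun g hg => by
      rw [sub_apply, hy₁Ω, lp.coeFn_sub, Pi.sub_apply, scal_ind_apply μ F _ hg, sub_self])
  have hx₀W : implOp μ e b t (x₀ (vacuum μ)) =
      (implOp μ e b t * x₀ * star (implOp μ e b t)) (vacuum μ) := (conj_vacuum μ e b t x₀).symm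
  have hU₀2 : ‖implOp μ e b t * x₀ * star (implOp μ e b t)‖ ≤ 2 := by
    have hW1 := norm_le_one_of_mem_unitary (implOp_mem_unitary μ e (π := π) b t)
    calc _ ≤ ‖implOp μ e b t‖ * ‖x₀‖ * ‖star (implOp μ e b t)‖ :=
          (norm_mul_le _ _).trans (by gcongr; exact norm_mul_le _ _)
      _ ≤ 1 * 2 * 1 := by
          gcongr
          exact (norm_star _).trans_le hW1
      _ = 2 := by norm_num
  have h5 : ‖y₁ (implOp μ e b t (x₀ (vacuum μ)))‖ ≤ 2 * (11 / 100 + 11 / 1000) := by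
    rw [hx₀W]
    exact (norm_mul_vacuum_le μ e hy₁M (implOp_conj_mem μ e b t hx₀M)).trans
      (mul_le_mul hU₀2 hind (norm_nonneg _) (by norm_num))
  have h6 : ‖f - k‖ ≤ 3 / 10 := by
    have h7 : f - k = (f - y (implOp μ e b t (x₀ (vacuum μ)))) +
        y₁ (implOp μ e b t (x₀ (vacuum μ))) +
        ((y - y₁) (implOp μ e b t (x₀ (vacuum μ))) - k) := by
      rw [sub_apply]; abel
    rw [h7]
    exact norm_add₃_le.trans (by linarith)
  have h7 : ‖k‖ ≤ 13 / 10 := by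
    have := norm_sub_norm_le k f
    rw [norm_sub_rev, hf] at this
    linarith
  -- The inner product of α_t(x₀) y Ω with k is at least 1 - 0.3 - 0.013 · 1.3 > 0.68, whereas
  -- compression bounds it by 0.071 · 1.3 < 0.1.
  have h8 := norm_inner_ge hf h3 h6
  have h9 := norm_inner_compression_le μ e b t (x := x) (η := v n * U * star (v n))
    (by rw [x.norm_map_of_mem_unitary hxu, norm_vacuum])
    (mem_vecSpan_of_genSpan μ e hx₀) (genSpan_le_algMtilde μ e π hx₁) hx₁φ hK₀ hxx.le hτ.le
    (mul_mem (mul_mem hvM hUM) (star_mem hvM))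
    (norm_le_one_of_mem_unitary (mul_mem (mul_mem (hvu n) hUu) (Unitary.star_mem (hvu n))))
    hyd2 (hKK hyΩ) hk
  linarith

end LowerBound

end GaussianDeformation

/-! ### From the unitaries exp(ih) to B, and the conclusion -/

namespace GaussianDeformation

/-- The normalizer is defined by u* B u = B; the equality, not just the inclusion, gives u B u* ⊂ B.
-/
theorem conj_mem_of_mem_normalizer {E : Type*} [NormedAddCommGroup E] [InnerProductSpace ℂ E]
    [CompleteSpace E] {N B : VonNeumannAlgebra E} {u x : E →L[ℂ] E} (hu : u ∈ normalizer N B)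
    (hx : x ∈ B) : u * x * star u ∈ B := by
  obtain ⟨_, hu1, hu2⟩ := hu
  have h : x ∈ (fun x => star u * x * u) '' (B : Set (E →L[ℂ] E)) := by rwa [hu2]
  obtain ⟨y, hy, rfl⟩ := h
  have h1 : u * (star u * y * u) * star u = y := by
    calc _ = (u * star u) * y * (u * star u) := by simp only [mul_assoc]
      _ = y := by rw [Unitary.mul_star_self_of_mem hu1, one_mul, mul_one]
  exact h1.symm ▸ hy

/-- An operator that intertwines the unitaries `exp(ih)`, `h = h* ∈ B`, intertwines `B`. -/
theorem intertwines_of_exp_selfAdjoint {E : Type*} [NormedAddCommGroup E] [InnerProductSpace ℂ E]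
    [CompleteSpace E] {B : VonNeumannAlgebra E} {V V' w : E →L[ℂ] E}
    (h : ∀ k ∈ B, IsSelfAdjoint k →
      V * NormedSpace.exp (Complex.I • k) * V' * w = w * NormedSpace.exp (Complex.I • k))
    {x : E →L[ℂ] E} (hx : x ∈ B) : V * x * V' * w = w * x := by
  have hsa : ∀ k ∈ B, IsSelfAdjoint k → V * k * V' * w = w * k := by
    intro k hk hsk
    have h1 : V * (Complex.I • k) * V' * w = w * (Complex.I • k) := by
      refine intertwines_of_exp fun s => ?_
      have hs : IsSelfAdjoint ((s : ℂ) • k) := by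
        rw [IsSelfAdjoint, star_smul, hsk.star_eq, Complex.star_def, Complex.conj_ofReal]
      rw [← Complex.coe_smul, smul_comm (s : ℂ) Complex.I k]
      exact h _ (SMulMemClass.smul_mem _ hk) hs
    simp only [mul_smul_comm, smul_mul_assoc] at h1
    exact smul_right_injective _ Complex.I_ne_zero h1
  -- Both x + x* and i(x - x*) are self-adjoint, and they span x.
  have h1 := hsa (x + star x) (add_mem hx (star_mem hx)) (IsSelfAdjoint.add_star_self x)
  have h2 := hsa (Complex.I • (x - star x)) (SMulMemClass.smul_mem _ (sub_mem hx (star_mem hx))) (by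
    rw [IsSelfAdjoint, star_smul, star_sub, star_star, Complex.star_def, Complex.conj_I, neg_smul,
      ← smul_neg, neg_sub])
  simp only [mul_smul_comm, smul_mul_assoc] at h2
  have h3 := smul_right_injective (E →L[ℂ] E) Complex.I_ne_zero h2
  have h4 : V * x * V' * w = (2⁻¹ : ℂ) • (V * (x + star x) * V' * w +
      V * (x - star x) * V' * w) := by
    simp only [mul_add, mul_sub, add_mul, sub_mul]
    module
  have h5 : w * x = (2⁻¹ : ℂ) • (w * (x + star x) + w * (x - star x)) := by
    simp only [mul_add, mul_sub]
    module
  rw [h4, h5, h1, h3]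

end GaussianDeformation

theorem theorem5p1
    {Γ : Type*} [Group Γ] [Countable Γ]
    {X : Type*} [MeasurableSpace X] [StandardBorelSpace X]
    (μ : Measure X) [IsProbabilityMeasure μ]
    [MulAction Γ X] [MeasurableConstSMul Γ X] [SMulInvariantMeasure Γ X μ]
    {H : Type*} [NormedAddCommGroup H] [InnerProductSpace ℝ H] [CompleteSpace H]
    {ι : Type*} (e : HilbertBasis ι ℝ H)
    (π : Γ →* (H ≃ₗᵢ[ℝ] H))
    (hπ : ∀ ξ η : H, Tendsto (fun g : Γ => inner ℝ (π g ξ) η) cofinite (𝓝 0))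
    (b : Cocycle π)
    (B : VonNeumannAlgebra (Space Γ μ ι)) (hBM : B ≤ algM Γ μ ι)
    (hB : ∀ x ∈ B, ∀ y ∈ B, x * y = y * x)
    (t : ℝ) (ht : 0 < t)
    (v : ℕ → algMtilde μ e π)
    (hv : ∀ n, (v n : Space Γ μ ι →L[ℂ] Space Γ μ ι) ∈ normalizer (algM Γ μ ι) B)
    (ha : ∀ n, norm2 μ (deformation μ e b t (v n) - v n : algMtilde μ e π).1 < 1 / 200)
    (hb : ∀ g : Γ, Tendsto (fun n => ‖fourierCoefficient μ (v n).1 g‖) atTop (𝓝 0)) :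
    ∃ w : algMtilde μ e π, w ≠ 0 ∧ IsStarProjection (star w * w) ∧
      ∀ x : algMtilde μ e π, (x : Space Γ μ ι →L[ℂ] Space Γ μ ι) ∈ B →
        deformation μ e b t x * w = w * x := by
  set W := implOp μ e b t with hW
  have hvM : ∀ n, (v n : Space Γ μ ι →L[ℂ] Space Γ μ ι) ∈ algM Γ μ ι := fun n => (hv n).1
  have hvu := fun n => (hv n).2.1
  have hv0 : ∀ g, Tendsto (fun n => ‖(v n).1 (vacuum μ) g‖) atTop (𝓝 0) := fun g =>
    squeeze_zero (fun n => norm_nonneg _)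
      (fun n => norm_apply_le_fourierCoefficient μ e π (hvM n) g) (hb g)
  have hvt : ∀ n, ‖W ((v n).1 (vacuum μ)) - (v n).1 (vacuum μ)‖ ≤ 1 / 200 := by
    intro n
    have h1 := ha n
    rw [norm2_eq] at h1
    rw [← conj_vacuum μ e b t]
    exact h1.le
  let G : Set (Space Γ μ ι →L[ℂ] Space Γ μ ι) :=
    {x | ∃ h ∈ B, IsSelfAdjoint h ∧ x = NormedSpace.exp (Complex.I • h)}
  have hGB : ∀ x ∈ G, x ∈ B := by
    rintro _ ⟨h, hh, _, rfl⟩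
    exact exp_mem B (SMulMemClass.smul_mem _ hh)
  have hGu : ∀ x ∈ G, x ∈ unitary (Space Γ μ ι →L[ℂ] Space Γ μ ι) := by
    rintro _ ⟨h, _, hs, rfl⟩
    exact exp_I_smul_mem_unitary hs
  have hGmul : ∀ x ∈ G, ∀ y ∈ G, x * y ∈ G := by
    rintro _ ⟨h, hh, hs, rfl⟩ _ ⟨k, hk, hsk, rfl⟩
    refine ⟨h + k, add_mem hh hk, hs.add hsk, ?_⟩
    exact congrArg Subtype.val (Commute.expUnitary_add (a := ⟨h, hs⟩) (b := ⟨k, hsk⟩)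
      (hB h hh k hk)).symm
  obtain ⟨w, hwM, hw0, hw⟩ := exists_intertwiner μ e b t (G := G)
    ⟨1, 0, zero_mem B, IsSelfAdjoint.zero _, by rw [smul_zero, NormedSpace.exp_zero]⟩
    (fun x hx => algM_le μ e (hBM (hGB x hx))) hGu hGmul (δ := 1 / 1000) (by norm_num)
    (fun x hx => by
      refine le_inner_implOp μ e b hπ t hvM hvu hv0 hvt (hBM (hGB x hx)) (hGu x hx) ?_ ?_
      · obtain ⟨h, hh, hs, rfl⟩ := hx
        exact exists_genSpan_approx_exp μ e π (hBM hh) hs (by norm_num)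
      -- Both x and v_n x v_n* lie in the abelian algebra B.
      · exact fun n => hB x (hGB x hx) _ (conj_mem_of_mem_normalizer (hv n) (hGB x hx)))
  have hwB : ∀ x ∈ B, W * x * star W * w = w * x := fun x hx =>
    intertwines_of_exp_selfAdjoint (fun k hk hs => hw _ ⟨k, hk, hs, rfl⟩) hx
  obtain ⟨p, hpM, hp0, hpp, hp⟩ := exists_partialIsometry_mem (algMtilde μ e π) hwM hw0
  refine ⟨⟨p, hpM⟩, fun h => hp0 (congrArg Subtype.val h),
    ⟨Subtype.ext hpp.1, Subtype.ext hpp.2⟩, fun x hx => Subtype.ext ?_⟩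
  refine hp x (W * x * star W) (hwB x hx) ?_
  -- The adjoint relation required by the polar decomposition is the relation for x* ∈ B.
  rw [star_mul, star_mul, star_star, ← mul_assoc]
  exact hwB _ (star_mem hx)
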